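/- **Setting.** Let $R$ be a commutative ring with $1\neq 0$ and let $\Gamma$ be a (discrete) group with identity $\varepsilon$. Let $\mathcal G$ be an *ample groupoid*: a topological groupoid with unit space $\mathcal G^{(0)}$ and domain and codomain maps $\mathbf d,\mathbf c$ (the product $gh$ is defined when $\mathbf d(g)=\mathbf c(h)$), such that $\mathbf d:\mathcal G\to\mathcal G^{(0)}$ is a local homeomorphism, $\mathcal G^{(0)}$ is Hausdorff, and the topology of $\mathcal G$ has a basis of compact open bisections (compact open sets on which $\mathbf d$ and $\mathbf c$ are injective); $\mathcal G$ itself need not be Hausdorff. Put $\mathcal G^x=\mathbf d^{-1}(x)$. Let $\mathcal G$ be *$\Gamma$-graded* by a continuous functor $\kappa:\mathcal G\to\Gamma$, and put $\mathcal G_\gamma=\kappa^{-1}(\gamma)$; then $\mathcal G_\varepsilon$ is an ample groupoid with the same unit space. $\mathcal G$ is *strongly graded* if $\mathcal G_\gamma\mathcal G_\delta=\mathcal G_{\gamma\delta}$ for all $\gamma,\delta\in\Gamma$. **The algebra.** The *Steinberg algebra* $A=A_R(\mathcal G)$ is the $R$-submodule of $R^{\mathcal G}$ spanned by the characteristic functions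 $\mathbf 1_B$ of compact open bisections $B$, with the product $(f*f')(k)=\sum_{g\in\mathcal G^{\mathbf d(k)}}f(kg^{-1})f'(g)$. It is $\Gamma$-graded by $A_\gamma=\{f\in A: f=0 \text{ off } \mathcal G_\gamma\}$, and $f\mapsto f|_{\mathcal G_\varepsilon}$ is an isomorphism of $A_\varepsilon$ with $A_R(\mathcal G_\varepsilon)$. $A$ is *strongly graded* if, for all $\gamma,\delta\in\Gamma$, the additive subgroup $A_\gamma A_\delta$ generated by the products $f*f'$ with $f\in A_\gamma$, $f'\in A_\delta$ equals $A_{\gamma\delta}$. **Modules.** For a ring $B$, possibly without unit, $\mathrm{Mod}\,B$ is the category of right $B$-modules $M$ with $M=MB$. $\mathrm{Gr}\,A$ is the category of right $A$-modules $M=MA$ with a decomposition $M=\bigoplus_{\gamma\in\Gamma}M_\gamma$ into additive subgroups such that $M_\gamma A_\delta\subseteq M_{\gamma\delta}$, with the degree-preserving homomorphisms. **Sheaves.** For an ample groupoid $\mathcal H$, $\mathrm{Mod}_R\mathcal H$ is the category of right $\mathcal H$-sheaves of $R$-modules. Such a sheaf is a local homeomorphism $p:E\to\mathcal H^{(0)}$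 with $R$-modules as stalks $E_x=p^{-1}(x)$, such that the zero section, the addition $E\times_{\mathcal H^{(0)}}E\to E$ and the multiplication by each scalar are continuous, together with a continuous action $(e,g)\mapsto eg$, defined when $p(e)=\mathbf c(g)$, such that $e\,p(e)=e$, $p(eg)=\mathbf d(g)$, $(eg)h=e(gh)$ and every map $E_{\mathbf c(g)}\to E_{\mathbf d(g)}$, $e\mapsto eg$, is $R$-linear. The morphisms are the continuous equivariant maps over $\mathcal H^{(0)}$ that are $R$-linear on stalks. $\mathrm{Gr}_R\mathcal G$ is the category of *graded* $\mathcal G$-sheaves: $\mathcal G$-sheaves of $R$-modules $E$ with decompositions $E_x=\bigoplus_{\gamma\in\Gamma}(E_x)_\gamma$ into $R$-submodules such that each $E_\gamma=\bigcup_x(E_x)_\gamma$ is open in $E$ and $E_\gamma\mathcal G_\delta\subseteq E_{\gamma\delta}$; the morphisms are the morphisms of $\mathcal G$-sheaves of $R$-modules that preserve degrees. **Functors.** * *Restriction.* $\mathcal I:\mathrm{Gr}_R\mathcal G\to\mathrm{Mod}_R\mathcal G_\varepsilon$, $E\mapsto E_\varepsilon$ (relative topology), and $\mathcal I:\mathrm{Gr}\,A\to\mathrm{Mod}\,A_\varepsilon$,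 $M\mapsto M_\varepsilon$. * *Induction of modules.* $\mathcal J:\mathrm{Mod}\,A_\varepsilon\to\mathrm{Gr}\,A$, $N\mapsto N\otimes_{A_\varepsilon}A$, with $(N\otimes_{A_\varepsilon} A)_\gamma$ the image of $N\otimes A_\gamma$. * *Induction of sheaves.* $\mathcal J:\mathrm{Mod}_R\mathcal G_\varepsilon\to\mathrm{Gr}_R\mathcal G$, $E\mapsto E\otimes_{\mathcal G_\varepsilon}\mathcal G=\bigsqcup_xE\otimes\mathcal G^x$. Here $E\otimes\mathcal G^x$ is the $R$-module generated by symbols $e\otimes g$ with $g\in\mathcal G^x$ and $p(e)=\mathbf c(g)$, subject to $e\otimes g+e'\otimes g=(e+e')\otimes g$, $(re)\otimes g=r(e\otimes g)$, and $eh\otimes g=e\otimes hg$ for $h\in\mathcal G_\varepsilon$. The action is $(e\otimes g)k=e\otimes gk$, and $e\otimes g$ has degree $\kappa(g)$. The topology is generated by the sets $\{\sum_i\sum_{g\in\mathcal G^x}f_i(g)\,s_i(\mathbf c(g))\otimes g : x\in U\}$, for $U\subseteq\mathcal G^{(0)}$ compact open, $s_i$ compactly supported continuous sections of $E$ and $f_i\in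 A$. On morphisms, $\mathcal J$ is $\phi\mapsto\phi\otimes\mathrm{id}$ in both cases. * *Sections.* For a sheaf $E$ over an ample groupoid $\mathcal H$, $\Gamma_c(E)$ is the right $A_R(\mathcal H)$-module of continuous sections $s$ with $\{x:s(x)\ne0\}$ compact, with $(sf)(x)=\sum_{g\in\mathcal H^x}f(g)\,s(\mathbf c(g))g$, and $\Gamma_c(\phi)(s)=\phi\circ s$. This gives $\Gamma_c:\mathrm{Gr}_R\mathcal G\to\mathrm{Gr}\,A$, where $\Gamma_c(E)_\gamma$ consists of the sections with values in $E_\gamma$, and $\Gamma_c:\mathrm{Mod}_R\mathcal G_\varepsilon\to\mathrm{Mod}\,A_R(\mathcal G_\varepsilon)\cong\mathrm{Mod}\,A_\varepsilon$. * *Sheaf of germs.* For a right $A_R(\mathcal H)$-module $M=MA_R(\mathcal H)$, $\mathrm{Sh}(M)$ has the stalks $\varinjlim_{U\ni x}M\mathbf 1_U$ (over compact open $U\subseteq\mathcal H^{(0)}$ containing $x$, with transition maps $m\mapsto m\mathbf 1_V$ for $V\subseteq U$), whose elements are the germs $[m]_x$ of elements $m\in M$; one has $r[m]_x=[m(r\mathbf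 1_U)]_x$ for $r\in R$ and $U\ni x$. The topology is generated by the sets $\{[m]_x:x\in U\}$, the action is $[m]_{\mathbf c(g)}\,g=[m\mathbf 1_B]_{\mathbf d(g)}$ for a compact open bisection $B\ni g$, and $\mathrm{Sh}(f)([m]_x)=[f(m)]_x$. This gives $\mathrm{Sh}:\mathrm{Gr}\,A\to\mathrm{Gr}_R\mathcal G$, where $(\mathrm{Sh}(M)_x)_\gamma=\{[m]_x:m\in M_\gamma\}$, and $\mathrm{Sh}:\mathrm{Mod}\,A_\varepsilon\cong\mathrm{Mod}\,A_R(\mathcal G_\varepsilon)\to\mathrm{Mod}_R\mathcal G_\varepsilon$. **Corollary.** The following are equivalent: 1. $\mathcal G$ is strongly graded; 2. $A_R(\mathcal G)$ is strongly graded; 3. all the arrows in the diagram $$\begin{array}{ccccc} \mathrm{Gr}_R\mathcal G&\xrightarrow{\ \mathcal I\ }&\mathrm{Mod}_R\mathcal G_\varepsilon&\xrightarrow{\ \mathcal J\ }&\mathrm{Gr}_R\mathcal G\\ {\scriptstyle\Gamma_c}\downarrow\uparrow{\scriptstyle\mathrm{Sh}}&&{\scriptstyle\Gamma_c}\downarrow\uparrow{\scriptstyle\mathrm{Sh}}&&{\scriptstyle\Gamma_c}\downarrow\uparrow{\scriptstyle\mathrm{Sh}}\\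 \mathrm{Gr}\,A_R(\mathcal G)&\xrightarrow{\ \mathcal I\ }&\mathrm{Mod}\,A_R(\mathcal G)_\varepsilon&\xrightarrow{\ \mathcal J\ }&\mathrm{Gr}\,A_R(\mathcal G) \end{array}$$ that is, the two functors $\mathcal I$, the two functors $\mathcal J$, and the functors $\Gamma_c$ and $\mathrm{Sh}$ of each column, are equivalences of categories. -/

import Mathlib

open CategoryTheory Topology Set

set_option linter.unusedSectionVars false

set_option linter.unusedVariables false

universe u v

namespace SG

noncomputable section

/-! ### Topological groupoids

A groupoid is a Mathlib groupoid on its type `X` of objects (the unit space); the set of all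
arrows is `Quiver.Total X`.  For an arrow `k`, `k.left` is the domain `d k` and `k.right` is the
codomain `c k`; the product `g h` of the composable pair `(g, h)` is `h ≫ g`. -/

/-- The set of all arrows of a groupoid. -/
abbrev Arr (X : Type u) [Groupoid.{u} X] : Type u := Quiver.Total X

/-- An arrow, as an element of the set of all arrows. -/
abbrev arr {X : Type u} [Groupoid.{u} X] {x y : X} (g : x ⟶ y) : Arr X := ⟨x, y, g⟩

/-- The unit at `x`. -/
abbrev unit {X : Type u} [Groupoid.{u} X] (x : X) : Arr X := arr (𝟙 x)

/-- The composable pairs `(snd, fst)`, with product `snd fst = fst ≫ snd`. -/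
structure CompPair (X : Type u) [Groupoid.{u} X] where
  {x y z : X}
  fst : x ⟶ y
  snd : y ⟶ z

/-- The set of composable pairs carries the relative product topology. -/
instance (X : Type u) [Groupoid.{u} X] [TopologicalSpace (Arr X)] :
    TopologicalSpace (CompPair X) :=
  TopologicalSpace.induced (fun q => (arr q.snd, arr q.fst)) inferInstance

/-- Topological groupoids; the unit space has the relative topology. -/
class IsTopologicalGroupoid (X : Type u) [Groupoid.{u} X] [TopologicalSpace X]
    [TopologicalSpace (Arr X)] : Prop where
  isInducing_unit : IsInducing (unit : X → Arr X)
  continuous_inv : Continuous fun k : Arr X => arr (inv k.hom)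
  continuous_comp : Continuous fun q : CompPair X => arr (q.fst ≫ q.snd)

/-- Étale groupoids. -/
class IsEtaleGroupoid (X : Type u) [Groupoid.{u} X] [TopologicalSpace X]
    [TopologicalSpace (Arr X)] : Prop extends IsTopologicalGroupoid X where
  isLocalHomeomorph_left : IsLocalHomeomorph (Quiver.Total.left : Arr X → X)

/-- Compact open bisections. -/
structure IsCOB {X : Type u} [Groupoid.{u} X] [TopologicalSpace (Arr X)] (B : Set (Arr X)) :
    Prop where
  isCompact : IsCompact B
  isOpen : IsOpen B
  injOn_left : InjOn Quiver.Total.left B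
  injOn_right : InjOn Quiver.Total.right B

/-- Ample groupoids. -/
class IsAmpleGroupoid (X : Type u) [Groupoid.{u} X] [TopologicalSpace X]
    [TopologicalSpace (Arr X)] : Prop extends IsEtaleGroupoid X where
  t2Space : T2Space X
  isTopologicalBasis : TopologicalSpace.IsTopologicalBasis {B : Set (Arr X) | IsCOB B}

section Ample

variable {X : Type u} [Groupoid.{u} X] [TopologicalSpace X] [TopologicalSpace (Arr X)]
  [IsAmpleGroupoid X]

open IsTopologicalGroupoid IsEtaleGroupoid IsAmpleGroupoid

theorem continuous_left : Continuous (Quiver.Total.left : Arr X → X) :=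
  isLocalHomeomorph_left.continuous

theorem isOpenMap_left : IsOpenMap (Quiver.Total.left : Arr X → X) :=
  isLocalHomeomorph_left.isOpenMap

theorem continuous_right : Continuous (Quiver.Total.right : Arr X → X) :=
  continuous_left.comp IsTopologicalGroupoid.continuous_inv

theorem continuous_unit : Continuous (unit : X → Arr X) := isInducing_unit.continuous

theorem isOpenMap_unit : IsOpenMap (unit : X → Arr X) := by
  have h : IsLocalHomeomorph ((Quiver.Total.left : Arr X → X) ∘ unit) :=
    (Homeomorph.refl X).isLocalHomeomorph
  exact (h.of_comp isLocalHomeomorph_left continuous_unit).isOpenMap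

theorem continuous_invArr : Continuous fun k : Arr X => arr (inv k.hom) :=
  IsTopologicalGroupoid.continuous_inv

theorem exists_cob {k : Arr X} {V : Set (Arr X)} (hV : V ∈ 𝓝 k) :
    ∃ B, IsCOB B ∧ k ∈ B ∧ B ⊆ V := by
  obtain ⟨B, hB, h1, h2⟩ := (isTopologicalBasis (X := X)).mem_nhds_iff.1 hV
  exact ⟨B, hB, h1, h2⟩

theorem IsCOB.mono {B C : Set (Arr X)} (hB : IsCOB B) (hC : IsOpen C) (hC' : IsCompact C)
    (h : C ⊆ B) : IsCOB C :=
  ⟨hC', hC, hB.injOn_left.mono h, hB.injOn_right.mono h⟩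

theorem isCOB_unit {U : Set X} (hU : IsCompact U) (hU' : IsOpen U) :
    IsCOB ((unit : X → Arr X) '' U) := by
  refine ⟨hU.image continuous_unit, isOpenMap_unit _ hU', ?_, ?_⟩
  · rintro _ ⟨x, _, rfl⟩ _ ⟨y, _, rfl⟩ h
    obtain rfl : x = y := h
    rfl
  · rintro _ ⟨x, _, rfl⟩ _ ⟨y, _, rfl⟩ h
    obtain rfl : x = y := h
    rfl

/-- `X` has a basis of compact open sets. -/
theorem exists_compactOpen {x : X} {V : Set X} (hV : V ∈ 𝓝 x) :
    ∃ U : Set X, IsCompact U ∧ IsOpen U ∧ x ∈ U ∧ U ⊆ V := by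
  have h1 : (unit : X → Arr X) '' V ∈ 𝓝 (unit x) := isOpenMap_unit.image_mem_nhds hV
  obtain ⟨B, hB, hx, hs⟩ := exists_cob h1
  refine ⟨Quiver.Total.left '' B, hB.isCompact.image continuous_left,
    isOpenMap_left _ hB.isOpen, ⟨_, hx, rfl⟩, ?_⟩
  rintro _ ⟨k, hk, rfl⟩
  obtain ⟨y, hy, rfl⟩ := hs hk
  exact hy

/-- Every compact set of objects lies in a compact open one. -/
theorem exists_compactOpen_superset {K : Set X} (hK : IsCompact K) :
    ∃ U : Set X, IsCompact U ∧ IsOpen U ∧ K ⊆ U := by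
  refine hK.induction_on (p := fun K => ∃ U : Set X, IsCompact U ∧ IsOpen U ∧ K ⊆ U) ?_ ?_ ?_ ?_
  · exact ⟨∅, isCompact_empty, isOpen_empty, subset_rfl⟩
  · rintro s t hst ⟨U, h1, h2, h3⟩
    exact ⟨U, h1, h2, hst.trans h3⟩
  · rintro s t ⟨U, h1, h2, h3⟩ ⟨V, h4, h5, h6⟩
    exact ⟨U ∪ V, h1.union h4, h2.union h5, union_subset_union h3 h6⟩
  · intro x _
    obtain ⟨U, h1, h2, h3, _⟩ := exists_compactOpen (Filter.univ_mem : univ ∈ 𝓝 x)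
    exact ⟨U, mem_nhdsWithin_of_mem_nhds (h2.mem_nhds h3), U, h1, h2, subset_rfl⟩

/-- Continuity of the composition. -/
theorem comp_nhds {x y z : X} (h : x ⟶ y) (g : y ⟶ z) {V : Set (Arr X)}
    (hV : V ∈ 𝓝 (arr (h ≫ g))) : ∃ C ∈ 𝓝 (arr h), ∃ B ∈ 𝓝 (arr g),
      ∀ {x' y' z' : X} (h' : x' ⟶ y') (g' : y' ⟶ z'), arr h' ∈ C → arr g' ∈ B →
        arr (h' ≫ g') ∈ V := by
  have h1 := (continuous_comp (X := X)).continuousAt (x := ⟨h, g⟩) hV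
  rw [nhds_induced, Filter.mem_map, Filter.mem_comap] at h1
  obtain ⟨t, ht, hs⟩ := h1
  obtain ⟨B, hB, C, hC, hBC⟩ := mem_nhds_prod_iff.1 ht
  exact ⟨C, hC, B, hB, fun h' g' hh hg =>
    hs (show (⟨h', g'⟩ : CompPair X) ∈ _ from hBC ⟨hg, hh⟩)⟩

/-- Nearby domains carry nearby arrows. -/
theorem near_left {x : X} (y : Quiver.Star x) {V : Set (Arr X)} (hV : V ∈ 𝓝 (arr y.2)) :
    ∀ᶠ z in 𝓝 x, ∃ w : Quiver.Star z, arr w.2 ∈ V := by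
  have h1 : Quiver.Total.left '' V ∈ 𝓝 x := isOpenMap_left.image_mem_nhds (x := arr y.2) hV
  filter_upwards [h1]
  rintro _ ⟨k, hk, rfl⟩
  exact ⟨⟨k.right, k.hom⟩, hk⟩

theorem isClosed_left {B : Set (Arr X)} (hB : IsCompact B) :
    IsClosed (Quiver.Total.left '' B) :=
  have := t2Space (X := X)
  (hB.image continuous_left).isClosed

theorem near_not {x : X} {B : Set (Arr X)} (hB : IsCompact B)
    (h : ∀ y : Quiver.Star x, arr y.2 ∉ B) :
    ∀ᶠ z in 𝓝 x, ∀ w : Quiver.Star z, arr w.2 ∉ B := by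
  have h1 : (Quiver.Total.left '' B)ᶜ ∈ 𝓝 x := by
    refine (isClosed_left hB).isOpen_compl.mem_nhds ?_
    rintro ⟨k, hk, rfl⟩
    exact h ⟨k.right, k.hom⟩ hk
  filter_upwards [h1] with z hz w hw
  exact hz ⟨_, hw, rfl⟩

theorem IsCOB.star_unique {B : Set (Arr X)} (hB : IsCOB B) {x : X} {y y' : Quiver.Star x}
    (h : arr y.2 ∈ B) (h' : arr y'.2 ∈ B) : y = y' := by
  have := hB.injOn_left h h' rfl
  obtain ⟨y1, y2⟩ := y
  obtain ⟨z1, z2⟩ := y'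
  simp only [Quiver.Total.mk.injEq, true_and] at this
  obtain ⟨rfl, h2⟩ := this
  obtain rfl := eq_of_heq h2
  rfl

/-- The product of two sets of arrows. -/
def mulSet {X : Type u} [Groupoid.{u} X] (B C : Set (Arr X)) : Set (Arr X) :=
  {k | ∃ (x y z : X) (h : x ⟶ y) (g : y ⟶ z), arr g ∈ B ∧ arr h ∈ C ∧ arr (h ≫ g) = k}

theorem mem_mulSet {B C : Set (Arr X)} {x y z : X} {h : x ⟶ y} {g : y ⟶ z} (hg : arr g ∈ B)
    (hh : arr h ∈ C) : arr (h ≫ g) ∈ mulSet B C := ⟨x, y, z, h, g, hg, hh, rfl⟩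

theorem IsCOB.mul {B C : Set (Arr X)} (hB : IsCOB B) (hC : IsCOB C) : IsCOB (mulSet B C) := by
  have := t2Space (X := X)
  refine ⟨?_, ?_, ?_, ?_⟩
  · have h1 : IsCompact ((B ×ˢ C) ∩ {q : Arr X × Arr X | q.2.right = q.1.left}) :=
      (hB.isCompact.prod hC.isCompact).inter_right
        (isClosed_eq (continuous_right.comp continuous_snd) (continuous_left.comp continuous_fst))
    have hemb : IsInducing (fun q : CompPair X => (arr q.snd, arr q.fst)) := ⟨rfl⟩
    have h2 : IsCompact {q : CompPair X | arr q.snd ∈ B ∧ arr q.fst ∈ C} := by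
      rw [hemb.isCompact_iff]
      convert h1
      ext ⟨⟨a, b, g⟩, ⟨c, d, h⟩⟩
      constructor
      · rintro ⟨q, ⟨h1, h2⟩, h3⟩
        obtain ⟨h3, h4⟩ := Prod.ext_iff.1 h3
        simp only at h3 h4
        rw [← h3, ← h4]
        exact ⟨⟨h1, h2⟩, rfl⟩
      · rintro ⟨⟨h1, h2⟩, h3⟩
        obtain rfl : d = a := h3
        exact ⟨⟨h, g⟩, ⟨h1, h2⟩, rfl⟩
    convert h2.image (continuous_comp (X := X))
    ext ⟨a, b, k⟩
    constructor
    · rintro ⟨_, z, _, h, g, h1, h2, h3⟩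
      exact ⟨⟨h, g⟩, ⟨h1, h2⟩, h3⟩
    · rintro ⟨⟨h, g⟩, ⟨h1, h2⟩, h3⟩
      rw [← h3]
      exact mem_mulSet h1 h2
  · rw [isOpen_iff_mem_nhds]
    rintro _ ⟨a, z, b, h, g, h1, h2, rfl⟩
    have e1 : arr g = arr (inv h ≫ (h ≫ g)) := by simp
    have hB' : B ∈ 𝓝 (arr (inv h ≫ (h ≫ g))) := by
      rw [← e1]; exact hB.isOpen.mem_nhds h1
    obtain ⟨C', hC', D, hD, hCD⟩ := comp_nhds (inv h) (h ≫ g) hB'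
    have h3 := (continuous_invArr (X := X)).continuousAt (x := arr h) hC'
    have h4 := near_left ⟨z, h⟩ (Filter.inter_mem (hC.isOpen.mem_nhds h2) h3)
    have h5 := (continuous_left (X := X)).continuousAt (x := arr (h ≫ g)) h4
    filter_upwards [h5, hD] with k hk hkD
    obtain ⟨w, hw, hw'⟩ := hk
    have := hCD (inv w.2) k.hom hw' hkD
    exact ⟨_, w.1, _, w.2, inv w.2 ≫ k.hom, this, hw, by simp⟩
  · rintro _ ⟨a, z, b, h, g, h1, h2, rfl⟩ _ ⟨a', z', b', h', g', h1', h2', rfl⟩ e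
    obtain rfl : a = a' := e
    have := hC.star_unique (y := ⟨z, h⟩) (y' := ⟨z', h'⟩) h2 h2'
    obtain ⟨rfl, e⟩ := Sigma.mk.inj_iff.1 this
    obtain rfl := eq_of_heq e
    have := hB.star_unique (y := ⟨_, g⟩) (y' := ⟨_, g'⟩) h1 h1'
    obtain ⟨rfl, e⟩ := Sigma.mk.inj_iff.1 this
    obtain rfl := eq_of_heq e
    rfl
  · rintro _ ⟨a, z, b, h, g, h1, h2, rfl⟩ _ ⟨a', z', b', h', g', h1', h2', rfl⟩ e
    obtain rfl : b = b' := e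
    have := hB.injOn_right h1 h1' rfl
    simp only [Quiver.Total.mk.injEq, true_and] at this
    obtain ⟨rfl, e⟩ := this
    obtain rfl := eq_of_heq e
    have := hC.injOn_right h2 h2' rfl
    simp only [Quiver.Total.mk.injEq, true_and] at this
    obtain ⟨rfl, e⟩ := this
    obtain rfl := eq_of_heq e
    rfl

end Ample

/-! ### Steinberg algebras -/

section Steinberg

/-- The characteristic function of a set of arrows. -/
def ind (R : Type u) [CommRing R] {X : Type u} [Groupoid.{u} X] (B : Set (Arr X)) : Arr X → R :=
  B.indicator fun _ => 1

/-- The `R`-submodule of `R^G` spanned by the characteristic functions of compact open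
bisections. -/
def steinbergSpan (R : Type u) [CommRing R] (X : Type u) [Groupoid.{u} X]
    [TopologicalSpace (Arr X)] : Submodule R (Arr X → R) :=
  Submodule.span R {f | ∃ B : Set (Arr X), IsCOB B ∧ f = ind R B}

/-- The Steinberg algebra `A_R(G)`; its product, the convolution, is defined below. -/
def SteinbergAlgebra (R : Type u) [CommRing R] (X : Type u) [Groupoid.{u} X]
    [TopologicalSpace (Arr X)] : Type u := steinbergSpan R X

instance (R : Type u) [CommRing R] (X : Type u) [Groupoid.{u} X]
    [TopologicalSpace (Arr X)] : AddCommGroup (SteinbergAlgebra R X) :=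
  inferInstanceAs (AddCommGroup (steinbergSpan R X))

instance (R : Type u) [CommRing R] (X : Type u) [Groupoid.{u} X]
    [TopologicalSpace (Arr X)] : Module R (SteinbergAlgebra R X) :=
  inferInstanceAs (Module R (steinbergSpan R X))

variable {R : Type u} [CommRing R] {X : Type u} [Groupoid.{u} X] [TopologicalSpace X]
  [TopologicalSpace (Arr X)]

/-- The characteristic function of a compact open bisection, in the Steinberg algebra. -/
def one (R : Type u) [CommRing R] {B : Set (Arr X)} (hB : IsCOB B) : SteinbergAlgebra R X :=
  ⟨ind R B, Submodule.subset_span ⟨B, hB, rfl⟩⟩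

theorem ind_of_mem {B : Set (Arr X)} {k : Arr X} (h : k ∈ B) : ind R B k = 1 :=
  indicator_of_mem h _

theorem ind_of_notMem {B : Set (Arr X)} {k : Arr X} (h : k ∉ B) : ind R B k = 0 :=
  indicator_of_notMem h _

theorem steinberg_ext {f g : SteinbergAlgebra R X} (h : ∀ k, f.1 k = g.1 k) : f = g :=
  Subtype.ext (funext h)

theorem steinberg_induction {p : SteinbergAlgebra R X → Prop}
    (hone : ∀ (B : Set (Arr X)) (hB : IsCOB B), p (one R hB))
    (hadd : ∀ f g, p f → p g → p (f + g)) (hsmul : ∀ (r : R) f, p f → p (r • f)) (f) : p f := by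
  obtain ⟨f, hf⟩ := f
  induction hf using Submodule.span_induction with
  | mem f hf => obtain ⟨B, hB, rfl⟩ := hf; exact hone B hB
  | zero =>
    have h0 : IsCOB (∅ : Set (Arr X)) := ⟨isCompact_empty, isOpen_empty, by simp, by simp⟩
    have := hsmul 0 _ (hone ∅ h0)
    rwa [zero_smul] at this
  | add f g _ _ h1 h2 => exact hadd _ _ h1 h2
  | smul r f _ h => exact hsmul r _ h

theorem fib_finite (f : SteinbergAlgebra R X) (x : X) :
    (Function.support fun y : Quiver.Star x => f.1 (arr y.2)).Finite := by
  refine steinberg_induction (p := fun f => ∀ x : X,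
    (Function.support fun y : Quiver.Star x => f.1 (arr y.2)).Finite) ?_ ?_ ?_ f x
  · intro B hB x
    refine Set.Subsingleton.finite ?_
    intro y hy z hz
    have hy' : arr y.2 ∈ B := by
      by_contra h
      exact hy (ind_of_notMem h)
    have hz' : arr z.2 ∈ B := by
      by_contra h
      exact hz (ind_of_notMem h)
    have := hB.injOn_left hy' hz' rfl
    obtain ⟨y1, y2⟩ := y
    obtain ⟨z1, z2⟩ := z
    simp only [Quiver.Total.mk.injEq, true_and] at this
    obtain ⟨rfl, h2⟩ := this
    obtain rfl := eq_of_heq h2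
    rfl
  · intro f g hf hg x
    exact ((hf x).union (hg x)).subset (Function.support_add _ _)
  · intro r f hf x
    exact (hf x).subset (Function.support_const_smul_subset r _)

/-- The restriction of `f` to the fibre `G^x` of the domain map, as a finitely supported
function. -/
def fib (x : X) : SteinbergAlgebra R X →ₗ[R] (Quiver.Star x →₀ R) where
  toFun f := Finsupp.ofSupportFinite (fun y => f.1 (arr y.2)) (fib_finite f x)
  map_add' f g := by ext; rfl
  map_smul' r f := by ext; rfl

theorem fib_apply (x : X) (f : SteinbergAlgebra R X) (y : Quiver.Star x) :
    fib x f y = f.1 (arr y.2) := rfl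

/-- The finite sum `∑_{y ∈ G^x} f(y) φ(y)`. -/
def pair {N : Type*} [AddCommGroup N] [Module R N] (x : X) (φ : Quiver.Star x → N) :
    SteinbergAlgebra R X →ₗ[R] N := Finsupp.linearCombination R φ ∘ₗ fib x

theorem pair_apply {N : Type*} [AddCommGroup N] [Module R N] (x : X) (φ : Quiver.Star x → N)
    (f : SteinbergAlgebra R X) : pair x φ f = (fib x f).sum fun y r => r • φ y := rfl

theorem pair_add_left {N : Type*} [AddCommGroup N] [Module R N] (x : X)
    (φ ψ : Quiver.Star x → N) (f : SteinbergAlgebra R X) :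
    pair x (fun y => φ y + ψ y) f = pair x φ f + pair x ψ f := by
  simp only [pair_apply, smul_add, Finsupp.sum_add]

theorem map_pair {N P : Type*} [AddCommGroup N] [Module R N] [AddCommGroup P] [Module R P]
    (L : N →ₗ[R] P) (x : X) (φ : Quiver.Star x → N) (f : SteinbergAlgebra R X) :
    L (pair x φ f) = pair x (fun y => L (φ y)) f := by
  simp only [pair_apply, Finsupp.sum, map_sum, map_smul]

variable [IsAmpleGroupoid X]

theorem fib_one_of_mem {B : Set (Arr X)} (hB : IsCOB B) {x : X} {y : Quiver.Star x}
    (hy : arr y.2 ∈ B) : fib x (one R hB) = Finsupp.single y 1 := by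
  ext z
  rw [fib_apply]
  by_cases hz : y = z
  · subst hz
    rw [Finsupp.single_eq_same]
    exact ind_of_mem hy
  · rw [Finsupp.single_eq_of_ne (Ne.symm hz)]
    exact ind_of_notMem (fun h => hz (hB.star_unique hy h))

theorem fib_one_of_notMem {B : Set (Arr X)} (hB : IsCOB B) {x : X}
    (h : ∀ y : Quiver.Star x, arr y.2 ∉ B) : fib x (one R hB) = 0 := by
  ext z
  exact ind_of_notMem (h z)

theorem pair_one_of_mem {N : Type*} [AddCommGroup N] [Module R N] {B : Set (Arr X)}
    (hB : IsCOB B) {x : X} (φ : Quiver.Star x → N) {y : Quiver.Star x} (hy : arr y.2 ∈ B) :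
    pair x φ (one R hB) = φ y := by
  rw [pair_apply, fib_one_of_mem hB hy]
  simp

theorem pair_one_of_notMem {N : Type*} [AddCommGroup N] [Module R N] {B : Set (Arr X)}
    (hB : IsCOB B) {x : X} (φ : Quiver.Star x → N) (h : ∀ y : Quiver.Star x, arr y.2 ∉ B) :
    pair x φ (one R hB) = 0 := by
  rw [pair_apply, fib_one_of_notMem hB h]
  simp

/-- The convolution `(f * g)(k) = ∑_{y, d y = d k} f(k y⁻¹) g(y)`, as a function on arrows. -/
def conv (f g : SteinbergAlgebra R X) (k : Arr X) : R :=
  pair k.left (fun y => f.1 (arr (inv y.2 ≫ k.hom))) g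

theorem conv_mem (f g : SteinbergAlgebra R X) : conv f g ∈ steinbergSpan R X := by
  refine steinberg_induction (p := fun f => ∀ g, conv f g ∈ steinbergSpan R X)
    (fun B hB => ?_) (fun f f' h h' g => ?_) (fun r f h g => ?_) f g
  · refine fun g => steinberg_induction (p := fun g => conv (one R hB) g ∈ steinbergSpan R X)
      (fun C hC => ?_) (fun g g' h h' => ?_)
      (fun r g h => ?_) g
    · refine Submodule.subset_span ⟨_, hB.mul hC, funext fun k => ?_⟩
      unfold conv
      by_cases hk : ∃ y : Quiver.Star k.left, arr y.2 ∈ C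
      · obtain ⟨y, hy⟩ := hk
        rw [pair_one_of_mem hC _ hy]
        by_cases h : arr (inv y.2 ≫ k.hom) ∈ B
        · have hk : k ∈ mulSet B C := ⟨_, _, _, y.2, inv y.2 ≫ k.hom, h, hy, by simp⟩
          exact (ind_of_mem h).trans (ind_of_mem hk).symm
        · refine (ind_of_notMem h).trans (ind_of_notMem ?_).symm
          rintro ⟨a, z, b, h', g', h1, h2, rfl⟩
          obtain rfl := hC.star_unique (y := ⟨_, h'⟩) h2 hy
          refine h ?_
          simpa using h1
      · push Not at hk
        rw [pair_one_of_notMem hC _ hk]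
        refine (ind_of_notMem ?_).symm
        rintro ⟨a, z, b, h', g', h1, h2, rfl⟩
        exact hk ⟨_, h'⟩ h2
    · convert Submodule.add_mem _ h h' using 1
      funext k
      exact map_add _ _ _
    · convert Submodule.smul_mem _ r h using 1
      funext k
      exact map_smul _ _ _
  · convert Submodule.add_mem _ (h g) (h' g) using 1
    funext k
    exact pair_add_left _ _ _ _
  · convert Submodule.smul_mem _ r (h g) using 1
    funext k
    exact (map_pair (LinearMap.lsmul R R r) _ _ _).symm

instance : Mul (SteinbergAlgebra R X) := ⟨fun f g => ⟨conv f g, conv_mem f g⟩⟩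

theorem mul_apply (f g : SteinbergAlgebra R X) (k : Arr X) :
    (f * g).1 k = pair k.left (fun y => f.1 (arr (inv y.2 ≫ k.hom))) g := rfl

/-- Composition with an arrow `y`, as a map `G^{c y} → G^{d y}`. -/
def rt {x : X} (y : Quiver.Star x) (v : Quiver.Star y.1) : Quiver.Star x := ⟨v.1, y.2 ≫ v.2⟩

theorem rt_injective {x : X} (y : Quiver.Star x) : Function.Injective (rt y) := by
  rintro ⟨a, v⟩ ⟨b, w⟩ h
  obtain ⟨rfl, h2⟩ := Sigma.mk.inj_iff.1 h
  have h3 : y.2 ≫ v = y.2 ≫ w := eq_of_heq h2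
  rw [cancel_epi] at h3
  rw [h3]

theorem fib_mul (x : X) (f g : SteinbergAlgebra R X) :
    fib x (f * g) = pair x (fun y => (fib y.1 f).mapDomain (rt y)) g := by
  ext w
  have h : ∀ y : Quiver.Star x,
      (fib y.1 f).mapDomain (rt y) w = f.1 (arr (inv y.2 ≫ w.2)) := by
    intro y
    have hw : w = rt y ⟨w.1, inv y.2 ≫ w.2⟩ := by simp [rt]
    conv_lhs => rw [hw, Finsupp.mapDomain_apply (rt_injective y)]
    rfl
  rw [fib_apply, mul_apply, ← Finsupp.lapply_apply (R := R), map_pair]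
  simp only [Finsupp.lapply_apply, h]

theorem pair_mul {N : Type*} [AddCommGroup N] [Module R N] (x : X) (φ : Quiver.Star x → N)
    (f g : SteinbergAlgebra R X) :
    pair x φ (f * g) = pair x (fun y => pair y.1 (fun v => φ (rt y v)) f) g := by
  rw [pair, LinearMap.comp_apply, fib_mul, map_pair]
  congr 2
  funext y
  rw [Finsupp.linearCombination_mapDomain]
  rfl

instance : NonUnitalRing (SteinbergAlgebra R X) :=
  { (inferInstance : AddCommGroup (SteinbergAlgebra R X)),
    (inferInstance : Mul (SteinbergAlgebra R X)) with
    left_distrib := fun f g h => steinberg_ext fun _ => map_add _ _ _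
    right_distrib := fun f g h => steinberg_ext fun _ => pair_add_left _ _ _ _
    zero_mul := fun f => steinberg_ext fun _ => by
      rw [mul_apply]
      exact (map_pair (0 : R →ₗ[R] R) _ (fun _ => 0) _).symm.trans rfl
    mul_zero := fun f => steinberg_ext fun _ => map_zero _
    mul_assoc := fun f g h => steinberg_ext fun _ => by
      rw [mul_apply, mul_apply, pair_mul]
      congr 2
      funext y
      rw [mul_apply]
      simp [rt] }

theorem smul_one_mul (r : R) (f g : SteinbergAlgebra R X) : (r • f) * g = r • (f * g) :=
  steinberg_ext fun _ => (map_pair (LinearMap.lsmul R R r) _ _ _).symm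

theorem mul_smul_one (r : R) (f g : SteinbergAlgebra R X) : f * (r • g) = r • (f * g) :=
  steinberg_ext fun _ => map_smul _ _ _

/-! Germs of elements of the Steinberg algebra at a point of the unit space. -/

/-- The characteristic function of a compact open set of units. -/
def oneU (R : Type u) [CommRing R] {U : Set X} (hc : IsCompact U) (ho : IsOpen U) :
    SteinbergAlgebra R X := one R (isCOB_unit hc ho)

theorem oneU_mem {U : Set X} {x : X} (hx : x ∈ U) :
    arr (⟨x, 𝟙 x⟩ : Quiver.Star x).2 ∈ (unit : X → Arr X) '' U := ⟨x, hx, rfl⟩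

theorem oneU_notMem {U : Set X} {x : X} (hx : x ∉ U) (y : Quiver.Star x) :
    arr y.2 ∉ (unit : X → Arr X) '' U := by
  rintro ⟨z, hz, h⟩
  have h2 : z = x := congrArg Quiver.Total.left h
  exact hx (h2 ▸ hz)

theorem fib_mul_oneU {U : Set X} (hc : IsCompact U) (ho : IsOpen U) (f : SteinbergAlgebra R X)
    {x : X} (hx : x ∈ U) : fib x (f * oneU R hc ho) = fib x f := by
  rw [fib_mul, oneU, pair_one_of_mem _ _ (oneU_mem hx)]
  have : rt (⟨x, 𝟙 x⟩ : Quiver.Star x) = id := by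
    funext v
    simp [rt]
  rw [this]
  exact Finsupp.mapDomain_id

theorem mul_oneU_apply {U : Set X} (hc : IsCompact U) (ho : IsOpen U)
    (f : SteinbergAlgebra R X) (k : Arr X) [Decidable (k.left ∈ U)] :
    (f * oneU R hc ho).1 k = if k.left ∈ U then f.1 k else 0 := by
  split_ifs with h
  · exact DFunLike.congr_fun (fib_mul_oneU hc ho f h) ⟨k.right, k.hom⟩
  · rw [mul_apply]
    exact pair_one_of_notMem _ _ (oneU_notMem h)

theorem oneU_mul_apply {U : Set X} (hc : IsCompact U) (ho : IsOpen U)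
    (f : SteinbergAlgebra R X) (k : Arr X) [Decidable (k.right ∈ U)] :
    (oneU R hc ho * f).1 k = if k.right ∈ U then f.1 k else 0 := by
  have key : ∀ (x : X) (y : Quiver.Star x),
      (fib y.1 (oneU R hc ho)).mapDomain (rt y) =
        (open Classical in if y.1 ∈ U then Finsupp.single y (1 : R) else 0) := by
    intro x y
    split_ifs with h
    · rw [oneU, fib_one_of_mem _ (oneU_mem h), Finsupp.mapDomain_single]
      simp [rt]
    · rw [oneU, fib_one_of_notMem _ (oneU_notMem h), Finsupp.mapDomain_zero]
  have h1 := DFunLike.congr_fun (fib_mul k.left (oneU R hc ho) f) ⟨k.right, k.hom⟩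
  refine Eq.trans h1 ?_
  simp only [key, pair_apply, Finsupp.sum, Finsupp.finsetSum_apply, Finsupp.smul_apply]
  rw [Finset.sum_eq_single ⟨k.right, k.hom⟩]
  · split_ifs <;> simp [fib_apply]
  · intro b _ hb
    split_ifs <;> simp [Finsupp.single_eq_of_ne (Ne.symm hb)]
  · intro h
    rw [Finsupp.notMem_support_iff.1 h, zero_smul]

/-- `f` and `g` agree on `d⁻¹(V)` for a neighbourhood `V` of `x`. -/
def GermEq (x : X) (f g : SteinbergAlgebra R X) : Prop := ∀ᶠ z in 𝓝 x, fib z f = fib z g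

theorem GermEq.mul_oneU {x : X} {f g : SteinbergAlgebra R X} (h : GermEq x f g) :
    ∃ (U : Set X) (hc : IsCompact U) (ho : IsOpen U), x ∈ U ∧
      f * oneU R hc ho = g * oneU R hc ho := by
  classical
  obtain ⟨U, hc, ho, hx, hU⟩ := exists_compactOpen h
  refine ⟨U, hc, ho, hx, steinberg_ext fun k => ?_⟩
  rw [mul_oneU_apply, mul_oneU_apply]
  split_ifs with hk
  · exact DFunLike.congr_fun (hU hk) ⟨k.right, k.hom⟩
  · rfl

theorem germEq_one {x : X} {y : Quiver.Star x} {B C : Set (Arr X)} (hB : IsCOB B) (hC : IsCOB C)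
    (h1 : arr y.2 ∈ B) (h2 : arr y.2 ∈ C) : GermEq x (one R hB) (one R hC) := by
  filter_upwards [near_left y
    (Filter.inter_mem (hB.isOpen.mem_nhds h1) (hC.isOpen.mem_nhds h2))] with z ⟨w, hw1, hw2⟩
  rw [fib_one_of_mem hB hw1, fib_one_of_mem hC hw2]

theorem germEq_oneU_mul {x : X} {y : Quiver.Star x} {B : Set (Arr X)} (hB : IsCOB B)
    (h1 : arr y.2 ∈ B) {U : Set X} (hc : IsCompact U) (ho : IsOpen U) (hU : y.1 ∈ U) :
    GermEq x (oneU R hc ho * one R hB) (one R hB) := by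
  classical
  have h2 : Quiver.Total.right ⁻¹' U ∈ 𝓝 (arr y.2) :=
    continuous_right.continuousAt (ho.mem_nhds hU)
  filter_upwards [near_left y
    (Filter.inter_mem (hB.isOpen.mem_nhds h1) h2)] with z ⟨w, hw1, hw2⟩
  ext v
  rw [fib_apply, oneU_mul_apply, fib_apply]
  split_ifs with h
  · rfl
  · refine (ind_of_notMem (fun hv => h ?_)).symm
    rw [hB.star_unique hv hw1]
    exact hw2

theorem germEq_mul {x y z : X} {h : x ⟶ y} {g : y ⟶ z} {B C D : Set (Arr X)} (hB : IsCOB B)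
    (hC : IsCOB C) (hD : IsCOB D) (h1 : arr g ∈ B) (h2 : arr h ∈ C) (h3 : arr (h ≫ g) ∈ D) :
    GermEq x (one R hB * one R hC) (one R hD) := by
  obtain ⟨C', hC', B', hB', hm⟩ := comp_nhds h g (hD.isOpen.mem_nhds h3)
  have h4 := near_left ⟨z, g⟩ (Filter.inter_mem (hB.isOpen.mem_nhds h1) hB')
  have h5 := (continuous_right (X := X)).continuousAt (x := arr h) h4
  filter_upwards [near_left ⟨y, h⟩ (Filter.inter_mem (hC.isOpen.mem_nhds h2)
    (Filter.inter_mem hC' h5))] with z ⟨w, hw1, hw2, v, hv1, hv2⟩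
  rw [fib_mul, pair_one_of_mem hC _ hw1, fib_one_of_mem hB hv1, Finsupp.mapDomain_single]
  exact (fib_one_of_mem hD (y := rt w v) (hm _ _ hw2 hv2)).symm

theorem germEq_smul_oneU {x : X} {U : Set X} (hc : IsCompact U) (ho : IsOpen U) (hU : x ∈ U)
    (r : R) (f : SteinbergAlgebra R X) : GermEq x (f * r • oneU R hc ho) (r • f) := by
  filter_upwards [ho.mem_nhds hU] with z hz
  rw [mul_smul_one, map_smul, map_smul, fib_mul_oneU _ _ _ hz]

/-- Local units. -/
theorem exists_localUnit (F : Finset (SteinbergAlgebra R X)) :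
    ∃ (U : Set X) (hc : IsCompact U) (ho : IsOpen U), ∀ f ∈ F,
      oneU R hc ho * f = f ∧ f * oneU R hc ho = f := by
  classical
  have key : ∀ f : SteinbergAlgebra R X, ∃ K : Set X, IsCompact K ∧
      ∀ k, f.1 k ≠ 0 → k.left ∈ K ∧ k.right ∈ K := by
    refine steinberg_induction (fun B hB => ?_) (fun f g hf hg => ?_) (fun r f hf => ?_)
    · refine ⟨Quiver.Total.left '' B ∪ Quiver.Total.right '' B,
        (hB.isCompact.image continuous_left).union (hB.isCompact.image continuous_right),
        fun k hk => ?_⟩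
      have : k ∈ B := by
        by_contra h
        exact hk (ind_of_notMem h)
      exact ⟨Or.inl ⟨k, this, rfl⟩, Or.inr ⟨k, this, rfl⟩⟩
    · obtain ⟨K, hK, h1⟩ := hf
      obtain ⟨L, hL, h2⟩ := hg
      refine ⟨K ∪ L, hK.union hL, fun k hk => ?_⟩
      by_cases h : f.1 k = 0
      · have : g.1 k ≠ 0 := fun h' => hk (by
          change f.1 k + g.1 k = 0
          rw [h, h', add_zero])
        exact ⟨Or.inr (h2 k this).1, Or.inr (h2 k this).2⟩
      · exact ⟨Or.inl (h1 k h).1, Or.inl (h1 k h).2⟩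
    · obtain ⟨K, hK, h1⟩ := hf
      refine ⟨K, hK, fun k hk => h1 k fun h => hk ?_⟩
      change r • f.1 k = 0
      rw [h, smul_zero]
  choose K hK hK' using key
  obtain ⟨U, hc, ho, hU⟩ := exists_compactOpen_superset (F.isCompact_biUnion fun f _ => hK f)
  refine ⟨U, hc, ho, fun f hf => ⟨steinberg_ext fun k => ?_, steinberg_ext fun k => ?_⟩⟩
  · rw [oneU_mul_apply]
    split_ifs with h
    · rfl
    · by_contra hne
      exact h (hU (mem_biUnion (x := f) hf (hK' f k (Ne.symm hne)).2))
  · rw [mul_oneU_apply]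
    split_ifs with h
    · rfl
    · by_contra hne
      exact h (hU (mem_biUnion (x := f) hf (hK' f k (Ne.symm hne)).1))

theorem oneU_mul_self {U : Set X} (hc : IsCompact U) (ho : IsOpen U) :
    oneU R hc ho * oneU R hc ho = oneU R hc ho := by
  classical
  refine steinberg_ext fun k => ?_
  rw [mul_oneU_apply]
  split_ifs with h
  · rfl
  · exact (ind_of_notMem (oneU_notMem h ⟨k.right, k.hom⟩)).symm

end Steinberg

/-! ### Internal direct sums -/

section Internal

/-- `M` is the internal direct sum of the family `comp`. -/
def IsDirectSum {ι M S : Type*} [AddCommGroup M] [SetLike S M] [AddSubmonoidClass S M]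
    (comp : ι → S) : Prop :=
  open Classical in DirectSum.IsInternal comp

variable {ι M S : Type*} [AddCommGroup M] [SetLike S M] [AddSubmonoidClass S M] {comp : ι → S}

theorem IsDirectSum.of_proj (π : ι → M →+ M) (hmem : ∀ i m, π i m ∈ comp i)
    (h1 : ∀ i, ∀ m ∈ comp i, π i m = m) (h2 : ∀ i j, ∀ m ∈ comp i, j ≠ i → π j m = 0)
    (htop : ∀ m : M, m ∈ AddSubmonoid.closure {m : M | ∃ i, m ∈ comp i}) :
    IsDirectSum comp := by
  classical
  have key : ∀ (d : DirectSum ι fun i => comp i) (i : ι),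
      π i (DirectSum.coeAddMonoidHom comp d) = d i := by
    intro d i
    induction d using DirectSum.induction_on with
    | zero => simp
    | of j x =>
      rw [DirectSum.coeAddMonoidHom_of]
      by_cases h : i = j
      · subst h
        rw [h1 i _ x.2, DirectSum.of_eq_same]
      · rw [h2 j i _ x.2 h, DirectSum.of_eq_of_ne _ _ _ h]
        rfl
    | add x y hx hy => simp [hx, hy]
  refine ⟨fun d e h => ?_, fun m => ?_⟩
  · refine DFinsupp.ext fun i => Subtype.ext ?_
    exact (key d i).symm.trans ((congrArg (π i) h).trans (key e i))
  · refine AddSubmonoid.closure_induction (motive := fun m _ => ∃ d,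
      DirectSum.coeAddMonoidHom comp d = m) ?_ ?_ ?_ (htop m)
    · rintro x ⟨i, hi⟩
      exact ⟨DirectSum.of (fun i => comp i) i ⟨x, hi⟩, DirectSum.coeAddMonoidHom_of _ _ _⟩
    · exact ⟨0, map_zero _⟩
    · rintro x y _ _ ⟨d, rfl⟩ ⟨e, rfl⟩
      exact ⟨d + e, map_add _ _ _⟩

theorem IsDirectSum.induction (h : IsDirectSum comp) {p : M → Prop} (hzero : p 0)
    (hmem : ∀ i, ∀ m ∈ comp i, p m) (hadd : ∀ m n, p m → p n → p (m + n)) (m : M) : p m := by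
  classical
  obtain ⟨d, rfl⟩ := h.2 m
  induction d using DirectSum.induction_on with
  | zero => rwa [map_zero]
  | of j x => rw [DirectSum.coeAddMonoidHom_of]; exact hmem j _ x.2
  | add x y hx hy => rw [map_add]; exact hadd _ _ hx hy

/-- The projection onto a homogeneous component. -/
def IsDirectSum.proj (h : IsDirectSum comp) (i : ι) : M →+ M :=
  open Classical in
  (AddSubmonoidClass.subtype (comp i)).comp
    ((DFinsupp.evalAddMonoidHom i).comp
      (AddEquiv.ofBijective (DirectSum.coeAddMonoidHom comp) h).symm.toAddMonoidHom)

theorem IsDirectSum.proj_mem (h : IsDirectSum comp) (i : ι) (m : M) : h.proj i m ∈ comp i :=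
  Subtype.property _

theorem symm_of_mem [DecidableEq ι] (h : DirectSum.IsInternal comp) {i : ι} {m : M}
    (hm : m ∈ comp i) :
    (AddEquiv.ofBijective (DirectSum.coeAddMonoidHom comp) h).symm m =
      DirectSum.of (fun i => comp i) i ⟨m, hm⟩ := by
  rw [AddEquiv.symm_apply_eq]
  exact (DirectSum.coeAddMonoidHom_of comp i ⟨m, hm⟩).symm

theorem IsDirectSum.proj_of_mem (h : IsDirectSum comp) {i : ι} {m : M} (hm : m ∈ comp i) :
    h.proj i m = m := by
  classical
  refine (congrArg (fun d : DirectSum ι fun i => comp i => (d i : M))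
    (symm_of_mem h hm)).trans ?_
  rw [DirectSum.of_eq_same]

theorem IsDirectSum.proj_of_ne (h : IsDirectSum comp) {i j : ι} {m : M} (hm : m ∈ comp i)
    (hj : j ≠ i) : h.proj j m = 0 := by
  classical
  refine (congrArg (fun d : DirectSum ι fun i => comp i => (d j : M))
    (symm_of_mem h hm)).trans ?_
  rw [DirectSum.of_eq_of_ne _ _ _ hj]
  rfl

theorem IsDirectSum.exists_sum (h : IsDirectSum comp) (m : M) :
    ∃ s : Finset ι, ∑ i ∈ s, h.proj i m = m ∧ ∀ i ∉ s, h.proj i m = 0 := by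
  classical
  suffices h' : ∃ s : Finset ι, ∀ t, s ⊆ t → ∑ i ∈ t, h.proj i m = m ∧
      ∀ i ∉ t, h.proj i m = 0 by
    obtain ⟨s, hs⟩ := h'
    exact ⟨s, hs s subset_rfl⟩
  refine h.induction (p := fun m => ∃ s : Finset ι, ∀ t, s ⊆ t → ∑ i ∈ t, h.proj i m = m ∧
      ∀ i ∉ t, h.proj i m = 0) ⟨∅, fun t _ => by simp⟩ ?_ ?_ m
  · intro i m hm
    refine ⟨{i}, fun t ht => ⟨?_, fun j hj => ?_⟩⟩
    · rw [Finset.sum_eq_single_of_mem i (ht (Finset.mem_singleton_self i))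
        (fun j _ hj => h.proj_of_ne hm hj), h.proj_of_mem hm]
    · refine h.proj_of_ne hm ?_
      rintro rfl
      exact hj (ht (Finset.mem_singleton_self _))
  · rintro m n ⟨s, hs⟩ ⟨t, ht⟩
    refine ⟨s ∪ t, fun r hr => ⟨?_, fun j hj => ?_⟩⟩
    · simp only [map_add, Finset.sum_add_distrib]
      rw [(hs r (Finset.union_subset_left hr)).1, (ht r (Finset.union_subset_right hr)).1]
    · rw [map_add, (hs r (Finset.union_subset_left hr)).2 j hj,
        (ht r (Finset.union_subset_right hr)).2 j hj, add_zero]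

end Internal

/-! ### Unital modules over rings with local units, and the functors of Dade's theorem -/

section Modules

/-- Unital right modules `M = MA` over a ring `A` that need not have a unit. -/
structure UMod (A : Type u) [NonUnitalRing A] where
  carrier : Type u
  [addCommGroup : AddCommGroup carrier]
  act : carrier →+ A →+ carrier
  act_act : ∀ m a b, act (act m a) b = act m (a * b)
  unital : ∀ m, m ∈ AddSubgroup.closure {n | ∃ m' a, act m' a = n}

attribute [instance] UMod.addCommGroup

/-- Homomorphisms of right modules. -/
@[ext]
structure UMod.Hom {A : Type u} [NonUnitalRing A] (M N : UMod A) where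
  toFun : M.carrier →+ N.carrier
  map_act : ∀ m a, toFun (M.act m a) = N.act (toFun m) a

/-- The category of unital right `A`-modules. -/
instance (A : Type u) [NonUnitalRing A] : Category.{u} (UMod A) where
  Hom := UMod.Hom
  id M := ⟨AddMonoidHom.id _, fun _ _ => rfl⟩
  comp f g := ⟨g.toFun.comp f.toFun, fun m a => by simp [f.map_act, g.map_act]⟩

/-- A `Γ`-graded ring with graded local units. -/
structure RingGrading (A : Type u) [NonUnitalRing A] (Γ : Type v) [Group Γ] where
  comp : Γ → AddSubgroup A
  isDirectSum : IsDirectSum comp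
  mul_mem : ∀ {γ δ a b}, a ∈ comp γ → b ∈ comp δ → a * b ∈ comp (γ * δ)
  localUnits : ∀ F : Finset A, ∃ e ∈ comp 1, e * e = e ∧ ∀ a ∈ F, e * a = a ∧ a * e = a

variable {A : Type u} [NonUnitalRing A] {Γ : Type v} [Group Γ]

/-- `A` is strongly graded: `A_γ A_δ = A_{γδ}`, where the left-hand side is the additive subgroup
generated by the products. -/
def RingGrading.IsStrong (𝒢 : RingGrading A Γ) : Prop :=
  ∀ γ δ, AddSubgroup.closure {c | ∃ a ∈ 𝒢.comp γ, ∃ b ∈ 𝒢.comp δ, a * b = c} = 𝒢.comp (γ * δ)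

/-- The ring `A_ε`. -/
def RingGrading.neutral (𝒢 : RingGrading A Γ) : NonUnitalSubring A where
  __ := 𝒢.comp 1
  mul_mem' ha hb := by simpa using 𝒢.mul_mem ha hb

/-- Graded unital right modules. -/
structure GrMod (𝒢 : RingGrading A Γ) extends UMod A where
  comp : Γ → AddSubgroup carrier
  isDirectSum : IsDirectSum comp
  act_mem : ∀ {γ δ m a}, m ∈ comp γ → a ∈ 𝒢.comp δ → act m a ∈ comp (γ * δ)

/-- Graded homomorphisms. -/
@[ext]
structure GrMod.Hom {𝒢 : RingGrading A Γ} (M N : GrMod 𝒢) extends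
    UMod.Hom M.toUMod N.toUMod where
  map_mem : ∀ {γ m}, m ∈ M.comp γ → toFun m ∈ N.comp γ

/-- The category of graded unital right modules. -/
instance (𝒢 : RingGrading A Γ) : Category.{u} (GrMod 𝒢) where
  Hom := GrMod.Hom
  id M := ⟨⟨AddMonoidHom.id _, fun _ _ => rfl⟩, fun h => h⟩
  comp f g := ⟨⟨g.toFun.comp f.toFun, fun m a => by simp [f.map_act, g.map_act]⟩,
    fun h => g.map_mem (f.map_mem h)⟩

theorem exists_unit (𝒢 : RingGrading A Γ) (M : UMod A) (m : M.carrier) :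
    ∃ e ∈ 𝒢.comp 1, M.act m e = m := by
  classical
  suffices h : ∃ F : Finset A, ∀ e, (∀ a ∈ F, a * e = a) → M.act m e = m by
    obtain ⟨F, hF⟩ := h
    obtain ⟨e, he, _, h⟩ := 𝒢.localUnits F
    exact ⟨e, he, hF e fun a ha => (h a ha).2⟩
  refine AddSubgroup.closure_induction (p := fun m _ => ∃ F : Finset A, ∀ e,
    (∀ a ∈ F, a * e = a) → M.act m e = m) ?_ ?_ ?_ ?_ (M.unital m)
  · rintro _ ⟨m, a, rfl⟩
    refine ⟨{a}, fun e he => ?_⟩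
    rw [M.act_act, he a (Finset.mem_singleton_self a)]
  · exact ⟨∅, fun e _ => by simp⟩
  · rintro x y _ _ ⟨F, hF⟩ ⟨G, hG⟩
    refine ⟨F ∪ G, fun e he => ?_⟩
    rw [map_add, AddMonoidHom.add_apply, hF e fun a ha => he a (Finset.mem_union_left _ ha),
      hG e fun a ha => he a (Finset.mem_union_right _ ha)]
  · rintro x _ ⟨F, hF⟩
    refine ⟨F, fun e he => ?_⟩
    rw [map_neg, AddMonoidHom.neg_apply, hF e he]

/-- The `A_ε`-module `M_ε`. -/
def GrMod.neutral {𝒢 : RingGrading A Γ} (M : GrMod 𝒢) : UMod 𝒢.neutral where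
  carrier := M.comp 1
  act := AddMonoidHom.mk' (fun m => AddMonoidHom.mk'
      (fun a => ⟨M.act m a, by simpa using M.act_mem m.2 a.2⟩)
      fun a b => Subtype.ext (map_add (M.act m) _ _))
    fun m n => AddMonoidHom.ext fun a => Subtype.ext
      (DFunLike.congr_fun (map_add M.act (m : M.carrier) n) (a : A))
  act_act m a b := Subtype.ext (M.act_act m a b)
  unital m := by
    obtain ⟨e, he, h⟩ := exists_unit 𝒢 M.toUMod m
    exact AddSubgroup.subset_closure ⟨m, ⟨e, he⟩, Subtype.ext h⟩

/-- The restriction functor `M ↦ M_ε` on graded modules. -/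
def modI (𝒢 : RingGrading A Γ) : GrMod 𝒢 ⥤ UMod 𝒢.neutral where
  obj M := M.neutral
  map {M N} f := ⟨AddMonoidHom.mk' (fun m : M.comp 1 => (⟨f.toFun m, f.map_mem m.2⟩ : N.comp 1))
    fun m n => Subtype.ext (map_add f.toFun _ _),
    fun (m : M.comp 1) a => Subtype.ext (f.map_act m a)⟩

section Tensor

open TensorProduct

variable (𝒢 : RingGrading A Γ) (N : UMod 𝒢.neutral)

/-- The relations `n a ⊗ b = n ⊗ a b`, for `a ∈ A_ε`. -/
def tensRel : Submodule ℤ (N.carrier ⊗[ℤ] A) :=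
  Submodule.span ℤ {t | ∃ (n : N.carrier) (a : 𝒢.neutral) (b : A),
    t = N.act n a ⊗ₜ b - n ⊗ₜ ((a : A) * b)}

/-- The tensor product `N ⊗_{A_ε} A`. -/
def Tens : Type u := (N.carrier ⊗[ℤ] A) ⧸ tensRel 𝒢 N

instance : AddCommGroup (Tens 𝒢 N) :=
  inferInstanceAs (AddCommGroup ((N.carrier ⊗[ℤ] A) ⧸ tensRel 𝒢 N))

variable {𝒢 N}

/-- The element `n ⊗ a` of `N ⊗_{A_ε} A`. -/
def tens (n : N.carrier) (a : A) : Tens 𝒢 N := (tensRel 𝒢 N).mkQ (n ⊗ₜ a)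

theorem tens_induction {p : Tens 𝒢 N → Prop} (htens : ∀ n a, p (tens n a)) (hzero : p 0)
    (hadd : ∀ s t, p s → p t → p (s + t)) (t : Tens 𝒢 N) : p t := by
  obtain ⟨t, rfl⟩ := (tensRel 𝒢 N).mkQ_surjective t
  induction t using TensorProduct.induction_on with
  | zero => rw [map_zero]; exact hzero
  | tmul n a => exact htens n a
  | add s t hs ht => rw [map_add]; exact hadd _ _ hs ht

theorem tens_add (n : N.carrier) (a b : A) : (tens n (a + b) : Tens 𝒢 N) = tens n a + tens n b :=
  (congrArg (tensRel 𝒢 N).mkQ (TensorProduct.tmul_add n a b)).trans (map_add _ _ _)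

theorem tens_zero (n : N.carrier) : (tens n 0 : Tens 𝒢 N) = 0 :=
  (congrArg (tensRel 𝒢 N).mkQ (TensorProduct.tmul_zero _ n)).trans (map_zero _)

/-- The map induced on tensor products by additive maps, the second of which commutes with left
multiplication by `A_ε`. -/
def tensMap {N' : UMod 𝒢.neutral} (φ : N.Hom N') (ψ : A →+ A)
    (hψ : ∀ (a : 𝒢.neutral) b, ψ (a * b) = a * ψ b) : Tens 𝒢 N →+ Tens 𝒢 N' :=
  ((tensRel 𝒢 N).mapQ (tensRel 𝒢 N')
    (TensorProduct.map φ.toFun.toIntLinearMap ψ.toIntLinearMap) (by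
      refine Submodule.span_le.2 ?_
      rintro _ ⟨n, a, b, rfl⟩
      refine Submodule.subset_span ⟨φ.toFun n, a, ψ b, ?_⟩
      change TensorProduct.map _ _ (N.act n a ⊗ₜ b - n ⊗ₜ ((a : A) * b)) = _
      rw [map_sub, TensorProduct.map_tmul, TensorProduct.map_tmul]
      change φ.toFun (N.act n a) ⊗ₜ[ℤ] ψ b - φ.toFun n ⊗ₜ[ℤ] ψ (a * b) = _
      rw [φ.map_act, hψ])).toAddMonoidHom

theorem tensMap_tens {N' : UMod 𝒢.neutral} (φ : N.Hom N') (ψ : A →+ A)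
    (hψ : ∀ (a : 𝒢.neutral) b, ψ (a * b) = a * ψ b) (n : N.carrier) (a : A) :
    tensMap φ ψ hψ (tens n a) = tens (φ.toFun n) (ψ a) := rfl

theorem tensHom_ext {P : Type*} [AddCommGroup P] {f g : Tens 𝒢 N →+ P}
    (h : ∀ n a, f (tens n a) = g (tens n a)) : f = g := by
  refine AddMonoidHom.ext fun t => ?_
  refine tens_induction (p := fun t => f t = g t) h (by simp) ?_ t
  intro s t hs ht
  rw [map_add, map_add, hs, ht]

theorem proj_mul (a : 𝒢.neutral) (γ : Γ) (b : A) :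
    𝒢.isDirectSum.proj γ (a * b) = a * 𝒢.isDirectSum.proj γ b := by
  refine 𝒢.isDirectSum.induction (p := fun b => 𝒢.isDirectSum.proj γ (a * b) =
    a * 𝒢.isDirectSum.proj γ b) (by simp) ?_ ?_ b
  · intro δ b hb
    have hab : (a : A) * b ∈ 𝒢.comp δ := by simpa using 𝒢.mul_mem a.2 hb
    by_cases h : γ = δ
    · subst h
      rw [𝒢.isDirectSum.proj_of_mem hb, 𝒢.isDirectSum.proj_of_mem hab]
    · rw [𝒢.isDirectSum.proj_of_ne hb h, 𝒢.isDirectSum.proj_of_ne hab h, mul_zero]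
  · intro b c hb hc
    rw [mul_add, map_add, map_add, mul_add, hb, hc]

/-- The right action of `A` on `N ⊗_{A_ε} A`. -/
def tensAct : Tens 𝒢 N →+ A →+ Tens 𝒢 N :=
  (AddMonoidHom.mk' (fun b => tensMap (𝟙 N) (AddMonoidHom.mulRight b)
      (by intro a c; exact mul_assoc (a : A) c b))
    (by
      intro b c
      refine tensHom_ext fun n a => ?_
      exact (congrArg (tens n) (mul_add a b c)).trans (tens_add _ _ _))).flip

theorem tensAct_tens (n : N.carrier) (a b : A) :
    (tensAct (tens n a) b : Tens 𝒢 N) = tens n (a * b) := rfl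

variable (𝒢 N)

/-- The component `N ⊗_{A_ε} A_γ`. -/
def tensComp (γ : Γ) : AddSubgroup (Tens 𝒢 N) :=
  AddSubgroup.closure {t | ∃ n, ∃ a ∈ 𝒢.comp γ, tens n a = t}

variable {𝒢 N}

theorem tensComp_induction {γ : Γ} {p : Tens 𝒢 N → Prop}
    (htens : ∀ n, ∀ a ∈ 𝒢.comp γ, p (tens n a)) (hzero : p 0)
    (hadd : ∀ s t, p s → p t → p (s + t)) (hneg : ∀ s, p s → p (-s)) :
    ∀ t ∈ tensComp 𝒢 N γ, p t := by
  intro t ht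
  induction ht using AddSubgroup.closure_induction with
  | mem m hm => obtain ⟨n, a, ha, rfl⟩ := hm; exact htens n a ha
  | zero => exact hzero
  | add s t _ _ hs ht => exact hadd _ _ hs ht
  | neg s _ hs => exact hneg _ hs

theorem tens_mem {γ : Γ} (n : N.carrier) {a : A} (ha : a ∈ 𝒢.comp γ) :
    tens n a ∈ tensComp 𝒢 N γ := AddSubgroup.subset_closure ⟨n, a, ha, rfl⟩

theorem tensComp_isDirectSum : IsDirectSum (tensComp 𝒢 N) := by
  refine IsDirectSum.of_proj (fun γ => tensMap (𝟙 N) (𝒢.isDirectSum.proj γ)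
    fun a b => proj_mul a γ b) ?_ ?_ ?_ ?_
  · intro γ
    refine tens_induction ?_ ?_ ?_
    · intro n a
      exact tens_mem _ (𝒢.isDirectSum.proj_mem γ a)
    · rw [map_zero]
      exact zero_mem _
    · intro s t hs ht
      rw [map_add]
      exact add_mem hs ht
  · intro γ
    refine tensComp_induction ?_ (map_zero _) ?_ ?_
    · intro n a ha
      rw [tensMap_tens, 𝒢.isDirectSum.proj_of_mem ha]
      rfl
    · intro s t hs ht
      rw [map_add, hs, ht]
    · intro s hs
      rw [map_neg, hs]
  · intro γ δ m hm hδ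
    revert m
    refine tensComp_induction ?_ (map_zero _) ?_ ?_
    · intro n a ha
      rw [tensMap_tens, 𝒢.isDirectSum.proj_of_ne ha hδ, tens_zero]
    · intro s t hs ht
      rw [map_add, hs, ht, add_zero]
    · intro s hs
      rw [map_neg, hs, neg_zero]
  · refine tens_induction ?_ (zero_mem _) (fun s t => add_mem)
    intro n a
    refine 𝒢.isDirectSum.induction (p := fun a => tens n a ∈ AddSubmonoid.closure _) ?_ ?_ ?_ a
    · rw [tens_zero]
      exact zero_mem _
    · intro γ a ha
      exact AddSubmonoid.subset_closure ⟨γ, tens_mem n ha⟩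
    · intro a b ha hb
      rw [tens_add]
      exact add_mem ha hb

variable (N)

/-- The graded module `N ⊗_{A_ε} A`, with `γ`-component `N ⊗_{A_ε} A_γ`. -/
def tensGr : GrMod 𝒢 where
  carrier := Tens 𝒢 N
  act := tensAct
  act_act m b c := by
    revert m
    refine tens_induction ?_ ?_ ?_
    · intro n a
      rw [tensAct_tens, tensAct_tens, tensAct_tens, mul_assoc]
    · simp only [map_zero, AddMonoidHom.zero_apply]
    · intro s t hs ht
      simp only [map_add, AddMonoidHom.add_apply, hs, ht]
  unital := by
    refine tens_induction ?_ (zero_mem _) (fun s t => add_mem)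
    intro n a
    obtain ⟨e, -, -, he⟩ := 𝒢.localUnits {a}
    refine AddSubgroup.subset_closure ⟨tens n a, e, ?_⟩
    rw [tensAct_tens, (he a (Finset.mem_singleton_self a)).2]
  comp := tensComp 𝒢 N
  isDirectSum := tensComp_isDirectSum
  act_mem {γ δ m a} hm ha := by
    refine tensComp_induction (p := fun m => tensAct m a ∈ tensComp 𝒢 N (γ * δ))
      ?_ ?_ ?_ ?_ m hm
    · intro n b hb
      exact tens_mem n (𝒢.mul_mem hb ha)
    · rw [map_zero]
      exact zero_mem _
    · intro s t hs ht
      rw [map_add]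
      exact add_mem hs ht
    · intro s hs
      rw [map_neg]
      exact neg_mem hs

variable {N}

theorem tensMap_act {N' : UMod 𝒢.neutral} (φ : N.Hom N') (m : Tens 𝒢 N) (b : A) :
    tensMap φ (AddMonoidHom.id A) (fun _ _ => rfl) (tensAct m b) =
      tensAct (tensMap φ (AddMonoidHom.id A) (fun _ _ => rfl) m) b := by
  revert m
  refine tens_induction (fun n a => rfl) ?_ ?_
  · simp only [map_zero, AddMonoidHom.zero_apply]
  · intro s t hs ht
    simp only [map_add, AddMonoidHom.add_apply, hs, ht]

theorem tensMap_mem {N' : UMod 𝒢.neutral} (φ : N.Hom N') {γ : Γ} {m : Tens 𝒢 N}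
    (hm : m ∈ tensComp 𝒢 N γ) :
    tensMap φ (AddMonoidHom.id A) (fun _ _ => rfl) m ∈ tensComp 𝒢 N' γ := by
  refine tensComp_induction (p := fun m => tensMap φ (AddMonoidHom.id A) (fun _ _ => rfl) m ∈
    tensComp 𝒢 N' γ) ?_ ?_ ?_ ?_ m hm
  · intro n b hb
    exact tens_mem _ hb
  · rw [map_zero]
    exact zero_mem _
  · intro s t hs ht
    rw [map_add]
    exact add_mem hs ht
  · intro s hs
    rw [map_neg]
    exact neg_mem hs

variable (𝒢)

/-- The induction functor `N ↦ N ⊗_{A_ε} A`, `φ ↦ φ ⊗ id`. -/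
def modJ : UMod 𝒢.neutral ⥤ GrMod 𝒢 where
  obj N := tensGr N
  map φ := ⟨⟨tensMap φ (AddMonoidHom.id A) fun _ _ => rfl, tensMap_act φ⟩, tensMap_mem φ⟩
  map_id N := GrMod.Hom.ext (tensHom_ext (N := N) fun n a => rfl)
  map_comp {N _ _} f g := GrMod.Hom.ext (tensHom_ext (N := N) fun n a => rfl)

end Tensor

/-- Restriction of scalars along an isomorphism of rings. -/
def restrictEquiv {B : Type u} [NonUnitalRing B] (e : A ≃+* B) : UMod B ⥤ UMod A where
  obj M :=
    { carrier := M.carrier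
      act := AddMonoidHom.mk' (fun m => (M.act m).comp (e : A ≃+ B).toAddMonoidHom)
        fun m n => by ext; simp
      act_act := fun m a b => by simp [M.act_act]
      unital := fun m => AddSubgroup.closure_mono (by
        rintro _ ⟨m', b, rfl⟩
        exact ⟨m', e.symm b, by simp⟩) (M.unital m) }
  map f := ⟨f.toFun, fun m a => f.map_act m (e a)⟩

end Modules

/-! ### Sheaves of modules over a groupoid -/

/-- Right `G`-sheaves of `R`-modules.  The total space is the disjoint union of the stalks; the
addition and the action are defined on fibre products, which have the relative product topology.
Since `R` is discrete, continuity of the scalar multiplication means continuity of the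
multiplication by each scalar.  The action of an arrow `g` with `d g = x`, `c g = y` is the
homomorphism `E_y → E_x`, `e ↦ e g`. -/
structure GSheaf (R : Type u) [CommRing R] (X : Type u) [Groupoid.{u} X] [TopologicalSpace X]
    [TopologicalSpace (Arr X)] where
  stalk : X → Type u
  [addCommGroup : ∀ x, AddCommGroup (stalk x)]
  [module : ∀ x, Module R (stalk x)]
  [top : TopologicalSpace (Σ x, stalk x)]
  isLocalHomeomorph_proj : IsLocalHomeomorph (Sigma.fst : (Σ x, stalk x) → X)
  continuous_zero : Continuous fun x => (⟨x, 0⟩ : Σ x, stalk x)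
  continuous_add : Continuous[TopologicalSpace.induced
      (fun q : Σ x, stalk x × stalk x => ((⟨q.1, q.2.1⟩, ⟨q.1, q.2.2⟩) :
        (Σ x, stalk x) × (Σ x, stalk x))) inferInstance, top]
    fun q => ⟨q.1, q.2.1 + q.2.2⟩
  continuous_smul : ∀ r : R, Continuous fun e : Σ x, stalk x => (⟨e.1, r • e.2⟩ : Σ x, stalk x)
  act : ∀ {x y : X}, (x ⟶ y) → (stalk y →ₗ[R] stalk x)
  act_id : ∀ x (e : stalk x), act (𝟙 x) e = e
  act_comp : ∀ {x y z : X} (h : x ⟶ y) (g : y ⟶ z) (e : stalk z),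
    act (h ≫ g) e = act h (act g e)
  continuous_act : Continuous[TopologicalSpace.induced
      (fun q : Σ k : Arr X, stalk k.right => ((⟨q.1.right, q.2⟩, q.1) : (Σ x, stalk x) × Arr X))
      inferInstance, top]
    fun q => ⟨q.1.left, act q.1.hom q.2⟩

attribute [instance] GSheaf.addCommGroup GSheaf.module GSheaf.top

section Sheaves

variable {R : Type u} [CommRing R] {X : Type u} [Groupoid.{u} X] [TopologicalSpace X]
  [TopologicalSpace (Arr X)]

/-- The total space of a sheaf. -/
abbrev GSheaf.Tot (E : GSheaf R X) : Type u := Σ x, E.stalk x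

/-- Morphisms of `G`-sheaves of `R`-modules. -/
@[ext]
structure GSheaf.Hom (E F : GSheaf R X) where
  app : ∀ x, E.stalk x →ₗ[R] F.stalk x
  continuous : Continuous fun e : E.Tot => (⟨e.1, app e.1 e.2⟩ : F.Tot)
  map_act : ∀ {x y : X} (g : x ⟶ y) (e : E.stalk y), app x (E.act g e) = F.act g (app y e)

/-- The category of `G`-sheaves of `R`-modules. -/
instance : Category.{u} (GSheaf R X) where
  Hom := GSheaf.Hom
  id E := ⟨fun _ => LinearMap.id, continuous_id, fun _ _ => rfl⟩
  comp φ ψ := ⟨fun x => ψ.app x ∘ₗ φ.app x, ψ.continuous.comp φ.continuous,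
    fun g e => by simp [φ.map_act, ψ.map_act]⟩

variable (E : GSheaf R X)

theorem isOpen_zero {s : ∀ x, E.stalk x} (hs : Continuous fun x => (⟨x, s x⟩ : E.Tot)) :
    IsOpen {x | s x = 0} := by
  have h1 : IsLocalHomeomorph ((Sigma.fst : E.Tot → X) ∘ fun x => ⟨x, 0⟩) :=
    (Homeomorph.refl X).isLocalHomeomorph
  have h2 := ((h1.of_comp E.isLocalHomeomorph_proj E.continuous_zero).isOpenMap _
    isOpen_univ).preimage hs
  convert h2
  ext x
  constructor
  · intro h
    have h' : s x = 0 := h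
    exact ⟨x, trivial, by dsimp only; rw [h']⟩
  · rintro ⟨y, -, h⟩
    obtain ⟨rfl, h⟩ := Sigma.mk.inj_iff.1 h
    exact (eq_of_heq h).symm

theorem continuous_section_add {s t : ∀ x, E.stalk x}
    (hs : Continuous fun x => (⟨x, s x⟩ : E.Tot)) (ht : Continuous fun x => (⟨x, t x⟩ : E.Tot)) :
    Continuous fun x => (⟨x, s x + t x⟩ : E.Tot) := by
  let _ : TopologicalSpace (Σ x, E.stalk x × E.stalk x) := TopologicalSpace.induced
    (fun q => ((⟨q.1, q.2.1⟩, ⟨q.1, q.2.2⟩) : E.Tot × E.Tot)) inferInstance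
  have h1 : Continuous fun x => (⟨x, s x, t x⟩ : Σ x, E.stalk x × E.stalk x) :=
    continuous_induced_rng.2 (hs.prodMk ht)
  exact E.continuous_add.comp h1

theorem continuous_section_act {s : ∀ x, E.stalk x} [IsAmpleGroupoid X]
    (hs : Continuous fun x => (⟨x, s x⟩ : E.Tot)) :
    Continuous fun k : Arr X => (⟨k.left, E.act k.hom (s k.right)⟩ : E.Tot) := by
  let _ : TopologicalSpace (Σ k : Arr X, E.stalk k.right) := TopologicalSpace.induced
    (fun q => ((⟨q.1.right, q.2⟩, q.1) : E.Tot × Arr X)) inferInstance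
  have h1 : Continuous fun k => (⟨k, s k.right⟩ : Σ k : Arr X, E.stalk k.right) :=
    continuous_induced_rng.2 ((hs.comp continuous_right).prodMk continuous_id)
  exact E.continuous_act.comp h1

theorem isCompact_support [T2Space X] {s : ∀ x, E.stalk x}
    (hs : Continuous fun x => (⟨x, s x⟩ : E.Tot)) {K : Set X} (hK : IsCompact K)
    (h : ∀ x ∉ K, s x = 0) : IsCompact {x | s x ≠ 0} := by
  refine hK.of_isClosed_subset (isOpen_zero E hs).isClosed_compl ?_
  intro x hx
  by_contra h'
  exact hx (h x h')

/-- The `R`-module `Γ_c(E)` of compactly supported continuous sections. -/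
def sections [IsAmpleGroupoid X] (E : GSheaf R X) : Submodule R (∀ x, E.stalk x) where
  carrier := {s | Continuous (fun x => (⟨x, s x⟩ : E.Tot)) ∧ IsCompact {x | s x ≠ 0}}
  add_mem' {s t} hs ht := by
    have := IsAmpleGroupoid.t2Space (X := X)
    have h := continuous_section_add E hs.1 ht.1
    refine ⟨h, isCompact_support E h (hs.2.union ht.2) fun x hx => ?_⟩
    simp only [mem_union, mem_ofPred_eq, not_or, not_not] at hx
    change s x + t x = 0
    rw [hx.1, hx.2, add_zero]
  zero_mem' := ⟨E.continuous_zero, by simp⟩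
  smul_mem' r s hs := by
    have := IsAmpleGroupoid.t2Space (X := X)
    have h := (E.continuous_smul r).comp hs.1
    refine ⟨h, isCompact_support E h hs.2 fun x hx => ?_⟩
    simp only [mem_ofPred_eq, not_not] at hx
    change r • s x = 0
    rw [hx, smul_zero]

variable [IsAmpleGroupoid X]

/-- `(s f)(x) = ∑_{g ∈ G^x} f(g) s(c g) g`. -/
def sact (s : ∀ x, E.stalk x) (f : SteinbergAlgebra R X) (x : X) : E.stalk x :=
  pair x (fun y => E.act y.2 (s y.1)) f

theorem sact_one_of_mem (s : ∀ x, E.stalk x) {B : Set (Arr X)} (hB : IsCOB B) {x : X}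
    {y : Quiver.Star x} (hy : arr y.2 ∈ B) : sact E s (one R hB) x = E.act y.2 (s y.1) :=
  pair_one_of_mem hB _ hy

theorem sact_one_of_notMem (s : ∀ x, E.stalk x) {B : Set (Arr X)} (hB : IsCOB B) {x : X}
    (h : ∀ y : Quiver.Star x, arr y.2 ∉ B) : sact E s (one R hB) x = 0 :=
  pair_one_of_notMem hB _ h

theorem sact_mem {s : ∀ x, E.stalk x} (hs : s ∈ sections E) (f : SteinbergAlgebra R X) :
    sact E s f ∈ sections E := by
  have := IsAmpleGroupoid.t2Space (X := X)
  refine steinberg_induction (p := fun f => sact E s f ∈ sections E) (fun B hB => ?_)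
    (fun f g hf hg => ?_) (fun r f hf => ?_) f
  · have h : Continuous fun x => (⟨x, sact E s (one R hB) x⟩ : E.Tot) := by
      refine continuous_iff_continuousAt.2 fun x => ?_
      by_cases hx : ∃ y : Quiver.Star x, arr y.2 ∈ B
      · obtain ⟨y, hy⟩ := hx
        intro V hV
        dsimp only at hV
        rw [sact_one_of_mem E s hB hy] at hV
        have h1 := (continuous_section_act E hs.1).continuousAt (x := arr y.2) hV
        rw [Filter.mem_map]
        filter_upwards [near_left y (Filter.inter_mem h1 (hB.isOpen.mem_nhds hy))]
          with z ⟨w, hw1, hw2⟩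
        rw [mem_preimage, sact_one_of_mem E s hB hw2]
        exact hw1
      · push Not at hx
        refine (E.continuous_zero.continuousAt (x := x)).congr ?_
        filter_upwards [near_not hB.isCompact hx] with z hz
        rw [sact_one_of_notMem E s hB hz]
    refine ⟨h, isCompact_support E h (hB.isCompact.image continuous_left) fun x hx => ?_⟩
    exact sact_one_of_notMem E s hB fun y hy => hx ⟨_, hy, rfl⟩
  · convert add_mem hf hg using 1
    funext x
    exact map_add _ _ _
  · convert (sections E).smul_mem r hf using 1
    funext x
    exact map_smul _ _ _

theorem sact_mul (s : ∀ x, E.stalk x) (f g : SteinbergAlgebra R X) :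
    sact E (sact E s f) g = sact E s (f * g) := by
  funext x
  unfold sact
  rw [pair_mul]
  congr 2
  funext y
  rw [map_pair]
  congr 2
  funext v
  exact (E.act_comp _ _ _).symm

theorem sact_oneU {s : ∀ x, E.stalk x} {U : Set X} (hc : IsCompact U) (ho : IsOpen U)
    {x : X} (hx : x ∈ U) : sact E s (oneU R hc ho) x = s x :=
  (sact_one_of_mem E s _ (oneU_mem hx)).trans (E.act_id _ _)

/-- The unital right `A_R(G)`-module `Γ_c(E)`. -/
def gammaObj : UMod (SteinbergAlgebra R X) where
  carrier := sections E
  act := AddMonoidHom.mk' (fun s => AddMonoidHom.mk' (fun f => ⟨sact E s f, sact_mem E s.2 f⟩)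
      fun f g => Subtype.ext (funext fun x => map_add _ _ _))
    fun s t => AddMonoidHom.ext fun f => Subtype.ext (funext fun x => by
      refine Eq.trans ?_ (pair_add_left x (fun y => E.act y.2 (s.1 y.1))
        (fun y => E.act y.2 (t.1 y.1)) f)
      simp only [← map_add]
      rfl)
  act_act s f g := Subtype.ext (sact_mul E s f g)
  unital s := by
    obtain ⟨U, hc, ho, hU⟩ := exists_compactOpen_superset s.2.2
    refine AddSubgroup.subset_closure ⟨s, oneU R hc ho, Subtype.ext (funext fun x => ?_)⟩
    by_cases hx : x ∈ U
    · exact sact_oneU E hc ho hx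
    · refine (sact_one_of_notMem E _ _ (oneU_notMem hx)).trans ?_
      by_contra h
      exact hx (hU (Ne.symm h))

variable {E} in
theorem map_section_mem {F : GSheaf R X} (φ : E.Hom F) {s : ∀ x, E.stalk x}
    (hs : s ∈ sections E) : (fun x => φ.app x (s x)) ∈ sections F := by
  have := IsAmpleGroupoid.t2Space (X := X)
  have h := φ.continuous.comp hs.1
  refine ⟨h, isCompact_support F h hs.2 fun x hx => ?_⟩
  simp only [mem_ofPred_eq, not_not] at hx
  rw [hx, map_zero]

variable {E} in
/-- The homomorphism `s ↦ φ ∘ s`. -/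
def gammaMap {F : GSheaf R X} (φ : E.Hom F) : (gammaObj E).Hom (gammaObj F) where
  toFun := AddMonoidHom.mk' (fun s : sections E => (⟨_, map_section_mem φ s.2⟩ : sections F))
    fun s t => Subtype.ext (funext fun x => map_add (φ.app x) _ _)
  map_act (s : sections E) f := Subtype.ext (funext fun x => by
    refine (map_pair (φ.app x) x (fun y => E.act y.2 (s.1 y.1)) f).trans ?_
    simp only [φ.map_act]
    rfl)

/-- The functor `Γ_c` from `G`-sheaves of `R`-modules to unital right `A_R(G)`-modules. -/
def gammaC (R : Type u) [CommRing R] (X : Type u) [Groupoid.{u} X] [TopologicalSpace X]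
    [TopologicalSpace (Arr X)] [IsAmpleGroupoid X] : GSheaf R X ⥤ UMod (SteinbergAlgebra R X) where
  obj E := gammaObj E
  map φ := gammaMap φ

/-- Every element of a stalk is the value of a compactly supported continuous section, whose values
may be taken in a given neighbourhood or zero. -/
theorem exists_section {x : X} (e : E.stalk x) {V : Set E.Tot} (hV : V ∈ 𝓝 (⟨x, e⟩ : E.Tot)) :
    ∃ s ∈ sections E, s x = e ∧ ∀ z, (⟨z, s z⟩ : E.Tot) ∈ V ∨ s z = 0 := by
  classical
  have := IsAmpleGroupoid.t2Space (X := X)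
  obtain ⟨φ, hφ, hφ'⟩ := E.isLocalHomeomorph_proj ⟨x, e⟩
  have hfst : ∀ q, φ q = q.1 := fun q => (congrFun hφ' q).symm
  have hx : x ∈ φ.target := by
    have := φ.map_source hφ
    rwa [hfst] at this
  have hsymm : φ.symm x = ⟨x, e⟩ := by
    have := φ.left_inv hφ
    rwa [hfst] at this
  have hV' : φ.symm ⁻¹' V ∈ 𝓝 x := (φ.continuousAt_symm hx) (by rwa [hsymm])
  obtain ⟨U, hc, ho, hxU, hU⟩ := exists_compactOpen
    (Filter.inter_mem (φ.open_target.mem_nhds hx) hV')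
  have hp : ∀ z ∈ U, (φ.symm z).1 = z := fun z hz => by
    rw [← hfst, φ.right_inv (hU hz).1]
  let s : ∀ z, E.stalk z := fun z => if h : z ∈ U then (hp z h) ▸ (φ.symm z).2 else 0
  have hs : ∀ z ∈ U, (⟨z, s z⟩ : E.Tot) = φ.symm z := fun z hz => by
    refine Sigma.ext (hp z hz).symm ?_
    simp only [s, dif_pos hz]
    exact eqRec_heq _ _
  have hs0 : ∀ z ∉ U, s z = 0 := fun z hz => dif_neg hz
  have hcont : Continuous fun z => (⟨z, s z⟩ : E.Tot) := by
    refine continuous_iff_continuousAt.2 fun z => ?_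
    by_cases hz : z ∈ U
    · refine (φ.continuousAt_symm (hU hz).1).congr ?_
      filter_upwards [ho.mem_nhds hz] with w hw
      exact (hs w hw).symm
    · refine (E.continuous_zero.continuousAt (x := z)).congr ?_
      filter_upwards [hc.isClosed.isOpen_compl.mem_nhds hz] with w hw
      rw [hs0 w hw]
  refine ⟨s, ⟨hcont, isCompact_support E hcont hc hs0⟩, ?_, fun z => ?_⟩
  · have := (hs x hxU).trans hsymm
    exact eq_of_heq (Sigma.mk.inj_iff.1 this).2
  · by_cases hz : z ∈ U
    · refine Or.inl ?_
      rw [hs z hz]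
      exact (hU hz).2
    · exact Or.inr (hs0 z hz)

/-! Sheaves from families of sections: the topology generated by the images of the sections over
compact open sets of units. -/

/-- The topology on `Σ x, F x` generated by the sets `{sec x s | x ∈ U}`, for `U` compact open. -/
@[reducible]
def secTop {F : X → Type u} {S : Type*} (sec : ∀ x, S → F x) : TopologicalSpace (Σ x, F x) :=
  TopologicalSpace.generateFrom {Z | ∃ (s : S) (U : Set X), IsCompact U ∧ IsOpen U ∧
    Z = {e | ∃ x ∈ U, e = ⟨x, sec x s⟩}}

section SecTop

variable {F : X → Type u} [∀ x, AddCommGroup (F x)] [∀ x, Module R (F x)] {S : Type u}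
  [AddCommGroup S] (sec : ∀ x, S →+ F x)

theorem isOpen_secTop_iff
    (hsurj : ∀ x, Function.Surjective (sec x))
    (hgerm : ∀ x s, sec x s = 0 → ∀ᶠ z in 𝓝 x, sec z s = 0)
    {V : Set (Σ x, F x)} :
    IsOpen[secTop fun x s => sec x s] V ↔
      ∀ s, IsOpen {x | (⟨x, sec x s⟩ : Σ x, F x) ∈ V} := by
  constructor
  · intro hV s
    induction hV with
    | basic Z hZ =>
      obtain ⟨t, U, hc, ho, rfl⟩ := hZ
      rw [isOpen_iff_mem_nhds]
      rintro x ⟨y, hy, h⟩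
      obtain ⟨rfl, h⟩ := Sigma.mk.inj_iff.1 h
      have h0 : sec x (s - t) = 0 := by rw [map_sub, eq_of_heq h, sub_self]
      filter_upwards [hgerm x _ h0, ho.mem_nhds hy] with z hz hz'
      refine ⟨z, hz', ?_⟩
      rw [map_sub, sub_eq_zero] at hz
      rw [hz]
    | univ => simp
    | inter V W _ _ h1 h2 => exact h1.inter h2
    | sUnion 𝒱 _ h =>
      have : {x | (⟨x, sec x s⟩ : Σ x, F x) ∈ ⋃₀ 𝒱} =
          ⋃ V ∈ 𝒱, {x | (⟨x, sec x s⟩ : Σ x, F x) ∈ V} := by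
        ext x
        simp
      rw [this]
      exact isOpen_biUnion h
  · intro h
    let _ := secTop (X := X) fun x s => sec x s
    rw [isOpen_iff_mem_nhds]
    rintro ⟨x, e⟩ he
    obtain ⟨s, rfl⟩ := hsurj x e
    obtain ⟨U, hc, ho, hx, hU⟩ := exists_compactOpen ((h s).mem_nhds he)
    refine Filter.mem_of_superset (IsOpen.mem_nhds
      (TopologicalSpace.isOpen_generateFrom_of_mem ⟨s, U, hc, ho, rfl⟩) ⟨x, hx, rfl⟩) ?_
    rintro _ ⟨z, hz, rfl⟩
    exact hU hz

theorem nhds_secTop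
    (hsurj : ∀ x, Function.Surjective (sec x))
    (hgerm : ∀ x s, sec x s = 0 → ∀ᶠ z in 𝓝 x, sec z s = 0)
    {x : X} {s : S} {V : Set (Σ x, F x)} :
    V ∈ @nhds _ (secTop fun x s => sec x s) (⟨x, sec x s⟩ : Σ x, F x) ↔
      ∀ᶠ z in 𝓝 x, (⟨z, sec z s⟩ : Σ x, F x) ∈ V := by
  let _ := secTop (X := X) fun x s => sec x s
  constructor
  · intro h
    obtain ⟨W, hW, hWo, hx⟩ := mem_nhds_iff.1 h
    filter_upwards [((isOpen_secTop_iff sec hsurj hgerm).1 hWo s).mem_nhds hx] with z hz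
    exact hW hz
  · intro h
    obtain ⟨U, hc, ho, hx, hU⟩ := exists_compactOpen h
    refine Filter.mem_of_superset (IsOpen.mem_nhds
      (TopologicalSpace.isOpen_generateFrom_of_mem ⟨s, U, hc, ho, rfl⟩) ⟨x, hx, rfl⟩) ?_
    rintro _ ⟨z, hz, rfl⟩
    exact hU hz

/-- The `G`-sheaf of `R`-modules with stalks `F x`, whose topology is generated by the images of
the sections `sec · s`. -/
def GSheaf.ofSections
    (hsurj : ∀ x, Function.Surjective (sec x))
    (hgerm : ∀ x s, sec x s = 0 → ∀ᶠ z in 𝓝 x, sec z s = 0)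
    (hsmul : ∀ x (r : R) s, ∃ t, ∀ᶠ z in 𝓝 x, r • sec z s = sec z t)
    (act : ∀ {x y : X}, (x ⟶ y) → (F y →ₗ[R] F x))
    (act_id : ∀ x (e : F x), act (𝟙 x) e = e)
    (act_comp : ∀ {x y z : X} (h : x ⟶ y) (g : y ⟶ z) (e : F z),
      act (h ≫ g) e = act h (act g e))
    (hact : ∀ {x y : X} (g : x ⟶ y) s, ∃ t, ∀ᶠ k in 𝓝 (arr g),
      act k.hom (sec k.right s) = sec k.left t) : GSheaf R X :=
  letI := secTop (X := X) fun x s => sec x s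
  { stalk := F
    isLocalHomeomorph_proj := by
      have hcont : Continuous (Sigma.fst : (Σ x, F x) → X) :=
        ⟨fun V hV => (isOpen_secTop_iff sec hsurj hgerm).2 fun s => hV⟩
      have hopen : IsOpenMap (Sigma.fst : (Σ x, F x) → X) := by
        refine IsOpenMap.of_nhds_le ?_
        rintro ⟨x, e⟩ V hV
        obtain ⟨s, rfl⟩ := hsurj x e
        exact (nhds_secTop sec hsurj hgerm).1 hV
      refine isLocalHomeomorph_iff_isOpenEmbedding_restrict.2 ?_
      rintro ⟨x, e⟩
      obtain ⟨s, rfl⟩ := hsurj x e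
      obtain ⟨U, hc, ho, hx, -⟩ := exists_compactOpen (Filter.univ_mem : univ ∈ 𝓝 x)
      have hZ : IsOpen {e : Σ x, F x | ∃ x ∈ U, e = ⟨x, sec x s⟩} :=
        TopologicalSpace.isOpen_generateFrom_of_mem ⟨s, U, hc, ho, rfl⟩
      refine ⟨_, hZ.mem_nhds ⟨x, hx, rfl⟩, .of_continuous_injective_isOpenMap
        (hcont.comp continuous_subtype_val) ?_ (hopen.domRestrict hZ)⟩
      rintro ⟨_, a, ha, rfl⟩ ⟨_, b, hb, rfl⟩ h
      obtain rfl : a = b := h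
      rfl
    continuous_zero := ⟨fun V hV => by
      have := (isOpen_secTop_iff sec hsurj hgerm).1 hV 0
      simp only [map_zero] at this
      exact this⟩
    continuous_add := by
      let _ : TopologicalSpace (Σ x, F x × F x) := TopologicalSpace.induced
        (fun q : Σ x, F x × F x => ((⟨q.1, q.2.1⟩, ⟨q.1, q.2.2⟩) : (Σ x, F x) × (Σ x, F x)))
        inferInstance
      refine continuous_iff_continuousAt.2 ?_
      rintro ⟨x, e, e'⟩ V hV
      obtain ⟨s, rfl⟩ := hsurj x e
      obtain ⟨t, rfl⟩ := hsurj x e'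
      dsimp only at hV
      rw [← map_add, nhds_secTop sec hsurj hgerm] at hV
      rw [Filter.mem_map, nhds_induced]
      obtain ⟨U, hc, ho, hx, hU⟩ := exists_compactOpen hV
      have hZ : ∀ s, IsOpen {e : Σ x, F x | ∃ x ∈ U, e = ⟨x, sec x s⟩} := fun s =>
        TopologicalSpace.isOpen_generateFrom_of_mem ⟨s, U, hc, ho, rfl⟩
      refine ⟨_, prod_mem_nhds ((hZ s).mem_nhds ⟨x, hx, rfl⟩) ((hZ t).mem_nhds ⟨x, hx, rfl⟩), ?_⟩
      rintro ⟨z, a, b⟩ ⟨⟨w, hw, h1⟩, ⟨w', hw', h2⟩⟩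
      obtain ⟨rfl, h1⟩ := Sigma.mk.inj_iff.1 h1
      obtain ⟨rfl, h2⟩ := Sigma.mk.inj_iff.1 h2
      have h1 : a = sec z s := eq_of_heq h1
      have h2 : b = sec z t := eq_of_heq h2
      rw [mem_preimage, h1, h2]
      dsimp only
      rw [← map_add]
      exact hU hw
    continuous_smul := fun r => by
      refine continuous_iff_continuousAt.2 ?_
      rintro ⟨x, e⟩ V hV
      obtain ⟨s, rfl⟩ := hsurj x e
      obtain ⟨t, ht⟩ := hsmul x r s
      dsimp only at hV
      rw [ht.self_of_nhds, nhds_secTop sec hsurj hgerm] at hV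
      rw [Filter.mem_map, nhds_secTop sec hsurj hgerm]
      filter_upwards [hV, ht] with z h1 h2
      rw [mem_preimage]
      dsimp only
      rwa [h2]
    act := act
    act_id := act_id
    act_comp := act_comp
    continuous_act := by
      let _ : TopologicalSpace (Σ k : Arr X, F k.right) := TopologicalSpace.induced
        (fun q : Σ k : Arr X, F k.right => ((⟨q.1.right, q.2⟩, q.1) : (Σ x, F x) × Arr X))
        inferInstance
      refine continuous_iff_continuousAt.2 ?_
      rintro ⟨⟨x, y, g⟩, e⟩ V hV
      obtain ⟨s, rfl⟩ := hsurj y e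
      obtain ⟨t, ht⟩ := hact g s
      dsimp only at hV
      have h0 : act g (sec y s) = sec x t := ht.self_of_nhds
      rw [h0, nhds_secTop sec hsurj hgerm] at hV
      rw [Filter.mem_map, nhds_induced]
      have hV' := (continuous_left (X := X)).continuousAt (x := arr g) hV
      obtain ⟨U, hc, ho, hx, -⟩ := exists_compactOpen (Filter.univ_mem : univ ∈ 𝓝 y)
      have hZ : IsOpen {e : Σ x, F x | ∃ x ∈ U, e = ⟨x, sec x s⟩} :=
        TopologicalSpace.isOpen_generateFrom_of_mem ⟨s, U, hc, ho, rfl⟩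
      refine ⟨_, prod_mem_nhds (hZ.mem_nhds ⟨y, hx, rfl⟩) (Filter.inter_mem ht hV'), ?_⟩
      rintro ⟨k, a⟩ ⟨⟨w, hw, h1⟩, h2, h3⟩
      obtain ⟨rfl, h1⟩ := Sigma.mk.inj_iff.1 h1
      have h1 : a = sec k.right s := eq_of_heq h1
      rw [mem_preimage, h1]
      dsimp only
      have h2 : act k.hom (sec k.right s) = sec k.left t := h2
      rw [h2]
      exact h3 }

end SecTop

end Sheaves

/-! ### Graded groupoids -/

/-- A `Γ`-grading of a topological groupoid: a continuous functor to the discrete group `Γ`. -/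
structure GroupoidGrading (X : Type u) [Groupoid.{u} X] [TopologicalSpace (Arr X)] (Γ : Type v)
    [Group Γ] where
  deg : ∀ {x y : X}, (x ⟶ y) → Γ
  deg_comp : ∀ {x y z : X} (h : x ⟶ y) (g : y ⟶ z), deg (h ≫ g) = deg g * deg h
  isLocallyConstant : IsLocallyConstant fun k : Arr X => deg k.hom

section Graded

variable {X : Type u} [Groupoid.{u} X] [TopologicalSpace X] [TopologicalSpace (Arr X)]
  {Γ : Type v} [Group Γ] (κ : GroupoidGrading X Γ)

/-- The component `G_γ`. -/
def GroupoidGrading.comp (γ : Γ) : Set (Arr X) := {k | κ.deg k.hom = γ}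

/-- `G` is strongly graded: `G_γ G_δ = G_{γδ}`. -/
def GroupoidGrading.IsStrong : Prop :=
  ∀ γ δ : Γ, mulSet (κ.comp γ) (κ.comp δ) = κ.comp (γ * δ)

theorem deg_id (x : X) : κ.deg (𝟙 x) = 1 := by
  have := κ.deg_comp (𝟙 x) (𝟙 x)
  rw [Category.comp_id] at this
  exact left_eq_mul.1 this

theorem deg_inv {x y : X} (g : x ⟶ y) : κ.deg (inv g) = (κ.deg g)⁻¹ := by
  have := κ.deg_comp g (inv g)
  rw [IsIso.hom_inv_id, deg_id] at this
  exact eq_inv_of_mul_eq_one_left this.symm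

theorem isClopen_comp (γ : Γ) : IsClopen (κ.comp γ) :=
  ⟨κ.isLocallyConstant.isClosed_fiber γ, κ.isLocallyConstant.isOpen_fiber γ⟩

/-- The groupoid `G_ε`, with the same unit space as `G`. -/
def Neutral (κ : GroupoidGrading X Γ) : Type u := X

/-- The arrows of degree `ε` from `x` to `y`. -/
abbrev NHom (x y : X) : Type u := {g : x ⟶ y // κ.deg g = 1}

/-- The composition of arrows of degree `ε`. -/
def nComp {x y z : X} (h : NHom κ x y) (g : NHom κ y z) : NHom κ x z :=
  ⟨h.1 ≫ g.1, by rw [κ.deg_comp, h.2, g.2, one_mul]⟩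

/-- The inverse of an arrow of degree `ε`. -/
def nInv {x y : X} (g : NHom κ x y) : NHom κ y x := ⟨inv g.1, by rw [deg_inv, g.2, inv_one]⟩

/-- The identity of `x`, as an arrow of degree `ε`. -/
def nId (x : X) : NHom κ x x := ⟨𝟙 x, deg_id κ x⟩

instance : Groupoid.{u} (Neutral κ) where
  Hom := NHom (X := X) κ
  id := nId (X := X) κ
  comp := nComp (X := X) κ
  id_comp {x y : X} (h : NHom κ x y) := Subtype.ext (Category.id_comp h.1)
  comp_id {x y : X} (h : NHom κ x y) := Subtype.ext (Category.comp_id h.1)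
  assoc {x y z w : X} (f : NHom κ x y) (g : NHom κ y z) (h : NHom κ z w) :=
    Subtype.ext (Category.assoc f.1 g.1 h.1)
  inv := nInv (X := X) κ
  inv_comp {x y : X} (g : NHom κ x y) := Subtype.ext (IsIso.inv_hom_id g.1)
  comp_inv {x y : X} (g : NHom κ x y) := Subtype.ext (IsIso.hom_inv_id g.1)

instance : TopologicalSpace (Neutral κ) := inferInstanceAs (TopologicalSpace X)

/-- The inclusion of the arrows of `G_ε` into those of `G`. -/
def incl (k : Arr (Neutral κ)) : Arr X := ⟨k.left, k.right, k.hom.1⟩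

/-- The arrows of `G_ε` carry the relative topology. -/
instance : TopologicalSpace (Arr (Neutral κ)) := TopologicalSpace.induced (incl κ) inferInstance

/-- An arrow of degree `ε`, as an arrow of `G_ε`. -/
def toNeutral {x y : X} (g : x ⟶ y) (hg : κ.deg g = 1) :
    @Quiver.Hom (Neutral κ) _ x y := ⟨g, hg⟩

theorem incl_injective : Function.Injective (incl κ) := by
  rintro ⟨a, b, g, hg⟩ ⟨a', b', g', hg'⟩ h
  obtain ⟨h1, h2, h⟩ := Quiver.Total.mk.inj h
  cases h1
  cases h2
  obtain rfl := eq_of_heq h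
  rfl

theorem mem_range_incl {k : Arr X} (hk : κ.deg k.hom = 1) : k ∈ range (incl κ) :=
  ⟨arr (toNeutral κ k.hom hk), rfl⟩

theorem range_incl : range (incl κ) = κ.comp 1 := by
  ext k
  constructor
  · rintro ⟨k, rfl⟩
    exact k.hom.2
  · exact fun h => mem_range_incl κ h

theorem isOpenEmbedding_incl : IsOpenEmbedding (incl κ) :=
  ⟨⟨⟨rfl⟩, incl_injective κ⟩, by rw [range_incl]; exact (isClopen_comp κ 1).2⟩

theorem neutral_inv {x y : Neutral κ} (g : x ⟶ y) : inv g = nInv (X := X) κ g :=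
  (Groupoid.inv_eq_inv g).symm

theorem isCOB_preimage {B : Set (Arr X)} (hB : IsCOB B) : IsCOB (incl κ ⁻¹' B) := by
  refine ⟨?_, hB.isOpen.preimage (isOpenEmbedding_incl κ).continuous, ?_, ?_⟩
  · rw [(isOpenEmbedding_incl κ).isInducing.isCompact_iff, image_preimage_eq_inter_range,
      range_incl]
    exact hB.isCompact.inter_right (isClopen_comp κ 1).1
  · intro k hk k' hk' h
    exact incl_injective κ (hB.injOn_left hk hk' h)
  · intro k hk k' hk' h
    exact incl_injective κ (hB.injOn_right hk hk' h)

theorem isCOB_image {C : Set (Arr (Neutral κ))} (hC : IsCOB C) : IsCOB (incl κ '' C) := by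
  refine ⟨hC.isCompact.image (isOpenEmbedding_incl κ).continuous,
    (isOpenEmbedding_incl κ).isOpenMap _ hC.isOpen, ?_, ?_⟩
  · rintro _ ⟨k, hk, rfl⟩ _ ⟨k', hk', rfl⟩ h
    rw [hC.injOn_left hk hk' h]
  · rintro _ ⟨k, hk, rfl⟩ _ ⟨k', hk', rfl⟩ h
    rw [hC.injOn_right hk hk' h]

open IsTopologicalGroupoid IsEtaleGroupoid IsAmpleGroupoid

variable [IsAmpleGroupoid X]

instance : IsAmpleGroupoid (Neutral κ) where
  isInducing_unit := by
    rw [← (isOpenEmbedding_incl κ).isInducing.of_comp_iff]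
    exact isInducing_unit (X := X)
  continuous_inv := by
    rw [(isOpenEmbedding_incl κ).isInducing.continuous_iff]
    have : (incl κ ∘ fun k : Arr (Neutral κ) => arr (inv k.hom)) =
        (fun k : Arr X => arr (inv k.hom)) ∘ incl κ := by
      funext k
      simp only [Function.comp, neutral_inv]
      rfl
    rw [this]
    exact continuous_invArr.comp (isOpenEmbedding_incl κ).continuous
  continuous_comp := by
    rw [(isOpenEmbedding_incl κ).isInducing.continuous_iff]
    have h : Continuous fun q : CompPair (Neutral κ) => (⟨q.fst.1, q.snd.1⟩ : CompPair X) := by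
      refine continuous_induced_rng.2 ?_
      have h1 := (isOpenEmbedding_incl κ).continuous
      have h2 : Continuous fun q : CompPair (Neutral κ) => (arr q.snd, arr q.fst) :=
        continuous_induced_dom
      exact (h1.prodMap h1).comp h2
    exact (continuous_comp (X := X)).comp h
  isLocalHomeomorph_left :=
    (isLocalHomeomorph_left (X := X)).comp (isOpenEmbedding_incl κ).isLocalHomeomorph
  t2Space := t2Space (X := X)
  isTopologicalBasis := by
    refine TopologicalSpace.isTopologicalBasis_of_isOpen_of_nhds (fun B hB => hB.isOpen) ?_
    intro k W hk hW
    obtain ⟨B, hB, hkB, hBW⟩ := exists_cob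
      (((isOpenEmbedding_incl κ).isOpenMap W hW).mem_nhds ⟨k, hk, rfl⟩)
    refine ⟨_, isCOB_preimage κ hB, hkB, fun k' hk' => ?_⟩
    obtain ⟨k'', h, h'⟩ := hBW hk'
    rwa [← incl_injective κ h']

/-! The grading of the Steinberg algebra. -/

variable (R : Type u) [CommRing R]

theorem restrict_mem (γ : Γ) (f : SteinbergAlgebra R X) :
    (κ.comp γ).indicator f.1 ∈ steinbergSpan R X := by
  refine steinberg_induction (p := fun f => (κ.comp γ).indicator f.1 ∈ steinbergSpan R X)
    (fun B hB => ?_) (fun f g hf hg => ?_) (fun r f hf => ?_) f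
  · have h : IsCOB (κ.comp γ ∩ B) := hB.mono ((isClopen_comp κ γ).2.inter hB.isOpen)
      (hB.isCompact.inter_left (isClopen_comp κ γ).1) inter_subset_right
    convert (one R h).2 using 1
    exact indicator_indicator _ _ _
  · convert add_mem hf hg using 1
    exact indicator_add _ _ _
  · convert (steinbergSpan R X).smul_mem r hf using 1
    funext k
    by_cases hk : k ∈ κ.comp γ
    · exact (indicator_of_mem hk _).trans (congrArg (r • ·) (indicator_of_mem hk f.1).symm)
    · refine (indicator_of_notMem hk _).trans ?_
      exact ((congrArg (r • ·) (indicator_of_notMem hk f.1)).trans (smul_zero r)).symm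

/-- `f ↦ f|_{G_γ}`, extended by zero. -/
def restrict (γ : Γ) : SteinbergAlgebra R X →+ SteinbergAlgebra R X :=
  AddMonoidHom.mk' (fun f => ⟨(κ.comp γ).indicator f.1, restrict_mem κ R γ f⟩)
    fun f g => Subtype.ext (indicator_add _ _ _)

/-- `A_R(G)_γ`, the elements supported in `G_γ`. -/
def steinbergComp (γ : Γ) : AddSubgroup (SteinbergAlgebra R X) where
  carrier := {f | ∀ k, f.1 k ≠ 0 → k ∈ κ.comp γ}
  add_mem' {f g} hf hg k hk := by
    by_contra h
    have h1 : f.1 k = 0 := by_contra fun h' => h (hf k h')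
    have h2 : g.1 k = 0 := by_contra fun h' => h (hg k h')
    refine hk ?_
    change f.1 k + g.1 k = 0
    rw [h1, h2, add_zero]
  zero_mem' k hk := absurd rfl hk
  neg_mem' {f} hf k hk := hf k fun h => hk (by change -(f.1 k) = 0; rw [h, neg_zero])

theorem finite_degrees (f : SteinbergAlgebra R X) :
    ∃ D : Finset Γ, ∀ k, f.1 k ≠ 0 → κ.deg k.hom ∈ D := by
  classical
  refine steinberg_induction (p := fun f => ∃ D : Finset Γ, ∀ k, f.1 k ≠ 0 → κ.deg k.hom ∈ D)
    (fun B hB => ?_) (fun f g hf hg => ?_) (fun r f hf => ?_) f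
  · let _ : TopologicalSpace Γ := ⊥
    have : DiscreteTopology Γ := ⟨rfl⟩
    have h := (hB.isCompact.image κ.isLocallyConstant.continuous).finite_of_discrete
    refine ⟨h.toFinset, fun k hk => ?_⟩
    rw [Set.Finite.mem_toFinset]
    exact ⟨k, by_contra fun h' => hk (ind_of_notMem h'), rfl⟩
  · obtain ⟨D, hD⟩ := hf
    obtain ⟨D', hD'⟩ := hg
    refine ⟨D ∪ D', fun k hk => ?_⟩
    by_contra h
    rw [Finset.mem_union, not_or] at h
    have h1 : f.1 k = 0 := by_contra fun h' => h.1 (hD k h')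
    have h2 : g.1 k = 0 := by_contra fun h' => h.2 (hD' k h')
    refine hk ?_
    change f.1 k + g.1 k = 0
    rw [h1, h2, add_zero]
  · obtain ⟨D, hD⟩ := hf
    refine ⟨D, fun k hk => hD k fun h => hk ?_⟩
    change r • f.1 k = 0
    rw [h, smul_zero]

/-- The `Γ`-graded ring `A_R(G)`. -/
def steinbergGrading : RingGrading (SteinbergAlgebra R X) Γ where
  comp := steinbergComp κ R
  isDirectSum := by
    classical
    refine IsDirectSum.of_proj (restrict κ R) ?_ ?_ ?_ ?_
    · intro γ f k hk
      exact mem_of_indicator_ne_zero hk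
    · intro γ f hf
      refine steinberg_ext fun k => ?_
      by_cases h : k ∈ κ.comp γ
      · exact indicator_of_mem h _
      · refine (indicator_of_notMem h _).trans ?_
        by_contra h'
        exact h (hf k (Ne.symm h'))
    · intro γ δ f hf hδ
      refine steinberg_ext fun k => ?_
      by_cases h : k ∈ κ.comp δ
      · refine (indicator_of_mem h _).trans ?_
        by_contra h'
        have h2 : κ.deg k.hom = γ := hf k h'
        exact hδ (Eq.trans (Eq.symm h) h2)
      · exact indicator_of_notMem h _
    · intro f
      obtain ⟨D, hD⟩ := finite_degrees κ R f
      have : f = ∑ γ ∈ D, restrict κ R γ f := by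
        refine steinberg_ext fun k => ?_
        let ev : SteinbergAlgebra R X →+ R :=
          (Pi.evalAddMonoidHom _ k).comp (steinbergSpan R X).subtype.toAddMonoidHom
        change f.1 k = ev (∑ γ ∈ D, restrict κ R γ f)
        rw [map_sum]
        change _ = ∑ γ ∈ D, (κ.comp γ).indicator f.1 k
        by_cases h : f.1 k = 0
        · rw [h, Finset.sum_eq_zero]
          intro γ _
          rw [indicator_apply, h, ite_self]
        · rw [Finset.sum_eq_single_of_mem _ (hD k h)]
          · exact (indicator_of_mem (show k ∈ κ.comp (κ.deg k.hom) from rfl) f.1).symm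
          · intro γ _ hγ
            exact indicator_of_notMem (show k ∉ κ.comp γ from fun h' => hγ (Eq.symm h')) f.1
      rw [this]
      refine sum_mem fun γ _ => AddSubmonoid.subset_closure ⟨γ, ?_⟩
      exact fun k hk => mem_of_indicator_ne_zero hk
  mul_mem {γ δ f g} hf hg k hk := by
    by_contra h
    refine hk ?_
    rw [mul_apply, pair_apply]
    refine Finset.sum_eq_zero fun y hy => ?_
    have hy' : κ.deg y.2 = δ := hg _ (Finsupp.mem_support_iff.1 hy)
    have : f.1 (arr (inv y.2 ≫ k.hom)) = 0 := by
      by_contra h'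
      have h2 : κ.deg (inv y.2 ≫ k.hom) = γ := hf _ h'
      rw [κ.deg_comp, deg_inv, hy', mul_inv_eq_iff_eq_mul] at h2
      exact h h2
    exact (congrArg (fib k.left g y • ·) this).trans (smul_zero _)
  localUnits F := by
    obtain ⟨U, hc, ho, h⟩ := exists_localUnit F
    refine ⟨oneU R hc ho, fun k hk => ?_, oneU_mul_self hc ho, h⟩
    have : k ∈ (unit : X → Arr X) '' U := by_contra fun h' => hk (ind_of_notMem h')
    obtain ⟨x, -, rfl⟩ := this
    exact deg_id κ x

/-! The isomorphism of `A_R(G)_ε` with `A_R(G_ε)`. -/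

theorem comp_incl_mem (f : SteinbergAlgebra R X) :
    (fun k => f.1 (incl κ k)) ∈ steinbergSpan R (Neutral κ) := by
  refine steinberg_induction (p := fun f => (fun k => f.1 (incl κ k)) ∈
    steinbergSpan R (Neutral κ)) (fun B hB => ?_) (fun f g hf hg => add_mem hf hg)
    (fun r f hf => (steinbergSpan R (Neutral κ)).smul_mem r hf) f
  exact (one R (isCOB_preimage κ hB)).2

/-- `f ↦ f|_{G_ε}`. -/
def resN (f : SteinbergAlgebra R X) : SteinbergAlgebra R (Neutral κ) := ⟨_, comp_incl_mem κ R f⟩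

theorem resN_surjective (g : SteinbergAlgebra R (Neutral κ)) :
    ∃ f ∈ steinbergComp κ R 1, resN κ R f = g := by
  refine steinberg_induction (p := fun g => ∃ f ∈ steinbergComp κ R 1, resN κ R f = g)
    (fun C hC => ?_) ?_ ?_ g
  · refine ⟨one R (isCOB_image κ hC), fun k hk => ?_, steinberg_ext fun k => ?_⟩
    · have : k ∈ incl κ '' C := by_contra fun h' => hk (ind_of_notMem h')
      obtain ⟨k, -, rfl⟩ := this
      exact k.hom.2
    · by_cases h : k ∈ C
      · exact (ind_of_mem (mem_image_of_mem _ h)).trans (ind_of_mem h).symm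
      · refine (ind_of_notMem fun h' => h ?_).trans (ind_of_notMem h).symm
        exact ((incl_injective κ).mem_set_image).1 h'
  · rintro _ _ ⟨f, hf, rfl⟩ ⟨g, hg, rfl⟩
    exact ⟨f + g, add_mem hf hg, rfl⟩
  · rintro r _ ⟨f, hf, rfl⟩
    refine ⟨r • f, fun k hk => hf k fun h => hk ?_, rfl⟩
    change r • f.1 k = 0
    rw [h, smul_zero]

/-- The inclusion of fibres. -/
def inclStar (x : X) (y : @Quiver.Star (Neutral κ) _ x) : Quiver.Star x := ⟨y.1, y.2.1⟩

theorem inclStar_injective (x : X) : Function.Injective (inclStar κ x) := by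
  rintro ⟨a, g, hg⟩ ⟨b, h, hh⟩ e
  obtain ⟨rfl, e⟩ := Sigma.mk.inj_iff.1 e
  obtain rfl := eq_of_heq e
  rfl

theorem fib_resN {g : SteinbergAlgebra R X} (hg : g ∈ steinbergComp κ R 1) (x : X) :
    fib x g = Finsupp.mapDomain (inclStar κ x) (fib (X := Neutral κ) x (resN κ R g)) := by
  ext y
  by_cases h : κ.deg y.2 = 1
  · have hy : y = inclStar κ x ⟨y.1, toNeutral κ y.2 h⟩ := rfl
    conv_rhs => rw [hy, Finsupp.mapDomain_apply (inclStar_injective κ x)]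
    rfl
  · rw [Finsupp.mapDomain_of_notMem_range]
    · by_contra h'
      exact h (hg (arr y.2) h')
    · rintro ⟨y, rfl⟩
      exact h y.2.2

theorem resN_mul (f : SteinbergAlgebra R X) {g : SteinbergAlgebra R X}
    (hg : g ∈ steinbergComp κ R 1) : resN κ R (f * g) = resN κ R f * resN κ R g := by
  refine steinberg_ext fun k => ?_
  change (f * g).1 (incl κ k) = _
  rw [mul_apply, mul_apply, pair, pair, LinearMap.comp_apply, LinearMap.comp_apply]
  refine (congrArg _ (fib_resN κ R hg _)).trans ?_
  rw [Finsupp.linearCombination_mapDomain]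
  congr 2
  funext (y : @Quiver.Star (Neutral κ) _ k.left)
  change f.1 _ = f.1 _
  rw [neutral_inv]
  rfl

/-- The isomorphism `A_R(G)_ε ≃ A_R(G_ε)`, `f ↦ f|_{G_ε}`. -/
def neutralEquiv : (steinbergGrading κ R).neutral ≃+* SteinbergAlgebra R (Neutral κ) :=
  RingEquiv.ofBijective
    ({ toFun := fun f => resN κ R f
       map_zero' := rfl
       map_add' := fun f g => rfl
       map_mul' := fun f g => resN_mul κ R f.1 g.2 } :
      (steinbergGrading κ R).neutral →ₙ+* SteinbergAlgebra R (Neutral κ))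
    ⟨fun f g h => Subtype.ext (steinberg_ext fun k => by
      by_cases hk : κ.deg k.hom = 1
      · obtain ⟨k, rfl⟩ := mem_range_incl κ hk
        exact congrFun (congrArg Subtype.val h) k
      · have h1 : f.1.1 k = 0 := by_contra fun h' => hk (f.2 k h')
        have h2 : g.1.1 k = 0 := by_contra fun h' => hk (g.2 k h')
        rw [h1, h2]),
    fun g => by
      obtain ⟨f, hf, h⟩ := resN_surjective κ R g
      exact ⟨⟨f, hf⟩, h⟩⟩

/-! ### Graded sheaves -/

/-- Graded `G`-sheaves of `R`-modules. -/
structure GrSheaf extends GSheaf R X where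
  comp : Γ → ∀ x, Submodule R (stalk x)
  isDirectSum : ∀ x, IsDirectSum fun γ => comp γ x
  isOpen_comp : ∀ γ, IsOpen {e : Σ x, stalk x | e.2 ∈ comp γ e.1}
  act_mem : ∀ {x y : X} {γ : Γ} {e : stalk y} (g : x ⟶ y), e ∈ comp γ y →
    act g e ∈ comp (γ * κ.deg g) x

variable {κ R}

/-- Graded morphisms. -/
@[ext]
structure GrSheaf.Hom (E F : GrSheaf κ R) extends GSheaf.Hom E.toGSheaf F.toGSheaf where
  map_mem : ∀ {γ x e}, e ∈ E.comp γ x → app x e ∈ F.comp γ x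

variable (κ R) in
/-- The category of graded `G`-sheaves of `R`-modules. -/
instance : Category.{u} (GrSheaf κ R) where
  Hom := GrSheaf.Hom
  id E := ⟨⟨fun _ => LinearMap.id, continuous_id, fun _ _ => rfl⟩, fun h => h⟩
  comp φ ψ := ⟨⟨fun x => ψ.app x ∘ₗ φ.app x, ψ.continuous.comp φ.continuous,
    fun g e => by simp [φ.map_act, ψ.map_act]⟩, fun h => ψ.map_mem (φ.map_mem h)⟩

variable (E : GrSheaf κ R)

/-- The inclusion of the total space of `E_ε` into that of `E`. -/
def inclTot (e : Σ x, E.comp 1 x) : E.Tot := ⟨e.1, e.2⟩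

/-- The relative topology on the total space of `E_ε`. -/
instance : TopologicalSpace (Σ x, E.comp 1 x) :=
  TopologicalSpace.induced (inclTot E) inferInstance

theorem isOpenEmbedding_inclTot : IsOpenEmbedding (inclTot E) := by
  refine ⟨⟨⟨rfl⟩, ?_⟩, ?_⟩
  · rintro ⟨x, e, he⟩ ⟨y, e', he'⟩ h
    obtain ⟨rfl, h⟩ := Sigma.mk.inj_iff.1 h
    obtain rfl := eq_of_heq h
    rfl
  · convert E.isOpen_comp 1
    ext e
    constructor
    · rintro ⟨e, rfl⟩
      exact e.2.2
    · intro h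
      exact ⟨⟨e.1, e.2, h⟩, rfl⟩

theorem continuous_inclTot : Continuous (inclTot E) := continuous_induced_dom

/-- The action of an arrow of degree `ε` on `E_ε`. -/
def neutralAct {x y : X} (g : x ⟶ y) (hg : κ.deg g = 1) : E.comp 1 y →ₗ[R] E.comp 1 x :=
  (E.act g).restrict fun e he => by
    have := E.act_mem g he
    rwa [hg, one_mul] at this

theorem neutral_add : Continuous[TopologicalSpace.induced
      (fun q : Σ x, E.comp 1 x × E.comp 1 x => ((⟨q.1, q.2.1⟩, ⟨q.1, q.2.2⟩) :
        (Σ x, E.comp 1 x) × (Σ x, E.comp 1 x))) inferInstance, inferInstance]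
    fun q => (⟨q.1, q.2.1 + q.2.2⟩ : Σ x, E.comp 1 x) := by
  let _ : TopologicalSpace (Σ x, E.comp 1 x × E.comp 1 x) := TopologicalSpace.induced
    (fun q => ((⟨q.1, q.2.1⟩, ⟨q.1, q.2.2⟩) : (Σ x, E.comp 1 x) × (Σ x, E.comp 1 x)))
    inferInstance
  let _ : TopologicalSpace (Σ x, E.stalk x × E.stalk x) := TopologicalSpace.induced
    (fun q => ((⟨q.1, q.2.1⟩, ⟨q.1, q.2.2⟩) : E.Tot × E.Tot)) inferInstance
  have h0 : Continuous fun q : Σ x, E.comp 1 x × E.comp 1 x =>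
      ((⟨q.1, q.2.1⟩, ⟨q.1, q.2.2⟩) : (Σ x, E.comp 1 x) × (Σ x, E.comp 1 x)) :=
    continuous_induced_dom
  have h : Continuous fun q : Σ x, E.comp 1 x × E.comp 1 x =>
      (⟨q.1, (q.2.1 : E.stalk q.1), (q.2.2 : E.stalk q.1)⟩ : Σ x, E.stalk x × E.stalk x) :=
    continuous_induced_rng.2
      (((continuous_inclTot E).prodMap (continuous_inclTot E)).comp h0)
  exact continuous_induced_rng.2 (E.continuous_add.comp h)

theorem neutral_act : Continuous[TopologicalSpace.induced
      (fun q : Σ k : Arr (Neutral κ), E.comp 1 k.right => ((⟨q.1.right, q.2⟩, q.1) :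
        (Σ x, E.comp 1 x) × Arr (Neutral κ))) inferInstance, inferInstance]
    fun q => (⟨q.1.left, neutralAct E q.1.hom.1 q.1.hom.2 q.2⟩ : Σ x, E.comp 1 x) := by
  let _ : TopologicalSpace (Σ k : Arr (Neutral κ), E.comp 1 k.right) :=
    TopologicalSpace.induced (fun q => ((⟨q.1.right, q.2⟩, q.1) :
      (Σ x, E.comp 1 x) × Arr (Neutral κ))) inferInstance
  let _ : TopologicalSpace (Σ k : Arr X, E.stalk k.right) := TopologicalSpace.induced
    (fun q => ((⟨q.1.right, q.2⟩, q.1) : E.Tot × Arr X)) inferInstance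
  have h0 : Continuous fun q : Σ k : Arr (Neutral κ), E.comp 1 k.right =>
      ((⟨q.1.right, q.2⟩, q.1) : (Σ x, E.comp 1 x) × Arr (Neutral κ)) :=
    continuous_induced_dom
  have h : Continuous fun q : Σ k : Arr (Neutral κ), E.comp 1 k.right =>
      (⟨incl κ q.1, (q.2 : E.stalk q.1.right)⟩ : Σ k : Arr X, E.stalk k.right) :=
    continuous_induced_rng.2
      (((continuous_inclTot E).prodMap (isOpenEmbedding_incl κ).continuous).comp h0)
  exact continuous_induced_rng.2 (E.continuous_act.comp h)

/-- The `G_ε`-sheaf `E_ε`, with the relative topology. -/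
def grNeutral (E : GrSheaf κ R) : GSheaf R (Neutral κ) where
  stalk := fun x : X => E.comp 1 x
  addCommGroup := fun x : X => inferInstanceAs (AddCommGroup (E.comp 1 x))
  module := fun x : X => inferInstanceAs (Module R (E.comp 1 x))
  top := inferInstanceAs (TopologicalSpace (Σ x : X, E.comp 1 x))
  isLocalHomeomorph_proj :=
    E.isLocalHomeomorph_proj.comp (isOpenEmbedding_inclTot E).isLocalHomeomorph
  continuous_zero :=
    (continuous_induced_rng (f := inclTot E) (g := fun x => ⟨x, 0⟩)).2 E.continuous_zero
  continuous_add := neutral_add E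
  continuous_smul := fun r => (continuous_induced_rng (f := inclTot E)
    (g := fun e : Σ x, E.comp 1 x => ⟨e.1, r • e.2⟩)).2
      ((E.continuous_smul r).comp (continuous_inclTot E))
  act := fun g => neutralAct E g.1 g.2
  act_id := fun x e => Subtype.ext (E.act_id x e.1)
  act_comp := fun h g e => Subtype.ext (E.act_comp h.1 g.1 e.1)
  continuous_act := neutral_act E

variable (κ R)

/-- The restriction functor `E ↦ E_ε` on graded sheaves. -/
def sheafI : GrSheaf κ R ⥤ GSheaf R (Neutral κ) where
  obj E := grNeutral E
  map {E F} φ :=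
    { app := fun x : X => (φ.app x).restrict fun e he => φ.map_mem he
      continuous := (continuous_induced_rng (f := inclTot F)
        (g := fun e : Σ x, E.comp 1 x => ⟨e.1, φ.app e.1 e.2.1, φ.map_mem e.2.2⟩)).2
          (φ.continuous.comp (continuous_inclTot E))
      map_act := fun g e => Subtype.ext (φ.map_act g.1 e.1) }

variable {κ R}

/-! The graded module of compactly supported sections. -/

theorem sections_eventually_eq {E : GSheaf R X} {s t : ∀ x, E.stalk x} (hs : s ∈ sections E)
    (ht : t ∈ sections E) {x : X} (h : s x = t x) : ∀ᶠ z in 𝓝 x, s z = t z := by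
  have h1 := (isOpen_zero E ((sections E).sub_mem hs ht).1).mem_nhds
    (show (s - t) x = 0 from sub_eq_zero.2 h)
  filter_upwards [h1] with z hz
  exact sub_eq_zero.1 hz

theorem local_decomp {s : ∀ x, E.stalk x} (hs : s ∈ sections E.toGSheaf) (x : X) :
    ∃ (D : Finset Γ) (t : Γ → ∀ x, E.stalk x), (∀ γ, t γ ∈ sections E.toGSheaf) ∧
      (∀ γ ∉ D, t γ = 0) ∧
      ∀ᶠ z in 𝓝 x, ∀ γ, (E.isDirectSum z).proj γ (s z) = t γ z := by
  classical
  obtain ⟨D, hD, hD'⟩ := (E.isDirectSum x).exists_sum (s x)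
  have h1 : ∀ γ, ∃ t ∈ sections E.toGSheaf, t x = (E.isDirectSum x).proj γ (s x) ∧
      ∀ z, t z ∈ E.comp γ z := by
    intro γ
    obtain ⟨t, ht, h1, h2⟩ := exists_section E.toGSheaf ((E.isDirectSum x).proj γ (s x))
      ((E.isOpen_comp γ).mem_nhds ((E.isDirectSum x).proj_mem γ (s x)))
    refine ⟨t, ht, h1, fun z => ?_⟩
    rcases h2 z with h | h
    · exact h
    · rw [h]
      exact zero_mem _
  choose t ht htx htm using h1
  have h2 : ∑ γ ∈ D, t γ ∈ sections E.toGSheaf := sum_mem fun γ _ => ht γ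
  have h3 : s x = (∑ γ ∈ D, t γ) x := by
    rw [Finset.sum_apply]
    refine hD.symm.trans ?_
    exact Finset.sum_congr rfl fun γ _ => (htx γ).symm
  refine ⟨D, fun γ => if γ ∈ D then t γ else 0, fun γ => ?_, fun γ hγ => if_neg hγ, ?_⟩
  · dsimp only
    split_ifs
    · exact ht γ
    · exact zero_mem _
  · filter_upwards [sections_eventually_eq hs h2 h3] with z hz γ
    rw [hz, Finset.sum_apply, map_sum]
    split_ifs with hγ
    · rw [Finset.sum_eq_single_of_mem γ hγ, (E.isDirectSum z).proj_of_mem (htm γ z)]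
      intro δ _ hδ
      exact (E.isDirectSum z).proj_of_ne (htm δ z) (Ne.symm hδ)
    · refine Finset.sum_eq_zero fun δ hδ => (E.isDirectSum z).proj_of_ne (htm δ z) ?_
      rintro rfl
      exact hγ hδ

theorem proj_section_mem (γ : Γ) {s : ∀ x, E.stalk x} (hs : s ∈ sections E.toGSheaf) :
    (fun x => (E.isDirectSum x).proj γ (s x)) ∈ sections E.toGSheaf := by
  have := t2Space (X := X)
  have h : Continuous fun x => (⟨x, (E.isDirectSum x).proj γ (s x)⟩ : E.Tot) := by
    refine continuous_iff_continuousAt.2 fun x => ?_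
    obtain ⟨D, t, ht, -, h⟩ := local_decomp E hs x
    refine (ht γ).1.continuousAt.congr ?_
    filter_upwards [h] with z hz
    rw [hz γ]
  refine ⟨h, isCompact_support _ h hs.2 fun x hx => ?_⟩
  simp only [mem_ofPred_eq, not_not] at hx
  rw [hx, map_zero]

theorem finite_degrees_section {s : ∀ x, E.stalk x} (hs : s ∈ sections E.toGSheaf) :
    ∃ D : Finset Γ, ∀ x, ∀ γ ∉ D, (E.isDirectSum x).proj γ (s x) = 0 := by
  classical
  have h : ∃ D : Finset Γ, ∀ x ∈ {x | s x ≠ 0}, ∀ γ ∉ D,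
      (E.isDirectSum x).proj γ (s x) = 0 := by
    refine hs.2.induction_on (p := fun K => ∃ D : Finset Γ, ∀ x ∈ K, ∀ γ ∉ D,
      (E.isDirectSum x).proj γ (s x) = 0) ⟨∅, by simp⟩ ?_ ?_ ?_
    · rintro K L hKL ⟨D, hD⟩
      exact ⟨D, fun x hx => hD x (hKL hx)⟩
    · rintro K L ⟨D, hD⟩ ⟨D', hD'⟩
      refine ⟨D ∪ D', fun x hx γ hγ => ?_⟩
      rw [Finset.mem_union, not_or] at hγ
      rcases hx with hx | hx
      · exact hD x hx γ hγ.1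
      · exact hD' x hx γ hγ.2
    · intro x _
      obtain ⟨D, t, -, ht, h⟩ := local_decomp E hs x
      refine ⟨_, mem_nhdsWithin_of_mem_nhds h, D, fun z hz γ hγ => ?_⟩
      rw [show _ = t γ z from hz γ, ht γ hγ]
      rfl
  obtain ⟨D, hD⟩ := h
  refine ⟨D, fun x γ hγ => ?_⟩
  by_cases hx : s x = 0
  · rw [hx, map_zero]
  · exact hD x hx γ hγ

/-- The sections with values in `E_γ`. -/
def sectionsComp (γ : Γ) : AddSubgroup (sections E.toGSheaf) where
  carrier := {s | ∀ x, s.1 x ∈ E.comp γ x}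
  add_mem' hs ht x := add_mem (hs x) (ht x)
  zero_mem' x := zero_mem _
  neg_mem' hs x := neg_mem (hs x)

theorem sectionsComp_isDirectSum : IsDirectSum (sectionsComp E) := by
  refine IsDirectSum.of_proj (fun γ => AddMonoidHom.mk'
    (fun s => ⟨_, proj_section_mem E γ s.2⟩)
    fun s t => Subtype.ext (funext fun x => map_add _ _ _)) ?_ ?_ ?_ ?_
  · intro γ s x
    exact (E.isDirectSum x).proj_mem γ _
  · intro γ s hs
    exact Subtype.ext (funext fun x => (E.isDirectSum x).proj_of_mem (hs x))
  · intro γ δ s hs hδ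
    exact Subtype.ext (funext fun x => (E.isDirectSum x).proj_of_ne (hs x) hδ)
  · intro s
    obtain ⟨D, hD⟩ := finite_degrees_section E s.2
    have : s = ∑ γ ∈ D, (⟨_, proj_section_mem E γ s.2⟩ : sections E.toGSheaf) := by
      refine Subtype.ext (funext fun x => ?_)
      rw [AddSubmonoidClass.coe_finsetSum, Finset.sum_apply]
      obtain ⟨D', hD', h0⟩ := (E.isDirectSum x).exists_sum (s.1 x)
      classical
      refine hD'.symm.trans ?_
      rw [Finset.sum_subset (Finset.subset_union_left (s₂ := D)) fun γ _ hγ => h0 γ hγ]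
      exact (Finset.sum_subset (Finset.subset_union_right (s₁ := D'))
        fun γ _ hγ => hD x γ hγ).symm
    rw [this]
    refine sum_mem fun γ _ => AddSubmonoid.subset_closure ⟨γ, fun x => ?_⟩
    exact (E.isDirectSum x).proj_mem γ _

/-- The graded `A_R(G)`-module `Γ_c(E)`. -/
def grGammaObj : GrMod (steinbergGrading κ R) where
  toUMod := gammaObj E.toGSheaf
  comp := sectionsComp E
  isDirectSum := sectionsComp_isDirectSum E
  act_mem {γ δ s f} hs hf x := by
    change pair x _ f ∈ E.comp (γ * δ) x
    rw [pair_apply]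
    refine Submodule.sum_mem _ fun y hy => Submodule.smul_mem _ _ ?_
    have hy' : κ.deg y.2 = δ := hf _ (Finsupp.mem_support_iff.1 hy)
    rw [← hy']
    exact E.act_mem y.2 (hs y.1)

variable (κ R)

/-- The functor `Γ_c` from graded `G`-sheaves of `R`-modules to graded `A_R(G)`-modules. -/
def grGammaC : GrSheaf κ R ⥤ GrMod (steinbergGrading κ R) where
  obj E := grGammaObj E
  map {E F} φ := ⟨gammaMap φ.toHom, fun {γ} (s : sections E.toGSheaf) hs x => φ.map_mem (hs x)⟩

/-- The functor `Γ_c` from `G_ε`-sheaves of `R`-modules to unital `A_R(G)_ε`-modules. -/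
def neutralGammaC : GSheaf R (Neutral κ) ⥤ UMod (steinbergGrading κ R).neutral :=
  gammaC R (Neutral κ) ⋙ restrictEquiv (neutralEquiv κ R)

end Graded

/-! ### The functors `Sh` -/

section Sh

variable {R : Type u} [CommRing R] {X : Type u} [Groupoid.{u} X] [TopologicalSpace X]
  [TopologicalSpace (Arr X)] [IsAmpleGroupoid X]

theorem continuous_secTop {F F' : X → Type u} [∀ x, AddCommGroup (F x)]
    [∀ x, AddCommGroup (F' x)] {S S' : Type u} [AddCommGroup S] [AddCommGroup S']
    (sec : ∀ x, S →+ F x) (sec' : ∀ x, S' →+ F' x)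
    (hsurj : ∀ x, Function.Surjective (sec x))
    (hgerm : ∀ x s, sec x s = 0 → ∀ᶠ z in 𝓝 x, sec z s = 0)
    (hsurj' : ∀ x, Function.Surjective (sec' x))
    (hgerm' : ∀ x s, sec' x s = 0 → ∀ᶠ z in 𝓝 x, sec' z s = 0)
    (φ : ∀ x, F x → F' x) (h : ∀ s, ∃ t, ∀ x, φ x (sec x s) = sec' x t) :
    Continuous[secTop fun x s => sec x s, secTop fun x s => sec' x s]
      fun e : Σ x, F x => (⟨e.1, φ e.1 e.2⟩ : Σ x, F' x) := by
  let _ : TopologicalSpace (Σ x, F x) := secTop fun x s => sec x s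
  let _ : TopologicalSpace (Σ x, F' x) := secTop fun x s => sec' x s
  refine ⟨fun V hV => (isOpen_secTop_iff sec hsurj hgerm).2 fun s => ?_⟩
  obtain ⟨t, ht⟩ := h s
  convert (isOpen_secTop_iff sec' hsurj' hgerm').1 hV t using 1
  ext x
  change (⟨x, φ x (sec x s)⟩ : Σ x, F' x) ∈ V ↔ _
  rw [ht]
  rfl

theorem oneU_mul_oneU {U V : Set X} (hc : IsCompact U) (ho : IsOpen U) (hc' : IsCompact V)
    (ho' : IsOpen V) (h : V ⊆ U) : oneU R hc ho * oneU R hc' ho' = oneU R hc' ho' := by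
  classical
  refine steinberg_ext fun k => ?_
  rw [oneU_mul_apply]
  split_ifs with hk
  · rfl
  · refine (ind_of_notMem ?_).symm
    rintro ⟨z, hz, rfl⟩
    exact hk (h hz)

theorem GermEq.smul {x : X} {f g : SteinbergAlgebra R X} (h : GermEq x f g) (r : R) :
    GermEq x (r • f) (r • g) := by
  filter_upwards [h] with z hz
  rw [map_smul, map_smul, hz]

theorem GermEq.trans {x : X} {f g h : SteinbergAlgebra R X} (h1 : GermEq x f g)
    (h2 : GermEq x g h) : GermEq x f h := by
  filter_upwards [h1, h2] with z hz hz'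
  exact hz.trans hz'

theorem GermEq.symm {x : X} {f g : SteinbergAlgebra R X} (h : GermEq x f g) : GermEq x g f := by
  filter_upwards [h] with z hz
  exact hz.symm

variable (M : UMod (SteinbergAlgebra R X))

theorem act_oneU_of_subset {m : M.carrier} {U V : Set X} (hc : IsCompact U) (ho : IsOpen U)
    (hc' : IsCompact V) (ho' : IsOpen V) (h : V ⊆ U) (hm : M.act m (oneU R hc ho) = 0) :
    M.act m (oneU R hc' ho') = 0 := by
  rw [← oneU_mul_oneU hc ho hc' ho' h, ← M.act_act, hm, map_zero, AddMonoidHom.zero_apply]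

/-- The kernel of the map from `M` to the direct limit of the groups `M 1_U`, over the compact open
neighbourhoods `U` of `x`, with the connecting maps `m ↦ m 1_V`. -/
def germKer (x : X) : AddSubgroup M.carrier where
  carrier := {m | ∃ (U : Set X) (hc : IsCompact U) (ho : IsOpen U), x ∈ U ∧
    M.act m (oneU R hc ho) = 0}
  zero_mem' := by
    obtain ⟨U, hc, ho, hx, -⟩ := exists_compactOpen (Filter.univ_mem : univ ∈ 𝓝 x)
    exact ⟨U, hc, ho, hx, by rw [map_zero, AddMonoidHom.zero_apply]⟩
  add_mem' := by
    rintro m n ⟨U, hc, ho, hx, hU⟩ ⟨V, hc', ho', hx', hV⟩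
    obtain ⟨W, hcW, hoW, hxW, hW⟩ := exists_compactOpen
      (Filter.inter_mem (ho.mem_nhds hx) (ho'.mem_nhds hx'))
    refine ⟨W, hcW, hoW, hxW, ?_⟩
    rw [map_add, AddMonoidHom.add_apply,
      act_oneU_of_subset M hc ho hcW hoW (hW.trans inter_subset_left) hU,
      act_oneU_of_subset M hc' ho' hcW hoW (hW.trans inter_subset_right) hV, add_zero]
  neg_mem' := by
    rintro m ⟨U, hc, ho, hx, hU⟩
    exact ⟨U, hc, ho, hx, by rw [map_neg, AddMonoidHom.neg_apply, hU, neg_zero]⟩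

/-- The direct limit of the groups `M 1_U`, over the compact open neighbourhoods `U` of `x`. -/
def ShStalk (x : X) : Type u := M.carrier ⧸ germKer M x

instance (x : X) : AddCommGroup (ShStalk M x) :=
  inferInstanceAs (AddCommGroup (M.carrier ⧸ germKer M x))

/-- The map `m ↦ [m]_x`. -/
def germ (x : X) : M.carrier →+ ShStalk M x := QuotientAddGroup.mk' (germKer M x)

theorem germ_surjective (x : X) : Function.Surjective (germ M x) :=
  QuotientAddGroup.mk'_surjective _

theorem germ_eq_zero {x : X} {m : M.carrier} : germ M x m = 0 ↔ m ∈ germKer M x :=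
  QuotientAddGroup.eq_zero_iff m

theorem germ_near {x : X} {m : M.carrier} (h : germ M x m = 0) :
    ∀ᶠ z in 𝓝 x, germ M z m = 0 := by
  obtain ⟨U, hc, ho, hx, hU⟩ := (germ_eq_zero M).1 h
  filter_upwards [ho.mem_nhds hx] with z hz
  exact (germ_eq_zero M).2 ⟨U, hc, ho, hz, hU⟩

theorem germ_act_congr {x : X} (m : M.carrier) {f g : SteinbergAlgebra R X}
    (h : GermEq x f g) : germ M x (M.act m f) = germ M x (M.act m g) := by
  obtain ⟨U, hc, ho, hx, hU⟩ := h.mul_oneU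
  rw [← sub_eq_zero, ← map_sub, germ_eq_zero]
  refine ⟨U, hc, ho, hx, ?_⟩
  rw [map_sub, AddMonoidHom.sub_apply, M.act_act, M.act_act, hU, sub_self]

theorem germ_act_oneU {x : X} (m : M.carrier) {U : Set X} (hc : IsCompact U) (ho : IsOpen U)
    (hx : x ∈ U) : germ M x (M.act m (oneU R hc ho)) = germ M x m := by
  rw [← sub_eq_zero, ← map_sub, germ_eq_zero]
  refine ⟨U, hc, ho, hx, ?_⟩
  rw [map_sub, AddMonoidHom.sub_apply, M.act_act, oneU_mul_self, sub_self]

/-- A compact open bisection containing `k`. -/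
def someCOB (k : Arr X) : Set (Arr X) := (exists_cob (Filter.univ_mem : univ ∈ 𝓝 k)).choose

theorem isCOB_someCOB (k : Arr X) : IsCOB (someCOB k) :=
  (exists_cob (Filter.univ_mem : univ ∈ 𝓝 k)).choose_spec.1

theorem mem_someCOB (k : Arr X) : k ∈ someCOB k :=
  (exists_cob (Filter.univ_mem : univ ∈ 𝓝 k)).choose_spec.2.1

/-- A compact open set of units containing `x`. -/
def someCO (x : X) : Set X := (exists_compactOpen (Filter.univ_mem : univ ∈ 𝓝 x)).choose

theorem isCompact_someCO (x : X) : IsCompact (someCO x) :=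
  (exists_compactOpen (Filter.univ_mem : univ ∈ 𝓝 x)).choose_spec.1

theorem isOpen_someCO (x : X) : IsOpen (someCO x) :=
  (exists_compactOpen (Filter.univ_mem : univ ∈ 𝓝 x)).choose_spec.2.1

theorem mem_someCO (x : X) : x ∈ someCO x :=
  (exists_compactOpen (Filter.univ_mem : univ ∈ 𝓝 x)).choose_spec.2.2.1

theorem germ_act_zero {x y : X} {g : x ⟶ y} {m : M.carrier} (hm : germ M y m = 0)
    {f : SteinbergAlgebra R X}
    (hf : ∀ (U : Set X) (hc : IsCompact U) (ho : IsOpen U), y ∈ U → GermEq x (oneU R hc ho * f) f) :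
    germ M x (M.act m f) = 0 := by
  obtain ⟨U, hc, ho, hx, hU⟩ := (germ_eq_zero M).1 hm
  rw [← germ_act_congr M m (hf U hc ho hx), ← M.act_act, hU, map_zero, AddMonoidHom.zero_apply,
    map_zero]

/-- The map `[m]_y ↦ [m 1_B]_x`, for a compact open bisection `B` containing `g`. -/
def shActHom {x y : X} (g : x ⟶ y) : ShStalk M y →+ ShStalk M x :=
  QuotientAddGroup.lift (germKer M y)
    ((germ M x).comp (M.act.flip (one R (isCOB_someCOB (arr g))))) fun m hm =>
      germ_act_zero M (g := g) ((germ_eq_zero M).2 hm) fun U hc ho hU =>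
        germEq_oneU_mul (y := ⟨y, g⟩) _ (mem_someCOB (arr g)) hc ho hU

theorem shActHom_germ {x y : X} (g : x ⟶ y) (m : M.carrier) {B : Set (Arr X)} (hB : IsCOB B)
    (hg : arr g ∈ B) : shActHom M g (germ M y m) = germ M x (M.act m (one R hB)) :=
  germ_act_congr M m (germEq_one (y := ⟨y, g⟩) _ hB (mem_someCOB (arr g)) hg)

/-- The map `[m]_x ↦ [m (r 1_U)]_x`, for a compact open neighbourhood `U` of `x`. -/
def shSmulHom (x : X) (r : R) : ShStalk M x →+ ShStalk M x :=
  QuotientAddGroup.lift (germKer M x)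
    ((germ M x).comp (M.act.flip (r • oneU R (isCompact_someCO x) (isOpen_someCO x))))
      fun m hm => germ_act_zero M (g := 𝟙 x) ((germ_eq_zero M).2 hm) fun U hc ho hU => by
        rw [mul_smul_one]
        exact (germEq_oneU_mul (y := ⟨x, 𝟙 x⟩) _ (oneU_mem (mem_someCO x)) hc ho hU).smul r

theorem shSmulHom_germ {x : X} (r : R) (m : M.carrier) {U : Set X} (hc : IsCompact U)
    (ho : IsOpen U) (hx : x ∈ U) :
    shSmulHom M x r (germ M x m) = germ M x (M.act m (r • oneU R hc ho)) :=
  germ_act_congr M m ((germEq_one (y := ⟨x, 𝟙 x⟩) _ _ (oneU_mem (mem_someCO x))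
    (oneU_mem hx)).smul r)

instance (x : X) : SMul R (ShStalk M x) := ⟨fun r e => shSmulHom M x r e⟩

theorem smul_germ {x : X} (r : R) (m : M.carrier) {U : Set X} (hc : IsCompact U)
    (ho : IsOpen U) (hx : x ∈ U) :
    r • germ M x m = germ M x (M.act m (r • oneU R hc ho)) := shSmulHom_germ M r m hc ho hx

instance (x : X) : Module R (ShStalk M x) where
  one_smul e := by
    obtain ⟨m, rfl⟩ := germ_surjective M x e
    rw [smul_germ M 1 m (isCompact_someCO x) (isOpen_someCO x) (mem_someCO x), one_smul,
      germ_act_oneU _ _ _ _ (mem_someCO x)]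
  mul_smul r s e := by
    obtain ⟨m, rfl⟩ := germ_surjective M x e
    have h := fun r m => smul_germ M r m (isCompact_someCO x) (isOpen_someCO x) (mem_someCO x)
    rw [h, h, h, M.act_act, mul_smul_one, smul_one_mul, oneU_mul_self, smul_smul]
  smul_zero r := map_zero (shSmulHom M x r)
  smul_add r := map_add (shSmulHom M x r)
  add_smul r s e := by
    obtain ⟨m, rfl⟩ := germ_surjective M x e
    have h := fun r m => smul_germ M r m (isCompact_someCO x) (isOpen_someCO x) (mem_someCO x)
    rw [h, h, h, add_smul, map_add, map_add]
  zero_smul e := by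
    obtain ⟨m, rfl⟩ := germ_surjective M x e
    rw [smul_germ M 0 m (isCompact_someCO x) (isOpen_someCO x) (mem_someCO x), zero_smul,
      map_zero, map_zero]

/-- The action `[m]_y g = [m 1_B]_x`, for a compact open bisection `B` containing `g`. -/
def shAct {x y : X} (g : x ⟶ y) : ShStalk M y →ₗ[R] ShStalk M x where
  toFun := shActHom M g
  map_add' := map_add _
  map_smul' r e := by
    obtain ⟨m, rfl⟩ := germ_surjective M y e
    have h := isCOB_someCOB (arr g)
    have h' := mem_someCOB (arr g)
    rw [smul_germ M r m (isCompact_someCO y) (isOpen_someCO y) (mem_someCO y),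
      shActHom_germ M g _ h h', shActHom_germ M g _ h h', RingHom.id_apply,
      smul_germ M r _ (isCompact_someCO x) (isOpen_someCO x) (mem_someCO x), M.act_act, M.act_act,
      smul_one_mul]
    refine germ_act_congr M m (((germEq_oneU_mul (y := ⟨y, g⟩) h h' _ _
      (mem_someCO y)).smul r).trans ?_)
    exact (germEq_smul_oneU _ _ (mem_someCO x) r _).symm

theorem shAct_germ {x y : X} (g : x ⟶ y) (m : M.carrier) {B : Set (Arr X)} (hB : IsCOB B)
    (hg : arr g ∈ B) : shAct M g (germ M y m) = germ M x (M.act m (one R hB)) :=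
  shActHom_germ M g m hB hg

/-- The `G`-sheaf `Sh(M)`. -/
def shObj : GSheaf R X :=
  GSheaf.ofSections (germ M) (germ_surjective M) (fun _ _ h => germ_near M h)
    (fun x r m => by
      refine ⟨M.act m (r • oneU R (isCompact_someCO x) (isOpen_someCO x)), ?_⟩
      filter_upwards [(isOpen_someCO x).mem_nhds (mem_someCO x)] with z hz
      exact smul_germ M r m _ _ hz)
    (shAct M)
    (fun x e => by
      obtain ⟨m, rfl⟩ := germ_surjective M x e
      rw [shAct_germ M (𝟙 x) m (isCOB_unit (isCompact_someCO x) (isOpen_someCO x))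
        (oneU_mem (mem_someCO x))]
      exact germ_act_oneU M m (isCompact_someCO x) (isOpen_someCO x) (mem_someCO x))
    (fun {x y z} h g e => by
      obtain ⟨m, rfl⟩ := germ_surjective M z e
      rw [shAct_germ M g m (isCOB_someCOB (arr g)) (mem_someCOB (arr g)),
        shAct_germ M h _ (isCOB_someCOB (arr h)) (mem_someCOB (arr h)),
        shAct_germ M (h ≫ g) m (isCOB_someCOB (arr (h ≫ g))) (mem_someCOB (arr (h ≫ g))),
        M.act_act]
      exact (germ_act_congr M m (germEq_mul (h := h) (g := g) _ _ _ (mem_someCOB (arr g))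
        (mem_someCOB (arr h)) (mem_someCOB (arr (h ≫ g))))).symm)
    (fun {x y} g m => by
      refine ⟨M.act m (one R (isCOB_someCOB (arr g))), ?_⟩
      filter_upwards [(isCOB_someCOB (arr g)).isOpen.mem_nhds (mem_someCOB (arr g))] with k hk
      exact shAct_germ M k.hom m _ hk)

variable {M}

/-- The map `[m]_x ↦ [f(m)]_x` on stalks. -/
def shMapApp {N : UMod (SteinbergAlgebra R X)} (f : M.Hom N) (x : X) :
    ShStalk M x →ₗ[R] ShStalk N x where
  toFun := QuotientAddGroup.lift (germKer M x) ((germ N x).comp f.toFun) (by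
    rintro m ⟨U, hc, ho, hx, hU⟩
    refine (germ_eq_zero N).2 ⟨U, hc, ho, hx, ?_⟩
    rw [← f.map_act, hU, map_zero])
  map_add' := map_add _
  map_smul' r e := by
    obtain ⟨m, rfl⟩ := germ_surjective M x e
    rw [smul_germ M r m (isCompact_someCO x) (isOpen_someCO x) (mem_someCO x)]
    refine (congrArg (germ N x) (f.map_act m _)).trans ?_
    exact (smul_germ N r _ (isCompact_someCO x) (isOpen_someCO x) (mem_someCO x)).symm

theorem shMapApp_germ {N : UMod (SteinbergAlgebra R X)} (f : M.Hom N) (x : X) (m : M.carrier) :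
    shMapApp f x (germ M x m) = germ N x (f.toFun m) := rfl

theorem shMapApp_act {N : UMod (SteinbergAlgebra R X)} (f : M.Hom N) {x y : X} (g : x ⟶ y)
    (e : ShStalk M y) : shMapApp f x (shAct M g e) = shAct N g (shMapApp f y e) := by
  obtain ⟨m, rfl⟩ := germ_surjective M y e
  rw [shAct_germ M g m (isCOB_someCOB (arr g)) (mem_someCOB (arr g)), shMapApp_germ,
    shMapApp_germ, shAct_germ N g _ (isCOB_someCOB (arr g)) (mem_someCOB (arr g)), f.map_act]

/-- The morphism `[m]_x ↦ [f(m)]_x`. -/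
def shMap {N : UMod (SteinbergAlgebra R X)} (f : M.Hom N) : (shObj M).Hom (shObj N) where
  app := shMapApp f
  continuous := continuous_secTop (germ M) (germ N) (germ_surjective M)
    (fun _ _ h => germ_near M h) (germ_surjective N) (fun _ _ h => germ_near N h)
    (fun x => shMapApp f x) fun m => ⟨f.toFun m, fun x => shMapApp_germ f x m⟩
  map_act := shMapApp_act f

theorem shMapApp_id (x : X) (e : ShStalk M x) : shMapApp (𝟙 M) x e = e := by
  obtain ⟨m, rfl⟩ := germ_surjective M x e
  rfl

theorem shMapApp_comp {N P : UMod (SteinbergAlgebra R X)} (f : M ⟶ N) (g : N ⟶ P) (x : X)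
    (e : ShStalk M x) : shMapApp (f ≫ g) x e = shMapApp g x (shMapApp f x e) := by
  obtain ⟨m, rfl⟩ := germ_surjective M x e
  rfl

/-- The functor `Sh` from unital right `A_R(G)`-modules to `G`-sheaves of `R`-modules. -/
def sh (R : Type u) [CommRing R] (X : Type u) [Groupoid.{u} X] [TopologicalSpace X]
    [TopologicalSpace (Arr X)] [IsAmpleGroupoid X] : UMod (SteinbergAlgebra R X) ⥤ GSheaf R X where
  obj M := shObj M
  map f := shMap f
  map_id M := GSheaf.Hom.ext (funext fun x => LinearMap.ext (shMapApp_id (M := M) x))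
  map_comp f g := GSheaf.Hom.ext (funext fun x => LinearMap.ext (shMapApp_comp f g x))

/-! The graded version. -/

variable {Γ : Type v} [Group Γ] {κ : GroupoidGrading X Γ}

theorem oneU_mem_comp {U : Set X} (hc : IsCompact U) (ho : IsOpen U) :
    oneU R hc ho ∈ steinbergComp κ R 1 := by
  intro k hk
  have : k ∈ (unit : X → Arr X) '' U := by_contra fun h' => hk (ind_of_notMem h')
  obtain ⟨x, -, rfl⟩ := this
  exact deg_id κ x

theorem smul_mem_comp {γ : Γ} (r : R) {f : SteinbergAlgebra R X}
    (hf : f ∈ steinbergComp κ R γ) : r • f ∈ steinbergComp κ R γ := by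
  refine fun k hk => hf k fun h => hk ?_
  change r • f.1 k = 0
  rw [h, smul_zero]

theorem exists_homogeneous_cob (κ : GroupoidGrading X Γ) (k : Arr X) :
    ∃ (B : Set (Arr X)) (hB : IsCOB B), k ∈ B ∧
      one R hB ∈ steinbergComp κ R (κ.deg k.hom) := by
  obtain ⟨B, hB, hk, h⟩ := exists_cob ((isClopen_comp κ (κ.deg k.hom)).2.mem_nhds
    (show k ∈ κ.comp (κ.deg k.hom) from rfl))
  exact ⟨B, hB, hk, fun l hl => h (by_contra fun h' => hl (ind_of_notMem h'))⟩

variable (M : GrMod (steinbergGrading κ R))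

theorem proj_act (γ : Γ) (m : M.carrier) {a : SteinbergAlgebra R X}
    (ha : a ∈ steinbergComp κ R 1) :
    M.isDirectSum.proj γ (M.act m a) = M.act (M.isDirectSum.proj γ m) a := by
  refine M.isDirectSum.induction (p := fun m => M.isDirectSum.proj γ (M.act m a) =
    M.act (M.isDirectSum.proj γ m) a) ?_ ?_ ?_ m
  · simp only [map_zero, AddMonoidHom.zero_apply]
  · intro δ m hm
    have hma : M.act m a ∈ M.comp δ := by
      have := M.act_mem hm ha
      rwa [mul_one] at this
    by_cases h : γ = δ
    · subst h
      rw [M.isDirectSum.proj_of_mem hm, M.isDirectSum.proj_of_mem hma]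
    · rw [M.isDirectSum.proj_of_ne hm h, M.isDirectSum.proj_of_ne hma h, map_zero,
        AddMonoidHom.zero_apply]
  · intro m n hm hn
    simp only [map_add, AddMonoidHom.add_apply, hm, hn]

/-- The `γ`-component `{[m]_x | m ∈ M_γ}` of the stalk at `x`. -/
def shComp (γ : Γ) (x : X) : Submodule R (ShStalk M.toUMod x) where
  carrier := {e | ∃ m ∈ M.comp γ, germ M.toUMod x m = e}
  zero_mem' := ⟨0, zero_mem _, map_zero _⟩
  add_mem' := by
    rintro _ _ ⟨m, hm, rfl⟩ ⟨n, hn, rfl⟩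
    exact ⟨m + n, add_mem hm hn, map_add _ _ _⟩
  smul_mem' := by
    rintro r _ ⟨m, hm, rfl⟩
    refine ⟨_, ?_,
      (smul_germ M.toUMod r m (isCompact_someCO x) (isOpen_someCO x) (mem_someCO x)).symm⟩
    have := M.act_mem hm (smul_mem_comp (κ := κ) r
      (oneU_mem_comp (isCompact_someCO x) (isOpen_someCO x)))
    rwa [mul_one] at this

/-- The projection of the stalk at `x` to its `γ`-component. -/
def shProj (x : X) (γ : Γ) : ShStalk M.toUMod x →+ ShStalk M.toUMod x :=
  QuotientAddGroup.lift (germKer M.toUMod x) ((germ M.toUMod x).comp (M.isDirectSum.proj γ)) (by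
    rintro m ⟨U, hc, ho, hx, hU⟩
    refine (germ_eq_zero _).2 ⟨U, hc, ho, hx, ?_⟩
    rw [← proj_act M γ m (oneU_mem_comp hc ho), hU, map_zero])

theorem shProj_germ (x : X) (γ : Γ) (m : M.carrier) :
    shProj M x γ (germ M.toUMod x m) = germ M.toUMod x (M.isDirectSum.proj γ m) := rfl

theorem shComp_isDirectSum (x : X) : IsDirectSum fun γ => shComp M γ x := by
  refine IsDirectSum.of_proj (shProj M x) ?_ ?_ ?_ ?_
  · intro γ e
    obtain ⟨m, rfl⟩ := germ_surjective M.toUMod x e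
    exact ⟨_, M.isDirectSum.proj_mem γ m, rfl⟩
  · rintro γ _ ⟨m, hm, rfl⟩
    rw [shProj_germ, M.isDirectSum.proj_of_mem hm]
  · rintro γ δ _ ⟨m, hm, rfl⟩ h
    rw [shProj_germ, M.isDirectSum.proj_of_ne hm h, map_zero]
  · intro e
    obtain ⟨m, rfl⟩ := germ_surjective M.toUMod x e
    refine M.isDirectSum.induction (p := fun m => germ M.toUMod x m ∈
      AddSubmonoid.closure _) ?_ ?_ ?_ m
    · rw [map_zero]
      exact zero_mem _
    · intro γ m hm
      exact AddSubmonoid.subset_closure ⟨γ, m, hm, rfl⟩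
    · intro m n hm hn
      rw [map_add]
      exact add_mem hm hn

/-- The graded `G`-sheaf `Sh(M)`. -/
def grShObj : GrSheaf κ R where
  toGSheaf := shObj M.toUMod
  comp := shComp M
  isDirectSum := shComp_isDirectSum M
  isOpen_comp γ := by
    refine (isOpen_secTop_iff (germ M.toUMod) (germ_surjective _)
      (fun _ _ h => germ_near _ h)).2 fun m => ?_
    rw [isOpen_iff_mem_nhds]
    rintro x ⟨n, hn, h⟩
    rw [← sub_eq_zero, ← map_sub] at h
    filter_upwards [germ_near M.toUMod h] with z hz
    rw [map_sub, sub_eq_zero] at hz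
    exact ⟨n, hn, hz⟩
  act_mem {x y γ e} g he := by
    obtain ⟨m, hm, rfl⟩ := he
    obtain ⟨B, hB, hg, h⟩ := exists_homogeneous_cob (R := R) κ (arr g)
    exact ⟨_, M.act_mem hm h, (shAct_germ M.toUMod g m hB hg).symm⟩

end Sh

section GrSh

variable {X : Type u} [Groupoid.{u} X] [TopologicalSpace X] [TopologicalSpace (Arr X)]
  [IsAmpleGroupoid X] {Γ : Type v} [Group Γ] (κ : GroupoidGrading X Γ) (R : Type u) [CommRing R]

/-- The functor `Sh` from graded `A_R(G)`-modules to graded `G`-sheaves of `R`-modules. -/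
def grSh : GrMod (steinbergGrading κ R) ⥤ GrSheaf κ R where
  obj M := grShObj M
  map {M N} f := ⟨shMap f.toHom, by
    rintro γ x _ ⟨m, hm, rfl⟩
    exact ⟨_, f.map_mem hm, rfl⟩⟩
  map_id M := GrSheaf.Hom.ext (funext fun x => LinearMap.ext (shMapApp_id (M := M.toUMod) x))
  map_comp f g := GrSheaf.Hom.ext
    (funext fun x => LinearMap.ext (shMapApp_comp f.toHom g.toHom x))

/-- The functor `Sh` from unital `A_R(G)_ε`-modules to `G_ε`-sheaves of `R`-modules. -/
def neutralSh : UMod (steinbergGrading κ R).neutral ⥤ GSheaf R (Neutral κ) :=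
  restrictEquiv (neutralEquiv κ R).symm ⋙ sh R (Neutral κ)

end GrSh

/-! ### The induction functor on sheaves -/

section Induction

open TensorProduct

variable {X : Type u} [Groupoid.{u} X] [TopologicalSpace X] [TopologicalSpace (Arr X)]
  {Γ : Type v} [Group Γ] {κ : GroupoidGrading X Γ} {R : Type u} [CommRing R]

section Stalks

variable (E : GSheaf R (Neutral κ))

/-- The stalk of a `G_ε`-sheaf at an object of `G`. -/
def NStalk (x : X) : Type u := GSheaf.stalk (X := Neutral κ) E x

instance (x : X) : AddCommGroup (NStalk E x) := GSheaf.addCommGroup (X := Neutral κ) E x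

instance (x : X) : Module R (NStalk E x) := GSheaf.module (X := Neutral κ) E x

/-- The action of an arrow of degree `ε` of `G`. -/
def nAct {x y : X} (h : x ⟶ y) (hh : κ.deg h = 1) : NStalk E y →ₗ[R] NStalk E x :=
  GSheaf.act (X := Neutral κ) E (toNeutral κ h hh)

variable {E}

theorem nAct_id {x : X} {h : x ⟶ x} (hh : κ.deg h = 1) (hid : h = 𝟙 x) (e : NStalk E x) :
    nAct E h hh e = e := by
  subst hid
  exact GSheaf.act_id (X := Neutral κ) E x e

theorem nAct_comp {x y z : X} {h : x ⟶ y} {g : y ⟶ z} (hh : κ.deg h = 1) (hg : κ.deg g = 1)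
    {k : x ⟶ z} (hk : κ.deg k = 1) (he : k = h ≫ g) (e : NStalk E z) :
    nAct E k hk e = nAct E h hh (nAct E g hg e) := by
  subst he
  exact GSheaf.act_comp (X := Neutral κ) E (toNeutral κ h hh) (toNeutral κ g hg) e

variable (E)

/-- The free `R`-module on the symbols `e ⊗ y`, with `y ∈ G^x` and `e ∈ E_{c y}`. -/
abbrev Free (x : X) : Type u := (Σ y : Quiver.Star x, NStalk E y.1) →₀ R

variable {E} in
/-- The generator `e ⊗ y` of the free module. -/
def sym {x : X} (y : Quiver.Star x) (e : NStalk E y.1) : Free E x := Finsupp.single ⟨y, e⟩ 1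

/-- The relations `e ⊗ y + e' ⊗ y = (e + e') ⊗ y`, `(r e) ⊗ y = r (e ⊗ y)` and, for `h` of degree
`ε`, `e h ⊗ y = e ⊗ h y`. -/
inductive Rel (x : X) : Free E x → Free E x → Prop
  | add (y : Quiver.Star x) (e e' : NStalk E y.1) : Rel x (sym y e + sym y e') (sym y (e + e'))
  | smul (y : Quiver.Star x) (r : R) (e : NStalk E y.1) : Rel x (sym y (r • e)) (r • sym y e)
  | act (y : Quiver.Star x) {z : X} (h : y.1 ⟶ z) (hh : κ.deg h = 1) (e : NStalk E z) :
      Rel x (sym y (nAct E h hh e)) (sym ⟨z, y.2 ≫ h⟩ e)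

/-- The `R`-submodule generated by the relations. -/
def relSpan (x : X) : Submodule R (Free E x) :=
  Submodule.span R {t | ∃ a b, Rel E x a b ∧ t = a - b}

/-- The `R`-module `E ⊗ G^x`. -/
def TStalk (x : X) : Type u := Free E x ⧸ relSpan E x

instance (x : X) : AddCommGroup (TStalk E x) :=
  inferInstanceAs (AddCommGroup (Free E x ⧸ relSpan E x))

instance (x : X) : Module R (TStalk E x) :=
  inferInstanceAs (Module R (Free E x ⧸ relSpan E x))

/-- The quotient map. -/
def tMk (x : X) : Free E x →ₗ[R] TStalk E x := (relSpan E x).mkQ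

variable {E}

theorem tMk_rel {x : X} {a b : Free E x} (h : Rel E x a b) : tMk E x a = tMk E x b := by
  have h1 : a - b ∈ relSpan E x := Submodule.subset_span ⟨a, b, h, rfl⟩
  exact (Submodule.Quotient.eq _).2 h1

/-- The element `e ⊗ y` of `E ⊗ G^x`. -/
def ten {x : X} (y : Quiver.Star x) : NStalk E y.1 →ₗ[R] TStalk E x where
  toFun e := tMk E x (sym y e)
  map_add' e e' := by rw [← tMk_rel (.add y e e'), map_add]
  map_smul' r e := by rw [tMk_rel (.smul y r e), map_smul]; rfl

theorem ten_act {x : X} (y : Quiver.Star x) {z : X} (h : y.1 ⟶ z) (hh : κ.deg h = 1)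
    (e : NStalk E z) : ten y (nAct E h hh e) = ten (⟨z, y.2 ≫ h⟩ : Quiver.Star x) e :=
  tMk_rel (.act y h hh e)

theorem ten_induction {x : X} {p : TStalk E x → Prop} (hten : ∀ y e, p (ten y e)) (hzero : p 0)
    (hadd : ∀ a b, p a → p b → p (a + b)) (t : TStalk E x) : p t := by
  obtain ⟨t, rfl⟩ := (relSpan E x).mkQ_surjective t
  change p (tMk E x t)
  induction t using Finsupp.induction_linear with
  | zero => rwa [map_zero]
  | add a b ha hb => rw [map_add]; exact hadd _ _ ha hb
  | single a r =>
    obtain ⟨y, e⟩ := a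
    have h1 : Finsupp.single (⟨y, e⟩ : Σ y : Quiver.Star x, NStalk E y.1) r = r • sym y e := by
      rw [sym, Finsupp.smul_single, smul_eq_mul, mul_one]
    rw [h1, ← tMk_rel (.smul y r e)]
    exact hten y (r • e)

theorem ten_ext {x : X} {P : Type*} [AddCommGroup P] [Module R P] {f g : TStalk E x →ₗ[R] P}
    (h : ∀ y e, f (ten y e) = g (ten y e)) (t : TStalk E x) : f t = g t := by
  refine ten_induction (p := fun t => f t = g t) h (by rw [map_zero, map_zero]) ?_ t
  intro a b ha hb
  rw [map_add, map_add, ha, hb]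

/-- The linear map on `E ⊗ G^x` induced by a family of linear maps that respects the
relations. -/
def tLift {x : X} {P : Type*} [AddCommGroup P] [Module R P]
    (φ : ∀ y : Quiver.Star x, NStalk E y.1 →ₗ[R] P)
    (hφ : ∀ (y : Quiver.Star x) {z : X} (h : y.1 ⟶ z) (hh : κ.deg h = 1) (e : NStalk E z),
      φ y (nAct E h hh e) = φ ⟨z, y.2 ≫ h⟩ e) : TStalk E x →ₗ[R] P :=
  (relSpan E x).liftQ (Finsupp.linearCombination R fun a => φ a.1 a.2) (by
    have key : ∀ (y : Quiver.Star x) (e : NStalk E y.1),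
        Finsupp.linearCombination R (fun a : Σ y : Quiver.Star x, NStalk E y.1 => φ a.1 a.2)
          (sym y e) = φ y e := fun y e => by
      rw [sym, Finsupp.linearCombination_single, one_smul]
    refine Submodule.span_le.2 ?_
    rintro _ ⟨a, b, h, rfl⟩
    rw [SetLike.mem_coe, LinearMap.mem_ker, map_sub, sub_eq_zero]
    cases h with
    | add y e e' => rw [map_add, key, key, key, map_add]
    | smul y r e => rw [map_smul, key, key, map_smul]
    | act y h hh e => rw [key, key, hφ])

theorem tLift_ten {x : X} {P : Type*} [AddCommGroup P] [Module R P]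
    (φ : ∀ y : Quiver.Star x, NStalk E y.1 →ₗ[R] P)
    (hφ : ∀ (y : Quiver.Star x) {z : X} (h : y.1 ⟶ z) (hh : κ.deg h = 1) (e : NStalk E z),
      φ y (nAct E h hh e) = φ ⟨z, y.2 ≫ h⟩ e) (y : Quiver.Star x) (e : NStalk E y.1) :
    tLift φ hφ (ten y e) = φ y e := by
  change Finsupp.linearCombination R (fun a : Σ y : Quiver.Star x, NStalk E y.1 => φ a.1 a.2)
    (sym y e) = φ y e
  rw [sym, Finsupp.linearCombination_single, one_smul]

/-- The action `(e ⊗ y) g = e ⊗ y g`. -/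
def tAct {x y : X} (g : x ⟶ y) : TStalk E y →ₗ[R] TStalk E x :=
  tLift (fun v => ten (rt ⟨y, g⟩ v)) (by
    intro v z h hh e
    refine (ten_act (rt ⟨y, g⟩ v) h hh e).trans ?_
    unfold rt
    rw [Category.assoc])

theorem tAct_ten {x y : X} (g : x ⟶ y) (v : Quiver.Star y) (e : NStalk E v.1) :
    tAct g (ten v e) = ten (rt ⟨y, g⟩ v) e := tLift_ten _ _ _ _

theorem ten_congr {x z : X} {k k' : x ⟶ z} (h : k = k') (e : NStalk E z) :
    ten (⟨z, k⟩ : Quiver.Star x) e = ten (⟨z, k'⟩ : Quiver.Star x) e := by rw [h]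

theorem tAct_id (x : X) (t : TStalk E x) : tAct (𝟙 x) t = t := by
  refine ten_ext (f := tAct (𝟙 x)) (g := LinearMap.id) (fun y e => ?_) t
  rw [tAct_ten]
  exact ten_congr (Category.id_comp _) e

theorem tAct_comp {x y z : X} (h : x ⟶ y) (g : y ⟶ z) (t : TStalk E z) :
    tAct (h ≫ g) t = tAct h (tAct g t) := by
  refine ten_ext (f := tAct (h ≫ g)) (g := tAct h ∘ₗ tAct g) (fun v e => ?_) t
  refine (tAct_ten _ v e).trans ?_
  refine Eq.trans ?_ (congrArg (tAct h) (tAct_ten g v e)).symm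
  refine Eq.trans ?_ (tAct_ten h (rt ⟨z, g⟩ v) e).symm
  exact ten_congr (Category.assoc _ _ _) e

/-! The grading of `E ⊗ G^x`. -/

variable (E) in
/-- The component `E ⊗ G^x_γ`, generated by the elements `e ⊗ y` with `y` of degree `γ`. -/
def tComp (γ : Γ) (x : X) : Submodule R (TStalk E x) :=
  Submodule.span R {t | ∃ (y : Quiver.Star x) (e : NStalk E y.1), κ.deg y.2 = γ ∧ ten y e = t}

theorem ten_mem {γ : Γ} {x : X} {y : Quiver.Star x} (hy : κ.deg y.2 = γ) (e : NStalk E y.1) :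
    ten y e ∈ tComp E γ x := Submodule.subset_span ⟨y, e, hy, rfl⟩

theorem deg_comp_one {x y z : X} (g : x ⟶ y) {h : y ⟶ z} (hh : κ.deg h = 1) :
    κ.deg (g ≫ h) = κ.deg g := by rw [κ.deg_comp, hh, one_mul]

variable (E) in
/-- The projection to `E ⊗ G^x_γ`. -/
def tProj (x : X) (γ : Γ) : TStalk E x →ₗ[R] TStalk E x :=
  open Classical in
  tLift (fun y => if κ.deg y.2 = γ then ten y else 0) (by
    intro y z h hh e
    rw [deg_comp_one y.2 hh]
    split_ifs
    · exact ten_act y h hh e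
    · rfl)

theorem tProj_ten_of_eq {x : X} {γ : Γ} {y : Quiver.Star x} (hy : κ.deg y.2 = γ)
    (e : NStalk E y.1) : tProj E x γ (ten y e) = ten y e := by
  rw [tProj, tLift_ten, if_pos hy]

theorem tProj_ten_of_ne {x : X} {γ : Γ} {y : Quiver.Star x} (hy : κ.deg y.2 ≠ γ)
    (e : NStalk E y.1) : tProj E x γ (ten y e) = 0 := by
  rw [tProj, tLift_ten, if_neg hy]
  rfl

theorem tProj_of_mem {x : X} {γ : Γ} {t : TStalk E x} (ht : t ∈ tComp E γ x) :
    tProj E x γ t = t := by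
  refine LinearMap.eqOn_span (f := tProj E x γ) (g := LinearMap.id) ?_ ht
  rintro _ ⟨y, e, hy, rfl⟩
  exact tProj_ten_of_eq hy e

theorem tProj_mem (x : X) (γ : Γ) (t : TStalk E x) : tProj E x γ t ∈ tComp E γ x := by
  refine ten_induction (p := fun t => tProj E x γ t ∈ tComp E γ x) ?_ ?_ ?_ t
  · intro y e
    by_cases hy : κ.deg y.2 = γ
    · rw [tProj_ten_of_eq hy]
      exact ten_mem hy e
    · rw [tProj_ten_of_ne hy]
      exact zero_mem _
  · rw [map_zero]
    exact zero_mem _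
  · intro a b ha hb
    rw [map_add]
    exact add_mem ha hb

theorem tComp_isDirectSum (x : X) : IsDirectSum fun γ => tComp E γ x := by
  refine IsDirectSum.of_proj (fun γ => (tProj E x γ).toAddMonoidHom) ?_ ?_ ?_ ?_
  · exact fun γ t => tProj_mem x γ t
  · exact fun γ t ht => tProj_of_mem ht
  · intro γ δ t ht h
    refine LinearMap.eqOn_span (f := tProj E x δ) (g := 0) ?_ ht
    rintro _ ⟨y, e, hy, rfl⟩
    exact tProj_ten_of_ne (by rw [hy]; exact Ne.symm h) e
  · refine ten_induction ?_ (zero_mem _) (fun a b => add_mem)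
    intro y e
    exact AddSubmonoid.subset_closure ⟨_, ten_mem rfl e⟩

theorem tAct_mem {x y : X} {γ : Γ} {t : TStalk E y} (g : x ⟶ y) (ht : t ∈ tComp E γ y) :
    tAct g t ∈ tComp E (γ * κ.deg g) x := by
  have h : tComp E γ y ≤ (tComp E (γ * κ.deg g) x).comap (tAct g) := by
    refine Submodule.span_le.2 ?_
    rintro _ ⟨v, e, hv, rfl⟩
    rw [SetLike.mem_coe, Submodule.mem_comap, tAct_ten]
    refine ten_mem (y := rt ⟨y, g⟩ v) ?_ e
    rw [← hv]
    exact κ.deg_comp g v.2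
  exact h ht

/-! Functoriality. -/

/-- The map on stalks. -/
def nApp {F : GSheaf R (Neutral κ)} (φ : E.Hom F) (x : X) : NStalk E x →ₗ[R] NStalk F x :=
  GSheaf.Hom.app (X := Neutral κ) φ x

theorem nApp_act {F : GSheaf R (Neutral κ)} (φ : E.Hom F) {x y : X} (h : x ⟶ y)
    (hh : κ.deg h = 1) (e : NStalk E y) :
    nApp φ x (nAct E h hh e) = nAct F h hh (nApp φ y e) :=
  GSheaf.Hom.map_act (X := Neutral κ) φ (toNeutral κ h hh) e

/-- The map `e ⊗ y ↦ φ(e) ⊗ y`. -/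
def tMap {F : GSheaf R (Neutral κ)} (φ : E.Hom F) (x : X) : TStalk E x →ₗ[R] TStalk F x :=
  tLift (fun y => ten y ∘ₗ nApp φ y.1) (by
    intro y z h hh e
    rw [LinearMap.comp_apply, nApp_act, ten_act]
    rfl)

theorem tMap_ten {F : GSheaf R (Neutral κ)} (φ : E.Hom F) {x : X} (y : Quiver.Star x)
    (e : NStalk E y.1) : tMap φ x (ten y e) = ten y (nApp φ y.1 e) := tLift_ten _ _ _ _

theorem tMap_act {F : GSheaf R (Neutral κ)} (φ : E.Hom F) {x y : X} (g : x ⟶ y)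
    (t : TStalk E y) : tMap φ x (tAct g t) = tAct g (tMap φ y t) := by
  refine ten_ext (f := tMap φ x ∘ₗ tAct g) (g := tAct g ∘ₗ tMap φ y) (fun v e => ?_) t
  refine (congrArg (tMap φ x) (tAct_ten g v e)).trans ?_
  refine (tMap_ten φ (rt ⟨y, g⟩ v) e).trans ?_
  refine Eq.trans ?_ (congrArg (tAct g) (tMap_ten φ v e)).symm
  exact (tAct_ten g v _).symm

theorem tMap_mem {F : GSheaf R (Neutral κ)} (φ : E.Hom F) {x : X} {γ : Γ} {t : TStalk E x}
    (ht : t ∈ tComp E γ x) : tMap φ x t ∈ tComp F γ x := by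
  have h : tComp E γ x ≤ (tComp F γ x).comap (tMap φ x) := by
    refine Submodule.span_le.2 ?_
    rintro _ ⟨v, e, hv, rfl⟩
    rw [SetLike.mem_coe, Submodule.mem_comap, tMap_ten]
    exact ten_mem hv _
  exact h ht

end Stalks

/-! The topology of `E ⊗_{G_ε} G`. -/

variable [IsAmpleGroupoid X] {E : GSheaf R (Neutral κ)}

/-- The value `s(x)` of a section. -/
def ev (x : X) : sections E →ₗ[R] NStalk E x where
  toFun s := s.1 x
  map_add' _ _ := rfl
  map_smul' _ _ := rfl

theorem ev_surjective (x : X) : Function.Surjective (ev (E := E) x) := by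
  intro e
  obtain ⟨s, hs, h, -⟩ := exists_section (X := Neutral κ) E (x := x) e Filter.univ_mem
  exact ⟨⟨s, hs⟩, h⟩

theorem ev_near {x : X} {s : sections E} (h : ev x s = 0) : ∀ᶠ z in 𝓝 x, ev z s = 0 :=
  (isOpen_zero (X := Neutral κ) E s.2.1).mem_nhds h

theorem ev_act {y z : X} (h : y ⟶ z) (hh : κ.deg h = 1) (s : sections E) :
    ∃ s' : sections E, ∀ᶠ k in 𝓝 (arr h), ∃ hk : κ.deg k.hom = 1,
      ev k.left s' = nAct E k.hom hk (ev k.right s) := by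
  obtain ⟨K, hK, hm, -⟩ := exists_cob (X := Neutral κ) (k := arr (toNeutral κ h hh))
    Filter.univ_mem
  refine ⟨⟨sact (X := Neutral κ) E s.1 (one R hK), sact_mem (X := Neutral κ) E s.2 _⟩, ?_⟩
  have h1 := (isOpenEmbedding_incl κ).isOpenMap.image_mem_nhds (hK.isOpen.mem_nhds hm)
  filter_upwards [h1]
  rintro _ ⟨k, hk, rfl⟩
  exact ⟨k.hom.2, sact_one_of_mem (X := Neutral κ) E s.1 hK (y := ⟨k.right, k.hom⟩) hk⟩

/-- The section `x ↦ ∑_{y ∈ G^x} f(y) s(c y) ⊗ y` attached to `s ⊗ f`, extended linearly. -/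
def secJ (x : X) : sections E ⊗[R] SteinbergAlgebra R X →ₗ[R] TStalk E x :=
  TensorProduct.lift (LinearMap.mk₂ R (fun s f => pair x (fun y => ten y (ev y.1 s)) f)
    (fun s s' f => by
      refine Eq.trans ?_ (pair_add_left _ _ _ _)
      simp only [map_add])
    (fun r s f => by
      refine Eq.trans ?_ (map_pair (LinearMap.lsmul R (TStalk E x) r) _ _ _).symm
      simp only [map_smul, LinearMap.lsmul_apply])
    (fun s f g => map_add _ _ _) (fun r s f => map_smul _ _ _))

theorem secJ_tmul (x : X) (s : sections E) (f : SteinbergAlgebra R X) :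
    secJ x (s ⊗ₜ[R] f) = pair x (fun y => ten y (ev y.1 s)) f := rfl

theorem secJ_one_of_mem {x : X} (s : sections E) {B : Set (Arr X)} (hB : IsCOB B)
    {y : Quiver.Star x} (hy : arr y.2 ∈ B) :
    secJ x (s ⊗ₜ[R] one R hB) = ten y (ev y.1 s) := by
  rw [secJ_tmul]
  exact pair_one_of_mem hB _ hy

theorem secJ_one_of_notMem {x : X} (s : sections E) {B : Set (Arr X)} (hB : IsCOB B)
    (h : ∀ y : Quiver.Star x, arr y.2 ∉ B) : secJ x (s ⊗ₜ[R] one R hB) = 0 := by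
  rw [secJ_tmul]
  exact pair_one_of_notMem hB _ h

theorem secJ_surjective (x : X) : Function.Surjective (secJ (E := E) x) := by
  refine ten_induction ?_ ⟨0, map_zero _⟩ ?_
  · intro y e
    obtain ⟨s, rfl⟩ := ev_surjective y.1 e
    exact ⟨s ⊗ₜ one R (isCOB_someCOB (arr y.2)), secJ_one_of_mem s _ (mem_someCOB (arr y.2))⟩
  · rintro _ _ ⟨a, rfl⟩ ⟨b, rfl⟩
    exact ⟨a + b, map_add _ _ _⟩

/-- Near `x`, an element of `Γ_c(E) ⊗ A` can be compared with a combination of prescribed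
bisections, one for each degree. -/
theorem secJ_normal {x : X} {V : Γ → Prop} (hV : ∀ y : Quiver.Star x, V (κ.deg y.2))
    (w : ∀ γ, V γ → Quiver.Star x) (hw : ∀ γ h, κ.deg (w γ h).2 = γ)
    {B : ∀ γ, V γ → Set (Arr X)} (hB : ∀ γ h, IsCOB (B γ h))
    (hwB : ∀ γ h, arr (w γ h).2 ∈ B γ h) (β : Γ → SteinbergAlgebra R X)
    (hβ : ∀ γ h, β γ = one R (hB γ h)) (t : sections E ⊗[R] SteinbergAlgebra R X) :
    ∃ σ : Γ →₀ sections E, ∀ᶠ z in 𝓝 x, secJ z t = secJ z (Finsupp.lsum R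
      (fun γ => (TensorProduct.mk R (sections E) (SteinbergAlgebra R X)).flip (β γ)) σ) := by
  set Φ : (Γ →₀ sections E) →ₗ[R] sections E ⊗[R] SteinbergAlgebra R X := Finsupp.lsum R
    (fun γ => (TensorProduct.mk R (sections E) (SteinbergAlgebra R X)).flip (β γ)) with hΦ
  have hadd : ∀ t t' : sections E ⊗[R] SteinbergAlgebra R X,
      (∃ σ, ∀ᶠ z in 𝓝 x, secJ z t = secJ z (Φ σ)) →
      (∃ σ, ∀ᶠ z in 𝓝 x, secJ z t' = secJ z (Φ σ)) →
      ∃ σ, ∀ᶠ z in 𝓝 x, secJ z (t + t') = secJ z (Φ σ) := by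
    rintro t t' ⟨σ, h⟩ ⟨σ', h'⟩
    refine ⟨σ + σ', ?_⟩
    filter_upwards [h, h'] with z h1 h2
    rw [map_add, map_add, map_add, h1, h2]
  induction t using TensorProduct.induction_on with
  | zero => exact ⟨0, .of_forall fun z => by simp only [map_zero]⟩
  | add t t' h h' => exact hadd _ _ h h'
  | tmul s f =>
    refine steinberg_induction (p := fun f => ∃ σ, ∀ᶠ z in 𝓝 x,
      secJ z (s ⊗ₜ[R] f) = secJ z (Φ σ)) (fun C hC => ?_) (fun f g hf hg => ?_)
      (fun r f hf => ?_) f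
    · by_cases hx : ∃ y : Quiver.Star x, arr y.2 ∈ C
      · obtain ⟨y, hy⟩ := hx
        obtain ⟨γ, hγ⟩ : ∃ γ, κ.deg y.2 = γ := ⟨_, rfl⟩
        have hVγ : V γ := hγ ▸ hV y
        have hdeg : κ.deg (inv (w γ hVγ).2 ≫ y.2) = 1 := by
          rw [κ.deg_comp, deg_inv, hw, hγ, mul_inv_cancel]
        obtain ⟨s', hs'⟩ := ev_act _ hdeg s
        obtain ⟨D, hD, D', hD', hDD⟩ := comp_nhds _ _ hs'
        have h1 := (continuous_invArr (X := X)).continuousAt (x := arr (w γ hVγ).2) hD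
        refine ⟨Finsupp.single γ s', ?_⟩
        filter_upwards [near_left y (Filter.inter_mem (hC.isOpen.mem_nhds hy) hD'),
          near_left (w γ hVγ) (Filter.inter_mem ((hB γ hVγ).isOpen.mem_nhds (hwB γ hVγ)) h1)]
          with z ⟨v, hv, hv'⟩ ⟨a, ha, ha'⟩
        obtain ⟨hk, hk'⟩ := hDD (inv a.2) v.2 ha' hv'
        have h2 : Φ (Finsupp.single γ s') = s' ⊗ₜ[R] one R (hB γ hVγ) := by
          rw [hΦ, Finsupp.lsum_single, ← hβ γ hVγ]
          rfl
        rw [h2, secJ_one_of_mem s hC hv, secJ_one_of_mem s' _ ha]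
        refine Eq.trans ?_ (congrArg (ten a) hk').symm
        rw [ten_act]
        exact ten_congr (by simp) _
      · push Not at hx
        refine ⟨0, ?_⟩
        filter_upwards [near_not hC.isCompact hx] with z hz
        rw [secJ_one_of_notMem s hC hz, map_zero, map_zero]
    · rw [TensorProduct.tmul_add]
      exact hadd _ _ hf hg
    · obtain ⟨σ, h⟩ := hf
      refine ⟨r • σ, ?_⟩
      filter_upwards [h] with z hz
      rw [TensorProduct.tmul_smul, map_smul, map_smul, map_smul, hz]

/-- The map `e ⊗ y ↦ e h` for `y = h w` of the same degree as `w`, and `e ⊗ y ↦ 0` for `y` of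
another degree. -/
def tEval {x : X} (w : Quiver.Star x) : TStalk E x →ₗ[R] NStalk E w.1 :=
  open Classical in
  tLift (fun y => if h : κ.deg (inv w.2 ≫ y.2) = 1 then nAct E (inv w.2 ≫ y.2) h else 0) (by
    intro y z h hh e
    have h1 : κ.deg (inv w.2 ≫ y.2 ≫ h) = κ.deg (inv w.2 ≫ y.2) := by
      rw [← Category.assoc, deg_comp_one _ hh]
    by_cases h2 : κ.deg (inv w.2 ≫ y.2) = 1
    · rw [dif_pos h2, dif_pos (h1.trans h2)]
      exact (nAct_comp h2 hh _ (Category.assoc _ _ _).symm e).symm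
    · rw [dif_neg h2, dif_neg (by rwa [h1])]
      rfl)

theorem tEval_self {x : X} (w : Quiver.Star x) (e : NStalk E w.1) : tEval w (ten w e) = e := by
  have h : κ.deg (inv w.2 ≫ w.2) = 1 := by rw [IsIso.inv_hom_id, deg_id]
  rw [tEval, tLift_ten, dif_pos h]
  exact nAct_id h (IsIso.inv_hom_id _) e

theorem tEval_ne {x : X} {w y : Quiver.Star x} (h : κ.deg y.2 ≠ κ.deg w.2) (e : NStalk E y.1) :
    tEval w (ten y e) = 0 := by
  have h' : κ.deg (inv w.2 ≫ y.2) ≠ 1 := by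
    rwa [κ.deg_comp, deg_inv, Ne, mul_inv_eq_one]
  rw [tEval, tLift_ten, dif_neg h']
  rfl

theorem secJ_near {x : X} {t : sections E ⊗[R] SteinbergAlgebra R X} (h : secJ x t = 0) :
    ∀ᶠ z in 𝓝 x, secJ z t = 0 := by
  classical
  let V : Γ → Prop := fun γ => ∃ y : Quiver.Star x, κ.deg y.2 = γ
  choose w hw using fun γ (h : V γ) => h
  let β : Γ → SteinbergAlgebra R X := fun γ =>
    if h : V γ then one R (isCOB_someCOB (arr (w γ h).2)) else 0
  have hβ : ∀ γ h, β γ = one R (isCOB_someCOB (arr (w γ h).2)) := fun γ h => dif_pos h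
  obtain ⟨σ, hσ⟩ := secJ_normal (V := V) (fun y => ⟨y, rfl⟩) w hw
    (fun γ h => isCOB_someCOB (arr (w γ h).2)) (fun γ h => mem_someCOB (arr (w γ h).2)) β hβ t
  have hΦ : Finsupp.lsum R
      (fun γ => (TensorProduct.mk R (sections E) (SteinbergAlgebra R X)).flip (β γ)) σ =
      ∑ γ ∈ σ.support, σ γ ⊗ₜ[R] β γ := rfl
  rw [hΦ] at hσ
  have h0 : secJ x (∑ γ ∈ σ.support, σ γ ⊗ₜ[R] β γ) = 0 := by
    rw [← hσ.self_of_nhds, h]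
  have h1 : ∀ γ (hγ : V γ), ev (w γ hγ).1 (σ γ) = 0 := by
    intro γ hγ
    by_cases hs : γ ∈ σ.support
    · rw [map_sum] at h0
      have h2 := congrArg (tEval (w γ hγ)) h0
      rw [map_sum, map_zero, Finset.sum_eq_single_of_mem γ hs, hβ γ hγ,
        secJ_one_of_mem _ _ (mem_someCOB (arr (w γ hγ).2)), tEval_self] at h2
      · exact h2
      · intro δ _ hδ
        by_cases hVδ : V δ
        · rw [hβ δ hVδ, secJ_one_of_mem _ _ (mem_someCOB (arr (w δ hVδ).2))]
          refine tEval_ne ?_ _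
          rwa [hw, hw]
        · rw [show β δ = 0 from dif_neg hVδ, TensorProduct.tmul_zero, map_zero, map_zero]
    · rw [Finsupp.notMem_support_iff.1 hs, map_zero]
  have h2 : ∀ γ ∈ σ.support, ∀ᶠ z in 𝓝 x, secJ z (σ γ ⊗ₜ[R] β γ) = 0 := by
    intro γ _
    by_cases hγ : V γ
    · have h3 := (continuous_right (X := X)).continuousAt (x := arr (w γ hγ).2)
        (ev_near (h1 γ hγ))
      filter_upwards [near_left (w γ hγ) (Filter.inter_mem h3
        ((isCOB_someCOB (arr (w γ hγ).2)).isOpen.mem_nhds (mem_someCOB (arr (w γ hγ).2))))]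
        with z ⟨a, ha, ha'⟩
      rw [hβ γ hγ, secJ_one_of_mem _ _ ha']
      exact (congrArg (ten a) ha).trans (map_zero _)
    · refine .of_forall fun z => ?_
      rw [show β γ = 0 from dif_neg hγ, TensorProduct.tmul_zero, map_zero]
  filter_upwards [hσ, (Filter.eventually_all_finset σ.support).2 h2] with z hz hz'
  rw [hz, map_sum]
  exact Finset.sum_eq_zero hz'

theorem secJ_act {x y : X} (g : x ⟶ y) {B : Set (Arr X)} (hB : IsCOB B) (hg : arr g ∈ B)
    (t : sections E ⊗[R] SteinbergAlgebra R X) :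
    tAct g (secJ y t) = secJ x (TensorProduct.map LinearMap.id
      ({ toFun := fun f => f * one R hB
         map_add' := fun f f' => add_mul f f' _
         map_smul' := fun r f => smul_one_mul r f _ } :
        SteinbergAlgebra R X →ₗ[R] SteinbergAlgebra R X) t) := by
  induction t using TensorProduct.induction_on with
  | zero => simp only [map_zero]
  | add t t' h h' => simp only [map_add, h, h']
  | tmul s f =>
    rw [TensorProduct.map_tmul, secJ_tmul]
    refine (map_pair (tAct g) _ _ _).trans ?_
    simp only [tAct_ten]
    refine Eq.trans ?_ (pair_mul (N := TStalk E x) x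
      (fun y => ten y (ev (E := E) y.1 s)) f (one R hB)).symm
    exact (pair_one_of_mem (R := R) (N := TStalk E x) hB
      (fun w => pair w.1 (fun v => ten (rt w v) (ev (E := E) v.1 s)) f) (y := ⟨y, g⟩) hg).symm

theorem secJ_restrict (γ : Γ) (x : X) (t : sections E ⊗[R] SteinbergAlgebra R X) :
    ∃ t' : sections E ⊗[R] SteinbergAlgebra R X, ∀ x, tProj E x γ (secJ x t) = secJ x t' := by
  induction t using TensorProduct.induction_on with
  | zero => exact ⟨0, fun x => by simp only [map_zero]⟩
  | add t t' h h' =>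
    obtain ⟨a, ha⟩ := h
    obtain ⟨b, hb⟩ := h'
    exact ⟨a + b, fun x => by simp only [map_add, ha, hb]⟩
  | tmul s f =>
    refine ⟨s ⊗ₜ restrict κ R γ f, fun x => ?_⟩
    rw [secJ_tmul, secJ_tmul]
    refine (map_pair (tProj E x γ) _ _ _).trans ?_
    rw [pair_apply, pair_apply]
    have h1 : (fib x (restrict κ R γ f)).support ⊆ (fib x f).support := by
      intro y hy
      rw [Finsupp.mem_support_iff] at hy ⊢
      intro h
      exact hy (indicator_apply_eq_zero.2 fun _ => h)
    refine Eq.trans ?_ (Finsupp.sum_of_support_subset _ h1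
      (fun y r => r • ten y (ev (E := E) y.1 s)) fun y _ => zero_smul _ _).symm
    refine Finset.sum_congr rfl fun y _ => ?_
    change fib x f y • tProj E x γ (ten y (ev (E := E) y.1 s)) = _
    by_cases hy : κ.deg y.2 = γ
    · rw [tProj_ten_of_eq hy]
      congr 1
      exact (indicator_of_mem (show arr y.2 ∈ κ.comp γ from hy) f.1).symm
    · rw [tProj_ten_of_ne hy, smul_zero]
      refine Eq.symm ?_
      have : fib x (restrict κ R γ f) y = 0 :=
        indicator_of_notMem (show arr y.2 ∉ κ.comp γ from hy) f.1
      rw [this, zero_smul]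

variable (E)

/-- The module `Γ_c(E) ⊗ A_R(G)`, whose elements name sections of `E ⊗_{G_ε} G`. -/
abbrev SecSrc : Type u := sections E ⊗[R] SteinbergAlgebra R X

/-- The map `t ↦ secJ x t`, as a homomorphism of groups. -/
def secA (x : X) : SecSrc E →+ TStalk E x := (secJ x).toAddMonoidHom

theorem secA_surjective (x : X) : Function.Surjective (secA E x) := secJ_surjective x

theorem secA_near (x : X) (t : SecSrc E) (h : secA E x t = 0) :
    ∀ᶠ z in 𝓝 x, secA E z t = 0 := secJ_near h

/-- The graded `G`-sheaf `E ⊗_{G_ε} G`, with stalks `E ⊗ G^x`.  Its topology is generated by the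
images of the sections attached to elements of `Γ_c(E) ⊗ A_R(G)` over compact open sets. -/
def indObj : GrSheaf κ R where
  toGSheaf := GSheaf.ofSections (secA E) (secA_surjective E) (secA_near E)
    (fun x r t => ⟨r • t, .of_forall fun z => (map_smul (secJ z) r t).symm⟩)
    tAct tAct_id tAct_comp
    (fun {x y} g t => by
      have h : ∀ k ∈ someCOB (arr g), tAct k.hom (secJ k.right t) = secJ k.left _ :=
        fun k hk => secJ_act k.hom (isCOB_someCOB (arr g)) hk t
      exact ⟨_, Filter.mem_of_superset
        ((isCOB_someCOB (arr g)).isOpen.mem_nhds (mem_someCOB (arr g))) h⟩)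
  comp := tComp E
  isDirectSum := tComp_isDirectSum
  isOpen_comp γ := by
    refine (isOpen_secTop_iff (F := TStalk E) (S := SecSrc E) (secA E) (secA_surjective E) (secA_near E)).2 fun t => ?_
    rw [isOpen_iff_mem_nhds]
    intro x hx
    have hx : secJ x t ∈ tComp E γ x := hx
    obtain ⟨t', ht'⟩ := secJ_restrict γ x t
    have h : secJ x (t' - t) = 0 := by
      rw [map_sub, ← ht', tProj_of_mem hx, sub_self]
    filter_upwards [secJ_near h] with z hz
    rw [map_sub, ← ht', sub_eq_zero] at hz
    change secJ z t ∈ tComp E γ z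
    rw [← hz]
    exact tProj_mem z γ _
  act_mem g he := tAct_mem g he

variable {E}

/-- The map `s ↦ φ ∘ s` on sections. -/
def secMap {F : GSheaf R (Neutral κ)} (φ : E.Hom F) : sections E →ₗ[R] sections F where
  toFun s := ⟨_, map_section_mem (X := Neutral κ) φ s.2⟩
  map_add' s t := Subtype.ext (funext fun x => map_add (φ.app x) _ _)
  map_smul' r s := Subtype.ext (funext fun x => map_smul (φ.app x) _ _)

theorem tMap_secJ {F : GSheaf R (Neutral κ)} (φ : E.Hom F) (x : X)
    (t : sections E ⊗[R] SteinbergAlgebra R X) :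
    tMap φ x (secJ x t) = secJ x (TensorProduct.map (secMap φ) LinearMap.id t) := by
  induction t using TensorProduct.induction_on with
  | zero => simp only [map_zero]
  | add t t' h h' => simp only [map_add, h, h']
  | tmul s f =>
    rw [TensorProduct.map_tmul, secJ_tmul]
    refine (map_pair (tMap φ x) _ _ _).trans ?_
    simp only [tMap_ten]
    rfl

theorem continuous_tMap {F : GSheaf R (Neutral κ)} (φ : E.Hom F) :
    Continuous[secTop fun x s => secA E x s, secTop fun x s => secA F x s]
      fun e : Σ x, TStalk E x => (⟨e.1, tMap φ e.1 e.2⟩ : Σ x, TStalk F x) :=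
  continuous_secTop (secA E) (secA F) (secA_surjective E) (secA_near E) (secA_surjective F)
    (secA_near F) (fun x => tMap φ x)
    fun t => ⟨TensorProduct.map (secMap φ) LinearMap.id t, fun x => tMap_secJ φ x t⟩

/-- The morphism `e ⊗ y ↦ φ(e) ⊗ y`. -/
def indMap {F : GSheaf R (Neutral κ)} (φ : E.Hom F) : (indObj E).Hom (indObj F) where
  app := tMap φ
  continuous := continuous_tMap φ
  map_act := tMap_act φ
  map_mem h := tMap_mem φ h

theorem tMap_id (x : X) (t : TStalk E x) : tMap (𝟙 E) x t = t :=
  ten_ext (f := tMap (𝟙 E) x) (g := LinearMap.id) (fun y e => tMap_ten _ y e) t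

theorem tMap_comp {F H : GSheaf R (Neutral κ)} (φ : E ⟶ F) (ψ : F ⟶ H) (x : X)
    (t : TStalk E x) : tMap (φ ≫ ψ) x t = tMap ψ x (tMap φ x t) := by
  refine ten_ext (f := tMap (φ ≫ ψ) x) (g := tMap ψ x ∘ₗ tMap φ x) (fun y e => ?_) t
  rw [LinearMap.comp_apply, tMap_ten, tMap_ten, tMap_ten]
  rfl

variable (κ R)

/-- The induction functor `E ↦ E ⊗_{G_ε} G`, `φ ↦ φ ⊗ id`. -/
def sheafJ : GSheaf R (Neutral κ) ⥤ GrSheaf κ R where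
  obj E := indObj E
  map φ := indMap φ
  map_id E := GrSheaf.Hom.ext (funext fun x => LinearMap.ext (tMap_id (E := E) x))
  map_comp φ ψ := GrSheaf.Hom.ext (funext fun x => LinearMap.ext (tMap_comp (κ := κ) φ ψ x))

end Induction

end

end SG

/-!
# Strongly graded ample groupoids and Dade's theorem for their Steinberg algebras

Let `A` be the Steinberg algebra of the graded ample groupoid `G`.

*Groupoids and algebras.* If `G` is strongly graded, each unit `x` is the domain of an arrow of
degree `γ⁻¹`; a compact open bisection `B` of that degree through the arrow gives
`1_{d(B)} = 1_{B⁻¹} 1_B ∈ A_γ A_{γ⁻¹}`. Compactness yields `1_U ∈ A_γ A_{γ⁻¹}` for arbitrarily large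
compact open `U` (`exists_oneU_mem`), and multiplication by these local units shows that `A` is
strongly graded (`steinberg_isStrong`). Conversely, an arrow `k` of degree `γδ` is factored by
evaluating at `k` an expression of `1_B`, `k ∈ B`, as a sum of products
(`isStrong_of_steinberg`).

*Dade's theorem.* Over any graded ring with graded local units, `(N ⊗_{A_ε} A)_ε ≅ N`
(`modJ_modI`). If the ring is strongly graded, a graded module is generated by `M_ε`, and it
vanishes if `M_ε` does; applied to the image and the kernel of `M_ε ⊗_{A_ε} A → M`, this makes
that map an isomorphism (`tensCounit_bijective`), so that restriction and induction are mutually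
inverse equivalences. If restriction is merely faithful, then the graded module `A / A_γ A`,
shifted so that its component of degree `ε` is zero, must vanish; hence `A = A_γ A`, and the
ring is strongly graded (`isStrong_of_faithful`).

*Sheaves.* For every ample groupoid `Γ_c` and `Sh` are mutually inverse up to the natural
isomorphisms `[s]_x ↦ s(x)` and `m ↦ (x ↦ [m]_x)` (`gammaC_sh_isEquivalence`), and these preserve
degrees. Since `Γ_c(E)_ε ≅ Γ_c(E_ε)` (`sheafI_neutralGammaC`), restriction of sheaves is an
equivalence as soon as restriction of modules is one. Since `(E ⊗_{G_ε} G)_ε ≅ E`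
(`sheafJ_sheafI`), the same then holds for induction of sheaves.
-/

namespace SG

noncomputable section

/-! ### Graded homomorphisms -/

section GradedHom

variable {ι M N S T : Type*} [AddCommGroup M] [SetLike S M] [AddSubmonoidClass S M]
  [AddCommGroup N] [SetLike T N] [AddSubmonoidClass T N] {comp : ι → S} {comp' : ι → T}

theorem IsDirectSum.map_proj (h : IsDirectSum comp) (h' : IsDirectSum comp') (f : M →+ N)
    (hf : ∀ i, ∀ m ∈ comp i, f m ∈ comp' i) (i : ι) (m : M) :
    f (h.proj i m) = h'.proj i (f m) := by
  refine h.induction (p := fun m => f (h.proj i m) = h'.proj i (f m)) (by simp) ?_ ?_ m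
  · intro j m hm
    by_cases hij : i = j
    · subst hij
      rw [h.proj_of_mem hm, h'.proj_of_mem (hf _ _ hm)]
    · rw [h.proj_of_ne hm hij, h'.proj_of_ne (hf _ _ hm) hij, map_zero]
  · intro m n hm hn
    simp only [map_add, hm, hn]

theorem IsDirectSum.eq_of_proj_eq (h : IsDirectSum comp) {m n : M}
    (hmn : ∀ i, h.proj i m = h.proj i n) : m = n := by
  obtain ⟨s, hs, -⟩ := h.exists_sum (m - n)
  rw [Finset.sum_eq_zero fun i _ => by rw [map_sub, hmn, sub_self]] at hs
  exact sub_eq_zero.1 hs.symm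

/-- An injective homomorphism that preserves degrees also reflects them. -/
theorem IsDirectSum.mem_of_map_mem (h : IsDirectSum comp) (h' : IsDirectSum comp') (f : M →+ N)
    (hf : ∀ i, ∀ m ∈ comp i, f m ∈ comp' i) (hinj : Function.Injective f) {i : ι} {m : M}
    (hm : f m ∈ comp' i) : m ∈ comp i := by
  have : h.proj i m = m := hinj (by rw [h.map_proj h' f hf, h'.proj_of_mem hm])
  rw [← this]
  exact h.proj_mem i m

end GradedHom

/-! ### Isomorphisms of modules -/

section ModuleIso

variable {A : Type u} [NonUnitalRing A] {Γ : Type v} [Group Γ] {𝒢 : RingGrading A Γ}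

theorem UMod.isIso_of_bijective {M N : UMod A} (f : M ⟶ N)
    (hf : Function.Bijective (UMod.Hom.toFun f)) : IsIso f := by
  let e := AddEquiv.ofBijective (UMod.Hom.toFun f) hf
  refine ⟨⟨e.symm.toAddMonoidHom, fun n a => hf.1 ?_⟩, UMod.Hom.ext ?_, UMod.Hom.ext ?_⟩
  · refine (e.apply_symm_apply _).trans ((UMod.Hom.map_act f _ a).trans ?_).symm
    exact congrArg (fun n => N.act n a) (e.apply_symm_apply n)
  · exact AddMonoidHom.ext e.symm_apply_apply
  · exact AddMonoidHom.ext e.apply_symm_apply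

theorem GrMod.isIso_of_bijective {M N : GrMod 𝒢} (f : M ⟶ N)
    (hf : Function.Bijective f.toFun) : IsIso f := by
  let e := AddEquiv.ofBijective f.toFun hf
  refine ⟨⟨⟨e.symm.toAddMonoidHom, fun n a => hf.1 ?_⟩, fun {γ n} hn => ?_⟩,
    GrMod.Hom.ext ?_, GrMod.Hom.ext ?_⟩
  · refine (e.apply_symm_apply _).trans ((UMod.Hom.map_act f.toHom _ a).trans ?_).symm
    exact congrArg (fun n => N.act n a) (e.apply_symm_apply n)
  · refine M.isDirectSum.mem_of_map_mem N.isDirectSum f.toFun (fun _ _ h => f.map_mem h) hf.1 ?_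
    have h : f.toFun (e.symm n) = n := e.apply_symm_apply n
    exact h.symm ▸ hn
  · exact AddMonoidHom.ext e.symm_apply_apply
  · exact AddMonoidHom.ext e.apply_symm_apply

/-- Every element of a unital module is fixed by the right units of a finite set of scalars. -/
theorem UMod.exists_finset_unit (N : UMod A) (n : N.carrier) :
    ∃ F : Finset A, ∀ u, (∀ a ∈ F, a * u = a) → N.act n u = n := by
  classical
  refine AddSubgroup.closure_induction (p := fun n _ => ∃ F : Finset A, ∀ u,
    (∀ a ∈ F, a * u = a) → N.act n u = n) ?_ ?_ ?_ ?_ (N.unital n)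
  · rintro _ ⟨n, a, rfl⟩
    refine ⟨{a}, fun u hu => ?_⟩
    rw [N.act_act, hu a (Finset.mem_singleton_self _)]
  · exact ⟨∅, fun u _ => by simp⟩
  · rintro x y _ _ ⟨F, hF⟩ ⟨G, hG⟩
    refine ⟨F ∪ G, fun u hu => ?_⟩
    rw [map_add, AddMonoidHom.add_apply, hF u fun a ha => hu a (Finset.mem_union_left _ ha),
      hG u fun a ha => hu a (Finset.mem_union_right _ ha)]
  · rintro x _ ⟨F, hF⟩
    refine ⟨F, fun u hu => ?_⟩
    rw [map_neg, AddMonoidHom.neg_apply, hF u hu]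

theorem exists_unit_finset (𝒢 : RingGrading A Γ) (F : Finset A) :
    ∃ e : 𝒢.neutral, ∀ a ∈ F, (e : A) * a = a ∧ a * e = a := by
  obtain ⟨e, he, -, h⟩ := 𝒢.localUnits F
  exact ⟨⟨e, he⟩, h⟩

/-- Restriction of scalars along an isomorphism of rings is an equivalence. -/
theorem restrictEquiv_isEquivalence {B : Type u} [NonUnitalRing B] (e : A ≃+* B) :
    (restrictEquiv e).IsEquivalence := by
  have key : ∀ {A B : Type u} [NonUnitalRing A] [NonUnitalRing B] (e : A ≃+* B),
      Nonempty (𝟭 (UMod B) ≅ restrictEquiv e ⋙ restrictEquiv e.symm) := by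
    intro A B _ _ e
    -- Both composites are the identity on underlying groups.
    let φ (M : UMod B) : M ⟶ (restrictEquiv e ⋙ restrictEquiv e.symm).obj M :=
      ⟨AddMonoidHom.id _, fun m b => congrArg (M.act m) (e.apply_symm_apply b).symm⟩
    exact ⟨NatIso.ofComponents (fun M => @asIso _ _ _ _ (φ M)
      (UMod.isIso_of_bijective _ Function.bijective_id)) fun f => rfl⟩
  obtain ⟨η⟩ := key e
  obtain ⟨ε⟩ := key e.symm
  exact (CategoryTheory.Equivalence.mk (restrictEquiv e) (restrictEquiv e.symm) η
    ε.symm).isEquivalence_functor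

end ModuleIso

/-! ### Dade's theorem for rings with graded local units -/

section Dade

open TensorProduct

variable {A : Type u} [NonUnitalRing A] {Γ : Type v} [Group Γ] {𝒢 : RingGrading A Γ}

/-- The homomorphism on `N ⊗_{A_ε} A` induced by a balanced biadditive map. -/
def tensLift {N : UMod 𝒢.neutral} {P : Type*} [AddCommGroup P] (φ : N.carrier →+ A →+ P)
    (hφ : ∀ n (a : 𝒢.neutral) b, φ (N.act n a) b = φ n (a * b)) : Tens 𝒢 N →+ P :=
  ((tensRel 𝒢 N).liftQ (TensorProduct.liftAddHom φ (fun r n a => by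
      rw [map_zsmul, map_zsmul, AddMonoidHom.smul_apply])).toIntLinearMap (by
    refine Submodule.span_le.2 ?_
    rintro _ ⟨n, a, b, rfl⟩
    rw [SetLike.mem_coe, LinearMap.mem_ker, map_sub, sub_eq_zero]
    exact hφ n a b)).toAddMonoidHom

theorem tens_act {N : UMod 𝒢.neutral} (n : N.carrier) (a : 𝒢.neutral) (b : A) :
    (tens (N.act n a) b : Tens 𝒢 N) = tens n (a * b) := by
  refine sub_eq_zero.1 ?_
  change (tensRel 𝒢 N).mkQ _ - (tensRel 𝒢 N).mkQ _ = 0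
  rw [← map_sub]
  exact (Submodule.Quotient.mk_eq_zero _).2 (Submodule.subset_span ⟨n, a, b, rfl⟩)

theorem tens_add_left {N : UMod 𝒢.neutral} (n n' : N.carrier) (a : A) :
    (tens (n + n') a : Tens 𝒢 N) = tens n a + tens n' a :=
  (congrArg (tensRel 𝒢 N).mkQ (TensorProduct.add_tmul n n' a)).trans (map_add _ _ _)

theorem tens_zero_left {N : UMod 𝒢.neutral} (a : A) : (tens (0 : N.carrier) a : Tens 𝒢 N) = 0 :=
  (congrArg (tensRel 𝒢 N).mkQ (TensorProduct.zero_tmul _ a)).trans (map_zero _)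

theorem tens_neg_left {N : UMod 𝒢.neutral} (n : N.carrier) (a : A) :
    (tens (-n) a : Tens 𝒢 N) = -tens n a :=
  (congrArg (tensRel 𝒢 N).mkQ (TensorProduct.neg_tmul n a)).trans (map_neg _ _)

/-- The map `n ⊗ a ↦ n a_ε`, where `a_ε` is the component of `a` of degree `ε`. -/
def tensCollapse (N : UMod 𝒢.neutral) : Tens 𝒢 N →+ N.carrier :=
  tensLift (AddMonoidHom.compl₂ N.act (AddMonoidHom.mk'
      (fun a => (⟨𝒢.isDirectSum.proj 1 a, 𝒢.isDirectSum.proj_mem 1 a⟩ : 𝒢.neutral))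
      fun a b => Subtype.ext (map_add (𝒢.isDirectSum.proj 1) a b))) (by
    intro n a b
    refine (N.act_act n a _).trans (congrArg (N.act n) (Subtype.ext ?_))
    exact (proj_mul a 1 b).symm)

theorem tensCollapse_tens {N : UMod 𝒢.neutral} (n : N.carrier) {a : A} (ha : a ∈ 𝒢.comp 1) :
    tensCollapse N (tens n a) = N.act n ⟨a, ha⟩ :=
  congrArg (N.act n) (Subtype.ext (𝒢.isDirectSum.proj_of_mem ha))

/-- An element `t` of degree `ε` of `N ⊗_{A_ε} A` is `t' ⊗ u`, with `t'` its image in `N`, for all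
sufficiently large local units `u`. -/
theorem tens_collapse {N : UMod 𝒢.neutral} {t : Tens 𝒢 N} (ht : t ∈ tensComp 𝒢 N 1) :
    ∃ F : Finset A, ∀ u : A, (∀ a ∈ F, a * u = a) → t = tens (tensCollapse N t) u := by
  classical
  refine tensComp_induction (p := fun t => ∃ F : Finset A, ∀ u : A, (∀ a ∈ F, a * u = a) →
    t = tens (tensCollapse N t) u) ?_ ?_ ?_ ?_ t ht
  · intro n a ha
    refine ⟨{a}, fun u hu => ?_⟩
    rw [tensCollapse_tens n ha, tens_act]
    exact congrArg (tens n) (hu a (Finset.mem_singleton_self a)).symm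
  · exact ⟨∅, fun u _ => by rw [map_zero, tens_zero_left]⟩
  · rintro s t ⟨F, hF⟩ ⟨G, hG⟩
    refine ⟨F ∪ G, fun u hu => ?_⟩
    rw [map_add, tens_add_left, ← hF u fun a ha => hu a (Finset.mem_union_left _ ha),
      ← hG u fun a ha => hu a (Finset.mem_union_right _ ha)]
  · rintro s ⟨F, hF⟩
    refine ⟨F, fun u hu => ?_⟩
    rw [map_neg, tens_neg_left, ← hF u hu]

/-- The map `n ⊗ a ↦ n a` is injective in degree `ε`. -/
theorem tensCollapse_injOn {N : UMod 𝒢.neutral} {t : Tens 𝒢 N} (ht : t ∈ tensComp 𝒢 N 1)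
    (h : tensCollapse N t = 0) : t = 0 := by
  obtain ⟨F, hF⟩ := tens_collapse ht
  obtain ⟨u, hu⟩ := exists_unit_finset 𝒢 F
  rw [hF u fun a ha => (hu a ha).2, h, tens_zero_left]

/-- Local units of `A_ε` come from the graded local units of `A`. -/
theorem UMod.exists_neutral_unit (N : UMod 𝒢.neutral) (n : N.carrier) :
    ∃ u : 𝒢.neutral, N.act n u = n := by
  classical
  obtain ⟨F, hF⟩ := N.exists_finset_unit n
  obtain ⟨u, hu⟩ := exists_unit_finset 𝒢 (F.image (Subtype.val : 𝒢.neutral → A))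
  exact ⟨u, hF u fun a ha => Subtype.ext (hu a (Finset.mem_image_of_mem _ ha)).2⟩

theorem tensCollapse_act {N : UMod 𝒢.neutral} (t : Tens 𝒢 N) (a : 𝒢.neutral)
    (ht : t ∈ tensComp 𝒢 N 1) :
    tensCollapse N (tensAct t (a : A)) = N.act (tensCollapse N t) a := by
  refine tensComp_induction (p := fun t => tensCollapse N (tensAct t (a : A)) =
    N.act (tensCollapse N t) a) ?_ ?_ ?_ ?_ t ht
  · intro n b hb
    have hba : b * a ∈ 𝒢.comp 1 := 𝒢.neutral.mul_mem (x := b) hb a.2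
    rw [tensAct_tens, tensCollapse_tens n hb, tensCollapse_tens n hba, N.act_act]
    exact congrArg (N.act n) (Subtype.ext rfl)
  · simp only [map_zero, AddMonoidHom.zero_apply]
  · intro s t hs ht
    simp only [map_add, AddMonoidHom.add_apply, hs, ht]
  · intro s hs
    simp only [map_neg, AddMonoidHom.neg_apply, hs]

/-- The natural map `(N ⊗_{A_ε} A)_ε → N`. -/
def modJICollapse (N : UMod 𝒢.neutral) : (modJ 𝒢 ⋙ modI 𝒢).obj N ⟶ N where
  toFun := (tensCollapse N).comp (tensComp 𝒢 N 1).subtype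
  map_act := fun (t : tensComp 𝒢 N 1) a => tensCollapse_act t.1 a t.2

/-- For every graded ring with graded local units, induction followed by restriction is isomorphic
to the identity. -/
theorem modJ_modI (𝒢 : RingGrading A Γ) : Nonempty (modJ 𝒢 ⋙ modI 𝒢 ≅ 𝟭 (UMod 𝒢.neutral)) := by
  have hiso : ∀ N : UMod 𝒢.neutral, IsIso (modJICollapse N) := by
    intro N
    refine UMod.isIso_of_bijective _ ⟨?_, fun n => ?_⟩
    · refine (injective_iff_map_eq_zero _).2 fun (t : tensComp 𝒢 N 1) ht => ?_
      exact Subtype.ext (tensCollapse_injOn t.2 ht)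
    · obtain ⟨u, hu⟩ := N.exists_neutral_unit n
      exact ⟨(⟨tens n u, tens_mem n u.2⟩ : tensComp 𝒢 N 1), (tensCollapse_tens n u.2).trans hu⟩
  refine ⟨NatIso.ofComponents (fun N => @asIso _ _ _ _ (modJICollapse N) (hiso N))
    fun {N N'} φ => ?_⟩
  refine UMod.Hom.ext (AddMonoidHom.ext fun (t : tensComp 𝒢 N 1) => ?_)
  obtain ⟨t, ht⟩ := t
  change tensCollapse N' (tensMap φ (AddMonoidHom.id A) (fun _ _ => rfl) t) =
    UMod.Hom.toFun φ (tensCollapse N t)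
  refine tensComp_induction (p := fun t => tensCollapse N' (tensMap φ (AddMonoidHom.id A)
    (fun _ _ => rfl) t) = UMod.Hom.toFun φ (tensCollapse N t)) ?_ ?_ ?_ ?_ t ht
  · intro n a ha
    rw [tensMap_tens]
    refine (tensCollapse_tens (UMod.Hom.toFun φ n) ha).trans ?_
    rw [← UMod.Hom.map_act, ← tensCollapse_tens n ha]
  · simp only [map_zero]
  · intro s t hs ht
    simp only [map_add, hs, ht]
  · intro s hs
    simp only [map_neg, hs]

/-- The map `M_ε ⊗_{A_ε} A → M`, `m ⊗ a ↦ m a`. -/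
def tensCounit (M : GrMod 𝒢) : Tens 𝒢 M.neutral →+ M.carrier :=
  tensLift (N := M.neutral) (M.act.comp (M.comp 1).subtype) fun m a b => M.act_act _ _ _

theorem tensCounit_act (M : GrMod 𝒢) (t : Tens 𝒢 M.neutral) (b : A) :
    tensCounit M (tensAct t b) = M.act (tensCounit M t) b := by
  refine tens_induction (p := fun t => tensCounit M (tensAct t b) = M.act (tensCounit M t) b)
    (fun n a => (M.act_act _ _ _).symm) ?_ ?_ t
  · simp only [map_zero, AddMonoidHom.zero_apply]
  · intro s t hs ht
    simp only [map_add, AddMonoidHom.add_apply, hs, ht]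

theorem tensCounit_mem (M : GrMod 𝒢) {γ : Γ} {t : Tens 𝒢 M.neutral}
    (ht : t ∈ tensComp 𝒢 M.neutral γ) : tensCounit M t ∈ M.comp γ := by
  refine tensComp_induction (p := fun t => tensCounit M t ∈ M.comp γ) ?_ ?_ ?_ ?_ t ht
  · intro (n : M.comp 1) a ha
    have := M.act_mem n.2 ha
    rwa [one_mul] at this
  · rw [map_zero]
    exact zero_mem _
  · intro s t hs ht
    rw [map_add]
    exact add_mem hs ht
  · intro s hs
    rw [map_neg]
    exact neg_mem hs

/-- The map `m ⊗ a ↦ m a`, as a graded homomorphism. -/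
def modCounit (M : GrMod 𝒢) : (modI 𝒢 ⋙ modJ 𝒢).obj M ⟶ M :=
  ⟨⟨tensCounit M, tensCounit_act M⟩, tensCounit_mem M⟩

/-- In degree `ε` the counit is the collapse map of `M_ε`, and hence injective. -/
theorem tensCounit_eq_collapse (M : GrMod 𝒢) {t : Tens 𝒢 M.neutral}
    (ht : t ∈ tensComp 𝒢 M.neutral 1) :
    tensCounit M t = (M.comp 1).subtype (tensCollapse M.neutral t) := by
  refine tensComp_induction (p := fun t => tensCounit M t =
    (M.comp 1).subtype (tensCollapse M.neutral t)) ?_ ?_ ?_ ?_ t ht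
  · intro (n : M.comp 1) a ha
    rw [tensCollapse_tens (N := M.neutral) n ha]
    rfl
  · rw [map_zero, map_zero]
    rfl
  · intro s t hs ht
    rw [map_add, map_add, hs, ht]
    rfl
  · intro s hs
    rw [map_neg, map_neg, hs]
    rfl

/-- In a strongly graded ring, additive properties of elements of `A_ε` need only be checked on
`A_{γ⁻¹} A_γ`. -/
theorem RingGrading.IsStrong.induction (h : 𝒢.IsStrong) (γ : Γ) {p : A → Prop} (hzero : p 0)
    (hadd : ∀ a b, p a → p b → p (a + b)) (hneg : ∀ a, p a → p (-a))
    (hmul : ∀ a ∈ 𝒢.comp γ⁻¹, ∀ b ∈ 𝒢.comp γ, p (a * b)) : ∀ e ∈ 𝒢.comp 1, p e := by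
  intro e he
  have he' : e ∈ AddSubgroup.closure {c | ∃ a ∈ 𝒢.comp γ⁻¹, ∃ b ∈ 𝒢.comp γ, a * b = c} := by
    rw [h, inv_mul_cancel]
    exact he
  induction he' using AddSubgroup.closure_induction with
  | mem c hc =>
    obtain ⟨a, ha, b, hb, rfl⟩ := hc
    exact hmul a ha b hb
  | zero => exact hzero
  | add a b ha hb h1 h2 =>
    have hs : ∀ {a}, a ∈ AddSubgroup.closure {c | ∃ a ∈ 𝒢.comp γ⁻¹, ∃ b ∈ 𝒢.comp γ, a * b = c} →
        a ∈ 𝒢.comp 1 := fun {a} ha => by rwa [h, inv_mul_cancel] at ha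
    exact hadd a b (h1 (hs ha)) (h2 (hs hb))
  | neg a ha h1 =>
    refine hneg a (h1 ?_)
    rwa [h, inv_mul_cancel] at ha

/-- For a strongly graded ring the counit is bijective: `M_γ = M_γ A_{γ⁻¹} A_γ ⊆ M_ε A_γ`, and
an element `t` of degree `γ` of the kernel has `t A_{γ⁻¹} = 0`, so that
`t ∈ t A_{γ⁻¹} A_γ = 0`. -/
theorem tensCounit_bijective (h : 𝒢.IsStrong) (M : GrMod 𝒢) :
    Function.Bijective (tensCounit M) := by
  have hinj : ∀ γ, ∀ t ∈ tensComp 𝒢 M.neutral γ, tensCounit M t = 0 → t = 0 := by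
    intro γ t ht h0
    have h1 : ∀ a ∈ 𝒢.comp γ⁻¹, tensAct t a = 0 := by
      intro a ha
      have hm : tensAct t a ∈ tensComp 𝒢 M.neutral 1 := by
        have := (tensGr M.neutral).act_mem ht ha
        rwa [mul_inv_cancel] at this
      refine tensCollapse_injOn hm ?_
      have h2 := tensCounit_eq_collapse M hm
      rw [tensCounit_act, h0, map_zero, AddMonoidHom.zero_apply] at h2
      exact (Subtype.ext h2).symm
    obtain ⟨e, he, het⟩ := exists_unit 𝒢 (tensGr M.neutral).toUMod t
    have het : tensAct t e = t := het
    rw [← het]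
    refine h.induction γ (p := fun e => tensAct t e = 0) (map_zero _) ?_ ?_ ?_ e he
    · intro a b ha hb
      rw [map_add, ha, hb, add_zero]
    · intro a ha
      rw [map_neg, ha, neg_zero]
    · intro a ha b _
      refine ((tensGr M.neutral).act_act t a b).symm.trans ?_
      change tensAct (tensAct t a) b = 0
      rw [h1 a ha, map_zero, AddMonoidHom.zero_apply]
  refine ⟨(injective_iff_map_eq_zero _).2 fun t ht => ?_, fun m => ?_⟩
  · refine tensComp_isDirectSum.eq_of_proj_eq fun γ => ?_
    rw [map_zero]
    refine hinj γ _ (tensComp_isDirectSum.proj_mem γ t) ?_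
    rw [tensComp_isDirectSum.map_proj M.isDirectSum (tensCounit M)
      (fun γ t ht => tensCounit_mem M ht), ht, map_zero]
  · refine M.isDirectSum.induction (p := fun m => ∃ t, tensCounit M t = m) ⟨0, map_zero _⟩ ?_ ?_ m
    · intro γ m hm
      obtain ⟨e, he, hem⟩ := exists_unit 𝒢 M.toUMod m
      rw [← hem]
      refine h.induction γ (p := fun e => ∃ t, tensCounit M t = M.act m e) ⟨0, ?_⟩ ?_ ?_ ?_ e he
      · rw [map_zero, map_zero]
      · rintro a b ⟨s, hs⟩ ⟨t, ht⟩
        exact ⟨s + t, by rw [map_add, map_add, hs, ht]⟩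
      · rintro a ⟨s, hs⟩
        exact ⟨-s, by rw [map_neg, map_neg, hs]⟩
      · intro a ha b _
        have hma := M.act_mem hm ha
        rw [mul_inv_cancel] at hma
        exact ⟨tens (N := M.neutral) (⟨_, hma⟩ : M.comp 1) b, M.act_act m a b⟩
    · rintro _ _ ⟨s, rfl⟩ ⟨t, rfl⟩
      exact ⟨s + t, map_add _ _ _⟩

/-- For a strongly graded ring, restriction followed by induction is isomorphic to the identity. -/
theorem modI_modJ (h : 𝒢.IsStrong) : Nonempty (𝟭 (GrMod 𝒢) ≅ modI 𝒢 ⋙ modJ 𝒢) := by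
  have hiso : ∀ M : GrMod 𝒢, IsIso (modCounit M) := fun M =>
    GrMod.isIso_of_bijective _ (tensCounit_bijective h M)
  refine ⟨(NatIso.ofComponents (fun M => @asIso _ _ _ _ (modCounit M) (hiso M))
    fun {M M'} φ => ?_).symm⟩
  exact GrMod.Hom.ext (tensHom_ext (N := M.neutral) fun n a => (φ.map_act _ a).symm)

/-- One half of Dade's theorem. -/
theorem modI_modJ_isEquivalence (h : 𝒢.IsStrong) :
    (modI 𝒢).IsEquivalence ∧ (modJ 𝒢).IsEquivalence := by
  obtain ⟨η⟩ := modI_modJ h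
  obtain ⟨ε⟩ := modJ_modI 𝒢
  let e := CategoryTheory.Equivalence.mk (modI 𝒢) (modJ 𝒢) η ε
  exact ⟨e.isEquivalence_functor, e.isEquivalence_inverse⟩

/-! The other half: the graded module `A / A_γ A`, shifted by `γ`, vanishes in degree `ε`. -/

theorem proj_mul_of_mem {γ : Γ} {a : A} (ha : a ∈ 𝒢.comp γ) (δ : Γ) (b : A) :
    𝒢.isDirectSum.proj (γ * δ) (a * b) = a * 𝒢.isDirectSum.proj δ b := by
  refine 𝒢.isDirectSum.induction (p := fun b => 𝒢.isDirectSum.proj (γ * δ) (a * b) =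
    a * 𝒢.isDirectSum.proj δ b) (by simp) ?_ ?_ b
  · intro τ b hb
    have hab := 𝒢.mul_mem ha hb
    by_cases h : δ = τ
    · subst h
      rw [𝒢.isDirectSum.proj_of_mem hb, 𝒢.isDirectSum.proj_of_mem hab]
    · rw [𝒢.isDirectSum.proj_of_ne hb h,
        𝒢.isDirectSum.proj_of_ne hab fun h' => h (mul_left_cancel h'), mul_zero]
  · intro b c hb hc
    rw [mul_add, map_add, map_add, mul_add, hb, hc]

variable (𝒢)

/-- The right ideal `A_γ A`. -/
def rightIdeal (γ : Γ) : AddSubgroup A :=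
  AddSubgroup.closure {c | ∃ a ∈ 𝒢.comp γ, ∃ b, a * b = c}

variable {𝒢} in
theorem rightIdeal_map {γ : Γ} (f : A →+ A)
    (hf : ∀ a ∈ 𝒢.comp γ, ∀ b, f (a * b) ∈ rightIdeal 𝒢 γ) :
    rightIdeal 𝒢 γ ≤ (rightIdeal 𝒢 γ).comap f := by
  refine (AddSubgroup.closure_le _).2 ?_
  rintro _ ⟨a, ha, b, rfl⟩
  exact hf a ha b

variable {𝒢} in
theorem mul_mem_rightIdeal {γ : Γ} {a : A} (ha : a ∈ 𝒢.comp γ) (b : A) :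
    a * b ∈ rightIdeal 𝒢 γ := AddSubgroup.subset_closure ⟨a, ha, b, rfl⟩

/-- The projection to the component of degree `γδ`, on `A / A_γ A`. -/
def quotProj (γ δ : Γ) : A ⧸ rightIdeal 𝒢 γ →+ A ⧸ rightIdeal 𝒢 γ :=
  QuotientAddGroup.map _ _ (𝒢.isDirectSum.proj (γ * δ)) (rightIdeal_map _ fun a ha b => by
    rw [proj_mul_of_mem ha]
    exact mul_mem_rightIdeal ha _)

theorem quotProj_mk (γ δ : Γ) (a : A) :
    quotProj 𝒢 γ δ (QuotientAddGroup.mk' _ a) =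
      QuotientAddGroup.mk' _ (𝒢.isDirectSum.proj (γ * δ) a) := rfl

/-- The right action of `A` on `A / A_γ A`. -/
def quotAct (γ : Γ) : A ⧸ rightIdeal 𝒢 γ →+ A →+ A ⧸ rightIdeal 𝒢 γ :=
  (AddMonoidHom.mk' (fun b => QuotientAddGroup.map _ (rightIdeal 𝒢 γ) (AddMonoidHom.mulRight b)
      (rightIdeal_map _ fun a ha c => by
        rw [AddMonoidHom.mulRight_apply, mul_assoc]
        exact mul_mem_rightIdeal ha _)) (fun b c => by
    refine QuotientAddGroup.addMonoidHom_ext _ (AddMonoidHom.ext fun a => ?_)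
    exact congrArg (QuotientAddGroup.mk' (rightIdeal 𝒢 γ)) (mul_add a b c))).flip

theorem quotAct_mk (γ : Γ) (a b : A) : quotAct 𝒢 γ (QuotientAddGroup.mk' _ a) b =
    QuotientAddGroup.mk' _ (a * b) := rfl

/-- The graded module `A / A_γ A`, in which the image of `A_{γδ}` has degree `δ`. -/
def quotGr (γ : Γ) : GrMod 𝒢 where
  carrier := A ⧸ rightIdeal 𝒢 γ
  act := quotAct 𝒢 γ
  act_act m b c := by
    obtain ⟨a, rfl⟩ := QuotientAddGroup.mk'_surjective _ m
    rw [quotAct_mk, quotAct_mk, quotAct_mk, mul_assoc]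
  unital m := by
    obtain ⟨a, rfl⟩ := QuotientAddGroup.mk'_surjective _ m
    obtain ⟨e, he⟩ := exists_unit_finset 𝒢 {a}
    refine AddSubgroup.subset_closure ⟨QuotientAddGroup.mk' _ a, e, ?_⟩
    rw [quotAct_mk, (he a (Finset.mem_singleton_self a)).2]
  comp δ := (𝒢.comp (γ * δ)).map (QuotientAddGroup.mk' _)
  isDirectSum := by
    refine IsDirectSum.of_proj (quotProj 𝒢 γ) ?_ ?_ ?_ ?_
    · intro δ m
      obtain ⟨a, rfl⟩ := QuotientAddGroup.mk'_surjective _ m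
      exact ⟨_, 𝒢.isDirectSum.proj_mem _ a, rfl⟩
    · rintro δ _ ⟨a, ha, rfl⟩
      rw [quotProj_mk, 𝒢.isDirectSum.proj_of_mem ha]
    · rintro δ τ _ ⟨a, ha, rfl⟩ h
      rw [quotProj_mk, 𝒢.isDirectSum.proj_of_ne ha fun h' => h (mul_left_cancel h'), map_zero]
    · intro m
      obtain ⟨a, rfl⟩ := QuotientAddGroup.mk'_surjective _ m
      refine 𝒢.isDirectSum.induction (p := fun a => QuotientAddGroup.mk' _ a ∈
        AddSubmonoid.closure _) ?_ ?_ ?_ a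
      · rw [map_zero]
        exact zero_mem _
      · intro τ a ha
        refine AddSubmonoid.subset_closure ⟨γ⁻¹ * τ, a, ?_, rfl⟩
        rwa [mul_inv_cancel_left]
      · intro a b ha hb
        rw [map_add]
        exact add_mem ha hb
  act_mem {δ τ m b} hm hb := by
    obtain ⟨a, ha, rfl⟩ := hm
    refine ⟨a * b, ?_, rfl⟩
    rw [← mul_assoc]
    exact 𝒢.mul_mem ha hb

variable {𝒢}

theorem quotGr_neutral {γ : Γ} {m : A ⧸ rightIdeal 𝒢 γ} (hm : m ∈ (quotGr 𝒢 γ).comp 1) :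
    m = 0 := by
  obtain ⟨a, ha, rfl⟩ := hm
  rw [mul_one] at ha
  obtain ⟨e, he⟩ := exists_unit_finset 𝒢 {a}
  refine (QuotientAddGroup.eq_zero_iff a).2 ?_
  rw [← (he a (Finset.mem_singleton_self a)).2]
  exact mul_mem_rightIdeal ha _

/-- The converse half of Dade's theorem; only the faithfulness of the restriction functor is
used, for the identity and the zero endomorphism of `A / A_γ A`. -/
theorem isStrong_of_faithful (h : (modI 𝒢).Faithful) : 𝒢.IsStrong := by
  intro γ δ
  refine le_antisymm ((AddSubgroup.closure_le _).2 ?_) fun c hc => ?_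
  · rintro _ ⟨a, ha, b, hb, rfl⟩
    exact 𝒢.mul_mem ha hb
  · let z : quotGr 𝒢 γ ⟶ quotGr 𝒢 γ :=
      ⟨⟨0, fun m a => by simp⟩, fun _ => zero_mem _⟩
    have hz : 𝟙 (quotGr 𝒢 γ) = z := by
      refine (modI 𝒢).map_injective (UMod.Hom.ext (AddMonoidHom.ext
        fun (m : (quotGr 𝒢 γ).comp 1) => Subtype.ext ?_))
      exact quotGr_neutral m.2
    have hc' : c ∈ rightIdeal 𝒢 γ :=
      (QuotientAddGroup.eq_zero_iff c).1 (DFunLike.congr_fun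
        (congrArg (fun f : quotGr 𝒢 γ ⟶ quotGr 𝒢 γ => f.toFun) hz) (QuotientAddGroup.mk' _ c))
    rw [← 𝒢.isDirectSum.proj_of_mem hc]
    clear hc
    induction hc' using AddSubgroup.closure_induction with
    | mem c hc =>
      obtain ⟨a, ha, b, rfl⟩ := hc
      rw [proj_mul_of_mem ha]
      exact AddSubgroup.subset_closure ⟨a, ha, _, 𝒢.isDirectSum.proj_mem δ b, rfl⟩
    | zero =>
      rw [map_zero]
      exact zero_mem _
    | add a b _ _ ha hb =>
      rw [map_add]
      exact add_mem ha hb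
    | neg a _ ha =>
      rw [map_neg]
      exact neg_mem ha

end Dade

/-! ### Isomorphisms of sheaves -/

section SheafIso

variable {R : Type u} [CommRing R] {X : Type u} [Groupoid.{u} X] [TopologicalSpace X]
  [TopologicalSpace (Arr X)]

/-- A morphism that is bijective on stalks has a continuous inverse, since it is a local
homeomorphism of the total spaces. -/
theorem GSheaf.Hom.continuous_symm {E F : GSheaf R X} (φ : E.Hom F)
    (e : ∀ x, E.stalk x ≃ₗ[R] F.stalk x) (he : ∀ x a, e x a = φ.app x a) :
    Continuous fun a : F.Tot => (⟨a.1, (e a.1).symm a.2⟩ : E.Tot) := by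
  let f : E.Tot → F.Tot := fun a => ⟨a.1, φ.app a.1 a.2⟩
  have hf : IsOpenMap f :=
    ((show IsLocalHomeomorph (Sigma.fst ∘ f) from E.isLocalHomeomorph_proj).of_comp
      F.isLocalHomeomorph_proj φ.continuous).isOpenMap
  refine ⟨fun V hV => ?_⟩
  convert hf V hV using 1
  ext a
  constructor
  · intro ha
    refine ⟨_, ha, ?_⟩
    change (⟨a.1, φ.app a.1 ((e a.1).symm a.2)⟩ : F.Tot) = a
    rw [← he, LinearEquiv.apply_symm_apply]
  · rintro ⟨b, hb, rfl⟩
    change (⟨b.1, (e b.1).symm (φ.app b.1 b.2)⟩ : E.Tot) ∈ V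
    rwa [← he, LinearEquiv.symm_apply_apply]

theorem GSheaf.isIso_of_bijective {E F : GSheaf R X} (φ : E ⟶ F)
    (hφ : ∀ x, Function.Bijective (GSheaf.Hom.app φ x)) : IsIso φ := by
  let e x := LinearEquiv.ofBijective (GSheaf.Hom.app φ x) (hφ x)
  refine ⟨⟨fun x => (e x).symm, GSheaf.Hom.continuous_symm φ e fun _ _ => rfl, ?_⟩, ?_, ?_⟩
  · intro x y g a
    obtain ⟨b, rfl⟩ := (e y).surjective a
    have h : e x (E.act g b) = F.act g (e y b) := GSheaf.Hom.map_act φ g b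
    refine (e x).injective ?_
    change e x ((e x).symm (F.act g (e y b))) = e x (E.act g ((e y).symm (e y b)))
    rw [LinearEquiv.apply_symm_apply, LinearEquiv.symm_apply_apply, h]
  · exact GSheaf.Hom.ext (funext fun x => LinearMap.ext (e x).symm_apply_apply)
  · exact GSheaf.Hom.ext (funext fun x => LinearMap.ext (e x).apply_symm_apply)

variable {Γ : Type v} [Group Γ] {κ : GroupoidGrading X Γ}

theorem GrSheaf.isIso_of_bijective {E F : GrSheaf κ R} (φ : E ⟶ F)
    (hφ : ∀ x, Function.Bijective (φ.app x)) : IsIso φ := by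
  let ψ : E.toGSheaf ⟶ F.toGSheaf := φ.toHom
  obtain ⟨χ, h1, h2⟩ := GSheaf.isIso_of_bijective ψ hφ
  have h1' : ∀ x a, GSheaf.Hom.app χ x (φ.app x a) = a := fun x a =>
    LinearMap.congr_fun (congrFun (congrArg GSheaf.Hom.app h1) x) a
  have h2' : ∀ x a, φ.app x (GSheaf.Hom.app χ x a) = a := fun x a =>
    LinearMap.congr_fun (congrFun (congrArg GSheaf.Hom.app h2) x) a
  refine ⟨⟨χ, fun {γ x a} ha => ?_⟩,
    GrSheaf.Hom.ext (funext fun x => LinearMap.ext (h1' x)),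
    GrSheaf.Hom.ext (funext fun x => LinearMap.ext (h2' x))⟩
  refine (E.isDirectSum x).mem_of_map_mem (F.isDirectSum x) (φ.app x).toAddMonoidHom
    (fun _ _ h => φ.map_mem h) (hφ x).1 ?_
  change φ.app x (GSheaf.Hom.app χ x a) ∈ F.comp γ x
  rwa [h2']

end SheafIso

/-! ### Compact open sets of units -/

section CompactOpen

variable {R : Type u} [CommRing R] {X : Type u} [Groupoid.{u} X] [TopologicalSpace X]
  [TopologicalSpace (Arr X)] [IsAmpleGroupoid X]

/-- A property of compact open sets of units that is inherited by subsets and by disjoint unions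
holds on a neighbourhood of a compact set if it holds locally. -/
theorem compactOpen_induction {p : Set X → Prop} (hempty : p ∅)
    (hmono : ∀ U V, IsCompact U → IsOpen U → IsCompact V → IsOpen V → V ⊆ U → p U → p V)
    (hunion : ∀ U V, IsCompact U → IsOpen U → IsCompact V → IsOpen V → Disjoint U V → p U → p V →
      p (U ∪ V)) {K : Set X} (hK : IsCompact K)
    (hloc : ∀ x ∈ K, ∃ U, IsCompact U ∧ IsOpen U ∧ x ∈ U ∧ p U) :
    ∃ U, IsCompact U ∧ IsOpen U ∧ K ⊆ U ∧ p U := by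
  have := IsAmpleGroupoid.t2Space (X := X)
  refine hK.induction_on (p := fun K => ∃ U, IsCompact U ∧ IsOpen U ∧ K ⊆ U ∧ p U) ?_ ?_ ?_ ?_
  · exact ⟨∅, isCompact_empty, isOpen_empty, subset_rfl, hempty⟩
  · rintro s t hst ⟨U, hc, ho, hU, h⟩
    exact ⟨U, hc, ho, hst.trans hU, h⟩
  · rintro s t ⟨U, hc, ho, hU, h⟩ ⟨V, hc', ho', hV, h'⟩
    have hd : IsCompact (V \ U) := hc'.diff ho
    have hd' : IsOpen (V \ U) := ho'.sdiff hc.isClosed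
    -- `U` is closed, since `X` is Hausdorff, and so `V \ U` is compact open.
    refine ⟨U ∪ V \ U, hc.union hd, ho.union hd', ?_, hunion _ _ hc ho hd hd'
      disjoint_sdiff_right h (hmono V _ hc' ho' hd hd' sdiff_subset h')⟩
    rw [union_sdiff_self]
    exact union_subset_union hU hV
  · intro x hx
    obtain ⟨U, hc, ho, hxU, h⟩ := hloc x hx
    exact ⟨U, mem_nhdsWithin_of_mem_nhds (ho.mem_nhds hxU), U, hc, ho, subset_rfl, h⟩

theorem oneU_union {U V W : Set X} (hc : IsCompact U) (ho : IsOpen U) (hc' : IsCompact V)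
    (ho' : IsOpen V) (hd : Disjoint U V) (hcW : IsCompact W) (hoW : IsOpen W) (hW : W = U ∪ V) :
    oneU R hcW hoW = oneU R hc ho + oneU R hc' ho' := by
  subst hW
  refine steinberg_ext fun k => ?_
  have hd' : Disjoint ((unit : X → Arr X) '' U) ((unit : X → Arr X) '' V) := by
    rw [disjoint_image_iff fun x y h => congrArg Quiver.Total.left h]
    exact hd
  change ((unit : X → Arr X) '' (U ∪ V)).indicator (fun _ => (1 : R)) k = _
  rw [image_union, indicator_union_of_disjoint hd']
  rfl

theorem germEq_one_zero {x : X} {B : Set (Arr X)} (hB : IsCOB B)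
    (h : ∀ y : Quiver.Star x, arr y.2 ∉ B) : GermEq x (one R hB) 0 := by
  filter_upwards [near_not hB.isCompact h] with z hz
  rw [fib_one_of_notMem hB hz, map_zero]

variable (M : UMod (SteinbergAlgebra R X))

theorem UMod.exists_oneU (m : M.carrier) : ∃ (U : Set X) (hc : IsCompact U) (ho : IsOpen U),
    M.act m (oneU R hc ho) = m := by
  obtain ⟨F, hF⟩ := M.exists_finset_unit m
  obtain ⟨U, hc, ho, hU⟩ := exists_localUnit F
  exact ⟨U, hc, ho, hF _ fun a ha => (hU a ha).2⟩

theorem germ_oneU_of_notMem {x : X} (m : M.carrier) {U : Set X} (hc : IsCompact U)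
    (ho : IsOpen U) (hx : x ∉ U) : germ M x (M.act m (oneU R hc ho)) = 0 := by
  rw [oneU, germ_act_congr M m (germEq_one_zero _ (oneU_notMem hx)), map_zero, map_zero]

end CompactOpen

/-! ### The sheaf of germs of sections -/

section GammaSh

variable {R : Type u} [CommRing R] {X : Type u} [Groupoid.{u} X] [TopologicalSpace X]
  [TopologicalSpace (Arr X)] [IsAmpleGroupoid X]

variable (E : GSheaf R X)

/-- The map `[s]_x ↦ s(x)`. -/
def germEval (x : X) : ShStalk (gammaObj E) x →ₗ[R] E.stalk x where
  toFun := QuotientAddGroup.lift (germKer (gammaObj E) x)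
    (AddMonoidHom.mk' (fun s : sections E => s.1 x) fun _ _ => rfl) (by
      rintro (s : sections E) ⟨U, hc, ho, hx, hU⟩
      change s.1 x = 0
      rw [← sact_oneU E (s := s.1) hc ho hx]
      exact congrFun (congrArg Subtype.val hU) x)
  map_add' := map_add _
  map_smul' r e := by
    obtain ⟨s, rfl⟩ := germ_surjective (gammaObj E) x e
    rw [smul_germ (gammaObj E) r s (isCompact_someCO x) (isOpen_someCO x) (mem_someCO x)]
    refine (map_smul (pair x fun y => E.act y.2 (Subtype.val s y.1)) r _).trans ?_
    exact congrArg (r • ·) (sact_oneU E (isCompact_someCO x) (isOpen_someCO x) (mem_someCO x))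

/-- A section that vanishes at `x` vanishes near `x`, and every point of a stalk is the value of a
section. -/
theorem germEval_bijective (x : X) : Function.Bijective (germEval E x) := by
  have := IsAmpleGroupoid.t2Space (X := X)
  refine ⟨(injective_iff_map_eq_zero _).2 fun e he => ?_, fun a => ?_⟩
  · obtain ⟨(s : sections E), rfl⟩ := germ_surjective (gammaObj E) x e
    obtain ⟨U, hc, ho, hx, hU⟩ := exists_compactOpen ((isOpen_zero E s.2.1).mem_nhds he)
    refine (germ_eq_zero _).2 ⟨U, hc, ho, hx, Subtype.ext (funext fun z => ?_)⟩
    by_cases hz : z ∈ U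
    · exact (sact_oneU E hc ho hz).trans (hU hz)
    · exact sact_one_of_notMem E _ _ (oneU_notMem hz)
  · obtain ⟨s, hs, h, -⟩ := exists_section E a Filter.univ_mem
    exact ⟨germ (gammaObj E) x (⟨s, hs⟩ : sections E), h⟩

/-- The morphism `Sh(Γ_c(E)) → E`, `[s]_x ↦ s(x)`. -/
def shGammaHom : (shObj (gammaObj E)).Hom E where
  app := germEval E
  continuous := ⟨fun V hV => (isOpen_secTop_iff (germ (gammaObj E)) (germ_surjective _)
    fun _ _ h => germ_near _ h).2 fun (s : sections E) => hV.preimage s.2.1⟩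
  map_act {x y} g e := by
    obtain ⟨(s : sections E), rfl⟩ := germ_surjective (gammaObj E) y e
    refine (congrArg (germEval E x)
      (shAct_germ (gammaObj E) g s (isCOB_someCOB (arr g)) (mem_someCOB (arr g)))).trans ?_
    exact sact_one_of_mem E s.1 (isCOB_someCOB (arr g)) (y := ⟨y, g⟩) (mem_someCOB (arr g))

variable (R X) in
/-- The sheaf of germs of the sections of `E` is naturally isomorphic to `E`. -/
theorem gammaC_sh : Nonempty (gammaC R X ⋙ sh R X ≅ 𝟭 (GSheaf R X)) := by
  let φ (E : GSheaf R X) : (gammaC R X ⋙ sh R X).obj E ⟶ E := shGammaHom E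
  refine ⟨NatIso.ofComponents (fun E => @asIso _ _ _ _ (φ E)
    (GSheaf.isIso_of_bijective _ (germEval_bijective E))) fun {E F} ψ => ?_⟩
  refine GSheaf.Hom.ext (funext fun x => LinearMap.ext fun e => ?_)
  obtain ⟨s, rfl⟩ := germ_surjective (gammaObj E) x e
  rfl

/-! ### Modules as sections of their sheaves of germs -/

variable (M : UMod (SteinbergAlgebra R X))

/-- The action of `A_R(G)` on a module, in terms of the action of `G` on germs. -/
theorem germ_act_apply (m : M.carrier) (f : SteinbergAlgebra R X) (x : X) :
    germ M x (M.act m f) = pair x (fun y => shAct M y.2 (germ M y.1 m)) f := by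
  refine steinberg_induction (p := fun f => germ M x (M.act m f) =
    pair x (fun y => shAct M y.2 (germ M y.1 m)) f) (fun B hB => ?_) (fun f g hf hg => ?_)
    (fun r f hf => ?_) f
  · by_cases hx : ∃ y : Quiver.Star x, arr y.2 ∈ B
    · obtain ⟨y, hy⟩ := hx
      rw [pair_one_of_mem hB _ hy, shAct_germ M y.2 m hB hy]
    · push Not at hx
      rw [pair_one_of_notMem hB _ hx, germ_act_congr M m (germEq_one_zero hB hx), map_zero,
        map_zero]
  · simp only [map_add, hf, hg]
  · rw [map_smul (pair x _), ← hf,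
      smul_germ M r _ (isCompact_someCO x) (isOpen_someCO x) (mem_someCO x), M.act_act]
    exact (germ_act_congr M m (germEq_smul_oneU _ _ (mem_someCO x) r f)).symm

theorem germ_section_mem (m : M.carrier) : (fun x => germ M x m) ∈ sections (shObj M) := by
  have := IsAmpleGroupoid.t2Space (X := X)
  have h : Continuous fun x => (⟨x, germ M x m⟩ : (shObj M).Tot) :=
    ⟨fun V hV => (isOpen_secTop_iff (germ M) (germ_surjective _) fun _ _ h => germ_near _ h).1
      hV m⟩
  obtain ⟨U, hc, ho, hU⟩ := M.exists_oneU m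
  refine ⟨h, isCompact_support (shObj M) h hc fun x hx => ?_⟩
  rw [← hU]
  exact germ_oneU_of_notMem M m hc ho hx

/-- The homomorphism `M → Γ_c(Sh(M))`, `m ↦ (x ↦ [m]_x)`. -/
def gammaShHom : M.Hom (gammaObj (shObj M)) where
  toFun := AddMonoidHom.mk' (fun m => (⟨fun x => germ M x m, germ_section_mem M m⟩ :
    sections (shObj M))) fun m n => Subtype.ext (funext fun x => map_add (germ M x) m n)
  map_act m f := Subtype.ext (funext fun x => germ_act_apply M m f x)

/-- Injectivity and surjectivity both follow by gluing over a finite partition of a compact open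
set of units: of the equations `m 1_U = 0`, and of the elements `m` with `s = [m]` on `U`. -/
theorem gammaShHom_bijective : Function.Bijective (gammaShHom M).toFun := by
  have := IsAmpleGroupoid.t2Space (X := X)
  refine ⟨(injective_iff_map_eq_zero _).2 fun m hm => ?_, fun (s : sections (shObj M)) => ?_⟩
  · have hm' : ∀ x, germ M x m = 0 := fun x => congrFun (congrArg Subtype.val hm) x
    obtain ⟨W, hcW, hoW, hW⟩ := M.exists_oneU m
    have key : ∃ U, IsCompact U ∧ IsOpen U ∧ W ⊆ U ∧
        ∀ (hc : IsCompact U) (ho : IsOpen U), M.act m (oneU R hc ho) = 0 := by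
      refine compactOpen_induction
        (p := fun U => ∀ (hc : IsCompact U) (ho : IsOpen U), M.act m (oneU R hc ho) = 0)
        (fun hc ho => ?_) (fun U V hc ho hc' ho' h hU _ _ => ?_)
        (fun U V hc ho hc' ho' hd hU hV hc'' ho'' => ?_) hcW (fun x _ => ?_)
      · have h0 : oneU R hc ho = 0 :=
          steinberg_ext fun k => ind_of_notMem (oneU_notMem (notMem_empty _) ⟨k.right, k.hom⟩)
        rw [h0, map_zero]
      · exact act_oneU_of_subset M hc ho hc' ho' h (hU hc ho)
      · rw [oneU_union hc ho hc' ho' hd hc'' ho'' rfl, map_add, hU hc ho, hV hc' ho', add_zero]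
      · obtain ⟨U, hc, ho, hx, hU⟩ := (germ_eq_zero M).1 (hm' x)
        exact ⟨U, hc, ho, hx, fun _ _ => hU⟩
    obtain ⟨U, hc, ho, hWU, hU⟩ := key
    rw [← hW]
    exact act_oneU_of_subset M hc ho hcW hoW hWU (hU hc ho)
  · have key : ∃ U, IsCompact U ∧ IsOpen U ∧ {x | s.1 x ≠ 0} ⊆ U ∧
        ∃ m, ∀ x ∈ U, s.1 x = germ M x m := by
      refine compactOpen_induction (p := fun U => ∃ m, ∀ x ∈ U, s.1 x = germ M x m)
        ⟨0, fun x hx => hx.elim⟩ (fun U V _ _ _ _ h => ?_)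
        (fun U V hc ho hc' ho' hd => ?_) s.2.2 (fun x _ => ?_)
      · rintro ⟨m, hm⟩
        exact ⟨m, fun x hx => hm x (h hx)⟩
      · rintro ⟨m, hm⟩ ⟨n, hn⟩
        refine ⟨M.act m (oneU R hc ho) + M.act n (oneU R hc' ho'), ?_⟩
        rintro x (hx | hx)
        · rw [hm x hx, map_add, germ_act_oneU M m hc ho hx,
            germ_oneU_of_notMem M n hc' ho' (hd.notMem_of_mem_left hx), add_zero]
        · rw [hn x hx, map_add, germ_act_oneU M n hc' ho' hx,
            germ_oneU_of_notMem M m hc ho (hd.notMem_of_mem_right hx), zero_add]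
      · obtain ⟨m, hm⟩ := germ_surjective M x (s.1 x)
        obtain ⟨U, hc, ho, hx, hU⟩ := exists_compactOpen
          (sections_eventually_eq s.2 (germ_section_mem M m) hm.symm)
        exact ⟨U, hc, ho, hx, m, fun z hz => hU hz⟩
    obtain ⟨U, hc, ho, hsU, m, hm⟩ := key
    refine ⟨M.act m (oneU R hc ho), Subtype.ext (funext fun x => ?_)⟩
    change germ M x (M.act m (oneU R hc ho)) = s.1 x
    by_cases hx : x ∈ U
    · rw [germ_act_oneU M m hc ho hx, hm x hx]
    · rw [germ_oneU_of_notMem M m hc ho hx]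
      by_contra h
      exact hx (hsU (Ne.symm h))

variable (R X) in
/-- Every unital module is naturally isomorphic to the sections of its sheaf of germs. -/
theorem sh_gammaC :
    Nonempty (𝟭 (UMod (SteinbergAlgebra R X)) ≅ sh R X ⋙ gammaC R X) := by
  let φ (M : UMod (SteinbergAlgebra R X)) : M ⟶ (sh R X ⋙ gammaC R X).obj M := gammaShHom M
  exact ⟨NatIso.ofComponents (fun M => @asIso _ _ _ _ (φ M)
    (UMod.isIso_of_bijective _ (gammaShHom_bijective M))) fun f => rfl⟩

variable (R X) in
/-- Steinberg's equivalence between modules over `A_R(G)` and `G`-sheaves of `R`-modules. -/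
theorem gammaC_sh_isEquivalence : (gammaC R X).IsEquivalence ∧ (sh R X).IsEquivalence := by
  obtain ⟨η⟩ := sh_gammaC R X
  obtain ⟨ε⟩ := gammaC_sh R X
  let e := CategoryTheory.Equivalence.mk (sh R X) (gammaC R X) η ε
  exact ⟨e.isEquivalence_inverse, e.isEquivalence_functor⟩

end GammaSh

/-! ### The graded and the neutral case -/

section GradedEquivalence

variable {X : Type u} [Groupoid.{u} X] [TopologicalSpace X] [TopologicalSpace (Arr X)]
  [IsAmpleGroupoid X] {Γ : Type v} [Group Γ] (κ : GroupoidGrading X Γ) (R : Type u) [CommRing R]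

/-- The isomorphisms of the ungraded case preserve degrees. -/
theorem grGammaC_grSh_isEquivalence :
    (grGammaC κ R).IsEquivalence ∧ (grSh κ R).IsEquivalence := by
  let φ (M : GrMod (steinbergGrading κ R)) : M ⟶ (grSh κ R ⋙ grGammaC κ R).obj M :=
    ⟨gammaShHom M.toUMod, fun {γ m} hm x => ⟨m, hm, rfl⟩⟩
  let ψ (E : GrSheaf κ R) : (grGammaC κ R ⋙ grSh κ R).obj E ⟶ E :=
    ⟨shGammaHom E.toGSheaf, by
      rintro γ x _ ⟨s, hs, rfl⟩
      exact hs x⟩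
  let η : 𝟭 _ ≅ grSh κ R ⋙ grGammaC κ R :=
    NatIso.ofComponents (fun M => @asIso _ _ _ _ (φ M)
      (GrMod.isIso_of_bijective _ (gammaShHom_bijective M.toUMod))) fun f => rfl
  let ε : grGammaC κ R ⋙ grSh κ R ≅ 𝟭 _ :=
    NatIso.ofComponents (fun E => @asIso _ _ _ _ (ψ E)
      (GrSheaf.isIso_of_bijective _ (germEval_bijective E.toGSheaf))) fun {E F} χ => by
        refine GrSheaf.Hom.ext (funext fun x => LinearMap.ext fun e => ?_)
        obtain ⟨s, rfl⟩ := germ_surjective (gammaObj E.toGSheaf) x e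
        rfl
  let e := CategoryTheory.Equivalence.mk _ _ η ε
  exact ⟨e.isEquivalence_inverse, e.isEquivalence_functor⟩

theorem neutralGammaC_neutralSh_isEquivalence :
    (neutralGammaC κ R).IsEquivalence ∧ (neutralSh κ R).IsEquivalence := by
  have h := gammaC_sh_isEquivalence R (Neutral κ)
  have := h.1
  have := h.2
  have := restrictEquiv_isEquivalence (neutralEquiv κ R)
  have := restrictEquiv_isEquivalence (neutralEquiv κ R).symm
  exact ⟨inferInstanceAs (_ ⋙ _).IsEquivalence, inferInstanceAs (_ ⋙ _).IsEquivalence⟩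

end GradedEquivalence

/-! ### Strong gradings of groupoids and of Steinberg algebras -/

section Strong

open IsAmpleGroupoid

variable {X : Type u} [Groupoid.{u} X] [TopologicalSpace X] [TopologicalSpace (Arr X)]
  [IsAmpleGroupoid X] {Γ : Type v} [Group Γ] {κ : GroupoidGrading X Γ} {R : Type u} [CommRing R]

/-- The set of inverses of the elements of `B`. -/
def invSet (B : Set (Arr X)) : Set (Arr X) := {k | arr (inv k.hom) ∈ B}

theorem IsCOB.invSet {B : Set (Arr X)} (hB : IsCOB B) : IsCOB (invSet B) := by
  have hinv : ∀ k : Arr X, arr (inv (arr (inv k.hom)).hom) = k := fun k => by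
    simp only [IsIso.inv_inv]
  refine ⟨?_, hB.isOpen.preimage continuous_invArr, fun k hk l hl h => ?_,
    fun k hk l hl h => ?_⟩
  · convert hB.isCompact.image (continuous_invArr (X := X))
    ext k
    constructor
    · exact fun hk => ⟨_, hk, hinv k⟩
    · rintro ⟨l, hl, rfl⟩
      change arr (inv (arr (inv l.hom)).hom) ∈ B
      rwa [hinv]
  · have := congrArg (fun k : Arr X => arr (inv k.hom)) (hB.injOn_right hk hl h)
    dsimp only at this
    rwa [hinv, hinv] at this
  · have := congrArg (fun k : Arr X => arr (inv k.hom)) (hB.injOn_left hk hl h)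
    dsimp only at this
    rwa [hinv, hinv] at this

/-- `1_{B⁻¹} 1_B = 1_{d(B)}`. -/
theorem one_invSet_mul {B : Set (Arr X)} (hB : IsCOB B)
    (hc : IsCompact (Quiver.Total.left '' B)) (ho : IsOpen (Quiver.Total.left '' B)) :
    one R hB.invSet * one R hB = oneU R hc ho := by
  refine steinberg_ext fun k => ?_
  rw [mul_apply]
  by_cases hk : ∃ y : Quiver.Star k.left, arr y.2 ∈ B
  · obtain ⟨y, hy⟩ := hk
    rw [pair_one_of_mem hB _ hy]
    by_cases h : k ∈ (unit : X → Arr X) '' (Quiver.Total.left '' B)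
    · refine Eq.trans (ind_of_mem ?_) (ind_of_mem h).symm
      obtain ⟨x, -, rfl⟩ := h
      change arr (inv (inv y.2 ≫ 𝟙 x)) ∈ B
      simpa using hy
    · refine Eq.trans (ind_of_notMem fun h' => h ?_) (ind_of_notMem h).symm
      have h' : arr (inv (inv y.2 ≫ k.hom)) ∈ B := h'
      have h1 := hB.injOn_right h' hy rfl
      obtain ⟨x, z, k⟩ := k
      simp only [IsIso.inv_comp, IsIso.inv_inv, Quiver.Total.mk.injEq] at h1
      obtain ⟨rfl, -, h2⟩ := h1
      refine ⟨z, ⟨_, hy, rfl⟩, ?_⟩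
      have h3 : inv k ≫ y.2 = 𝟙 z ≫ y.2 := by rw [Category.id_comp]; exact eq_of_heq h2
      have h4 : inv k = 𝟙 z := (cancel_mono _).1 h3
      have h5 : k = 𝟙 z := by
        have := IsIso.hom_inv_id k
        rwa [h4, Category.comp_id] at this
      rw [h5]
  · push Not at hk
    rw [pair_one_of_notMem hB _ hk]
    refine (ind_of_notMem ?_).symm
    rintro ⟨x, ⟨l, hl, rfl⟩, rfl⟩
    exact hk ⟨l.right, l.hom⟩ hl

/-- If `G` is strongly graded, the characteristic function of a sufficiently large compact open
set of units belongs to `A_γ A_{γ⁻¹}`. -/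
theorem exists_oneU_mem (h : κ.IsStrong) (γ : Γ) {K : Set X} (hK : IsCompact K) :
    ∃ U, IsCompact U ∧ IsOpen U ∧ K ⊆ U ∧ ∀ (hc : IsCompact U) (ho : IsOpen U),
      oneU R hc ho ∈ AddSubgroup.closure {c | ∃ a ∈ (steinbergGrading κ R).comp γ,
        ∃ b ∈ (steinbergGrading κ R).comp γ⁻¹, a * b = c} := by
  set I := AddSubgroup.closure {c | ∃ a ∈ (steinbergGrading κ R).comp γ,
    ∃ b ∈ (steinbergGrading κ R).comp γ⁻¹, a * b = c}
  have hmul : ∀ c ∈ I, ∀ e ∈ (steinbergGrading κ R).comp 1, c * e ∈ I := by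
    intro c hc e he
    induction hc using AddSubgroup.closure_induction with
    | mem c hc =>
      obtain ⟨a, ha, b, hb, rfl⟩ := hc
      refine AddSubgroup.subset_closure ⟨a, ha, b * e, ?_, (mul_assoc a b e).symm⟩
      have := (steinbergGrading κ R).mul_mem hb he
      rwa [mul_one] at this
    | zero =>
      rw [zero_mul]
      exact zero_mem _
    | add a b _ _ ha hb =>
      rw [add_mul]
      exact add_mem ha hb
    | neg a _ ha =>
      rw [neg_mul]
      exact neg_mem ha
  refine compactOpen_induction (p := fun U => ∀ (hc : IsCompact U) (ho : IsOpen U),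
    oneU R hc ho ∈ I) (fun hc ho => ?_) (fun U V hc ho _ _ hVU hU hc' ho' => ?_)
    (fun U V hc ho hc' ho' hd hU hV hc'' ho'' => ?_) hK (fun x _ => ?_)
  · have h0 : oneU R hc ho = 0 :=
      steinberg_ext fun k => ind_of_notMem (oneU_notMem (notMem_empty _) ⟨k.right, k.hom⟩)
    rw [h0]
    exact zero_mem _
  · rw [← oneU_mul_oneU hc ho hc' ho' hVU]
    exact hmul _ (hU hc ho) _ (oneU_mem_comp hc' ho')
  · rw [oneU_union hc ho hc' ho' hd hc'' ho'' rfl]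
    exact add_mem (hU hc ho) (hV hc' ho')
  -- Near `x`, take a bisection `B` of degree `γ⁻¹` through an arrow with domain `x`.
  · have hx : unit x ∈ mulSet (κ.comp γ) (κ.comp γ⁻¹) := by
      rw [h, mul_inv_cancel]
      exact deg_id κ x
    obtain ⟨a, y, b, l, g, -, hl, hk⟩ := hx
    obtain rfl : a = x := congrArg Quiver.Total.left hk
    obtain ⟨B, hB, hlB, hBγ⟩ := exists_cob ((isClopen_comp κ γ⁻¹).2.mem_nhds hl)
    have hc := hB.isCompact.image (continuous_left (X := X))
    have ho := isOpenMap_left (X := X) _ hB.isOpen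
    refine ⟨_, hc, ho, ⟨_, hlB, rfl⟩, fun hc ho => ?_⟩
    rw [← one_invSet_mul hB hc ho]
    refine AddSubgroup.subset_closure ⟨_, fun k hk => ?_, _, fun k hk => ?_, rfl⟩
    · have hk' : arr (inv k.hom) ∈ B := by_contra fun h' => hk (ind_of_notMem h')
      have h1 : κ.deg (inv k.hom) = γ⁻¹ := hBγ hk'
      rw [deg_inv, inv_inj] at h1
      exact h1
    · exact hBγ (by_contra fun h' => hk (ind_of_notMem h'))

/-- If `f` has degree `γδ`, then `f = 1_U f` for a large `U`, and `1_U ∈ A_γ A_{γ⁻¹}`. -/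
theorem steinberg_isStrong (h : κ.IsStrong) : (steinbergGrading κ R).IsStrong := by
  intro γ δ
  refine le_antisymm ((AddSubgroup.closure_le _).2 ?_) fun f hf => ?_
  · rintro _ ⟨a, ha, b, hb, rfl⟩
    exact (steinbergGrading κ R).mul_mem ha hb
  · obtain ⟨K, hcK, hoK, hK⟩ := exists_localUnit {f}
    have hK := (hK f (Finset.mem_singleton_self f)).1
    obtain ⟨U, hc, ho, hKU, hU⟩ := exists_oneU_mem (R := R) h γ hcK
    have hf' : oneU R hc ho * f = f := by
      rw [← hK, ← mul_assoc, oneU_mul_oneU hc ho hcK hoK hKU]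
    rw [← hf']
    refine AddSubgroup.closure_induction (p := fun e _ => e * f ∈ AddSubgroup.closure _)
      ?_ ?_ ?_ ?_ (hU hc ho)
    · rintro _ ⟨a, ha, b, hb, rfl⟩
      refine AddSubgroup.subset_closure ⟨a, ha, b * f, ?_, (mul_assoc a b f).symm⟩
      have := (steinbergGrading κ R).mul_mem hb hf
      rwa [inv_mul_cancel_left] at this
    · rw [zero_mul]
      exact zero_mem _
    · intro a b _ _ ha hb
      rw [add_mul]
      exact add_mem ha hb
    · intro a _ ha
      rw [neg_mul]
      exact neg_mem ha

theorem exists_factors_of_mul_ne_zero {f g : SteinbergAlgebra R X} {k : Arr X}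
    (h : (f * g).1 k ≠ 0) :
    ∃ y : Quiver.Star k.left, f.1 (arr (inv y.2 ≫ k.hom)) ≠ 0 ∧ g.1 (arr y.2) ≠ 0 := by
  rw [mul_apply, pair_apply] at h
  obtain ⟨y, hy, hne⟩ := Finset.exists_ne_zero_of_sum_ne_zero h
  exact ⟨y, right_ne_zero_of_smul hne, Finsupp.mem_support_iff.1 hy⟩

/-- If `k` has degree `γδ` and `k ∈ B` with `1_B ∈ A_γ A_δ`, then `1_B(k) ≠ 0` forces a product
`f g` with `f ∈ A_γ` and `g ∈ A_δ` not to vanish at `k`, which factors `k`. -/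
theorem isStrong_of_steinberg [Nontrivial R] (h : (steinbergGrading κ R).IsStrong) :
    κ.IsStrong := by
  intro γ δ
  ext k
  constructor
  · rintro ⟨x, y, z, l, g, hg, hl, rfl⟩
    have hg : κ.deg g = γ := hg
    have hl : κ.deg l = δ := hl
    exact (κ.deg_comp l g).trans (by rw [hg, hl])
  · intro hk
    have hk : κ.deg k.hom = γ * δ := hk
    have key : ∀ f ∈ AddSubgroup.closure {c | ∃ a ∈ (steinbergGrading κ R).comp γ,
        ∃ b ∈ (steinbergGrading κ R).comp δ, a * b = c}, f.1 k ≠ 0 →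
        k ∈ mulSet (κ.comp γ) (κ.comp δ) := by
      intro f hf
      induction hf using AddSubgroup.closure_induction with
      | mem f hf =>
        obtain ⟨a, ha, b, hb, rfl⟩ := hf
        intro hne
        obtain ⟨y, h1, h2⟩ := exists_factors_of_mul_ne_zero hne
        exact ⟨_, _, _, y.2, inv y.2 ≫ k.hom, ha _ h1, hb _ h2, by simp⟩
      | zero => exact fun h => absurd rfl h
      | add a b _ _ ha hb =>
        intro hne
        by_cases h1 : a.1 k = 0
        · refine hb fun h2 => hne ?_
          change a.1 k + b.1 k = 0
          rw [h1, h2, add_zero]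
        · exact ha h1
      | neg a _ ha =>
        refine fun hne => ha fun h1 => hne ?_
        change -(a.1 k) = 0
        rw [h1, neg_zero]
    obtain ⟨B, hB, hkB, hBγ⟩ := exists_homogeneous_cob (R := R) κ k
    rw [hk] at hBγ
    refine key (one R hB) ((h γ δ).symm ▸ hBγ) ?_
    change ind R B k ≠ 0
    rw [ind_of_mem hkB]
    exact one_ne_zero

end Strong

/-! ### Sections of the neutral component -/

section RestrictionSquare

variable {X : Type u} [Groupoid.{u} X] [TopologicalSpace X] [TopologicalSpace (Arr X)]
  [IsAmpleGroupoid X] {Γ : Type v} [Group Γ] {κ : GroupoidGrading X Γ} {R : Type u} [CommRing R]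

/-- Sums over `G^x` weighted by a function of degree `ε` are sums over `(G_ε)^x`. -/
theorem pair_resN {N : Type*} [AddCommGroup N] [Module R N] {g : SteinbergAlgebra R X}
    (hg : g ∈ steinbergComp κ R 1) (x : X) (φ : Quiver.Star x → N) :
    pair x φ g = pair (X := Neutral κ) x (fun y => φ (inclStar κ x y)) (resN κ R g) := by
  rw [pair, LinearMap.comp_apply, fib_resN κ R hg, Finsupp.linearCombination_mapDomain]
  rfl

variable (E : GrSheaf κ R)

theorem neutral_section_mem {s : ∀ x, E.stalk x} (hs : s ∈ sections E.toGSheaf)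
    (hs' : ∀ x, s x ∈ E.comp 1 x) :
    (fun x : X => (⟨s x, hs' x⟩ : E.comp 1 x)) ∈ sections (X := Neutral κ) (grNeutral E) := by
  refine ⟨(continuous_induced_rng (f := inclTot E)).2 hs.1, ?_⟩
  have h : {x : X | (⟨s x, hs' x⟩ : E.comp 1 x) ≠ 0} = {x | s x ≠ 0} :=
    Set.ext fun x => not_congr Subtype.ext_iff
  exact (congrArg IsCompact h).mpr hs.2

/-- The isomorphism `Γ_c(E)_ε → Γ_c(E_ε)`. -/
def neutralSections :
    (grGammaC κ R ⋙ modI (steinbergGrading κ R)).obj E ⟶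
      (sheafI κ R ⋙ neutralGammaC κ R).obj E where
  toFun := AddMonoidHom.mk' (fun s : sectionsComp E 1 =>
      (⟨_, neutral_section_mem E s.1.2 s.2⟩ : sections (X := Neutral κ) (grNeutral E)))
    fun s t => rfl
  map_act := fun (s : sectionsComp E 1) a => Subtype.ext (funext fun x : X => Subtype.ext (by
    refine (pair_resN a.2 x _).trans ?_
    exact (map_pair (X := Neutral κ) (E.comp 1 x).subtype x
      (fun y : @Quiver.Star (Neutral κ) _ x => neutralAct E y.2.1 y.2.2 ⟨s.1.1 y.1, s.2 y.1⟩)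
      (resN κ R a.1)).symm))

theorem neutralSections_bijective :
    Function.Bijective (UMod.Hom.toFun (neutralSections E)) := by
  constructor
  · intro (s : sectionsComp E 1) (t : sectionsComp E 1) h
    refine Subtype.ext (Subtype.ext (funext fun x => ?_))
    exact congrArg Subtype.val (congrFun (congrArg Subtype.val h) x)
  · intro (t : sections (X := Neutral κ) (grNeutral E))
    let t' (x : X) : E.comp 1 x := t.1 x
    have ht : (fun x => (t' x : E.stalk x)) ∈ sections E.toGSheaf := by
      refine ⟨(continuous_inclTot E).comp t.2.1, ?_⟩
      have h : {x : X | (t' x : E.stalk x) ≠ 0} = {x | t' x ≠ 0} :=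
        Set.ext fun x => not_congr ZeroMemClass.coe_eq_zero
      exact (congrArg IsCompact h).mpr t.2.2
    exact ⟨(⟨⟨_, ht⟩, fun x => (t' x).2⟩ : sectionsComp E 1), rfl⟩

variable (κ R) in
/-- Restriction commutes with taking sections. -/
theorem sheafI_neutralGammaC :
    Nonempty (grGammaC κ R ⋙ modI (steinbergGrading κ R) ≅ sheafI κ R ⋙ neutralGammaC κ R) :=
  ⟨NatIso.ofComponents (fun E => @asIso _ _ _ _ (neutralSections E)
    (UMod.isIso_of_bijective _ (neutralSections_bijective E))) fun f => rfl⟩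

end RestrictionSquare

/-! ### The neutral component of an induced sheaf -/

section InducedNeutral

open TensorProduct

variable {X : Type u} [Groupoid.{u} X] [TopologicalSpace X] [TopologicalSpace (Arr X)]
  [IsAmpleGroupoid X] {Γ : Type v} [Group Γ] {κ : GroupoidGrading X Γ} {R : Type u} [CommRing R]

/-- Continuity of a map on the total space of a sheaf can be tested on sections. -/
theorem GSheaf.continuous_of_sections (E : GSheaf R X) {Y : Type*} [TopologicalSpace Y]
    {f : E.Tot → Y} (hf : ∀ s ∈ sections E, Continuous fun x => f ⟨x, s x⟩) : Continuous f := by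
  refine continuous_iff_continuousAt.2 ?_
  rintro ⟨x, e⟩ V hV
  obtain ⟨s, hs, rfl, -⟩ := exists_section E e Filter.univ_mem
  have h : IsLocalHomeomorph ((Sigma.fst : E.Tot → X) ∘ fun x => ⟨x, s x⟩) :=
    (Homeomorph.refl X).isLocalHomeomorph
  have hopen := (h.of_comp E.isLocalHomeomorph_proj hs.1).isOpenMap
  change f ⁻¹' V ∈ 𝓝 _
  refine Filter.mem_of_superset (hopen.image_mem_nhds ((hf s hs).continuousAt hV)) ?_
  rintro _ ⟨z, hz, rfl⟩
  exact hz

variable (E : GSheaf R (Neutral κ))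

/-- The map `e ↦ e ⊗ p(e)`. -/
def toInd (x : X) : NStalk E x →ₗ[R] tComp E 1 x :=
  (ten (⟨x, 𝟙 x⟩ : Quiver.Star x)).codRestrict _ fun e => ten_mem (deg_id κ x) e

/-- If `g` has degree `ε`, then `e ⊗ g = e g ⊗ d(g)`; injectivity follows by evaluation at the
unit. -/
theorem toInd_bijective (x : X) : Function.Bijective (toInd E x) := by
  constructor
  · intro e e' h
    have h := congrArg (fun t : tComp E 1 x => tEval (⟨x, 𝟙 x⟩ : Quiver.Star x) t.1) h
    change tEval (⟨x, 𝟙 x⟩ : Quiver.Star x) (ten ⟨x, 𝟙 x⟩ e) =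
      tEval (⟨x, 𝟙 x⟩ : Quiver.Star x) (ten ⟨x, 𝟙 x⟩ e') at h
    rwa [tEval_self, tEval_self] at h
  · rintro ⟨t, ht⟩
    suffices h : t ∈ LinearMap.range (ten (E := E) (⟨x, 𝟙 x⟩ : Quiver.Star x)) by
      obtain ⟨e, he⟩ := h
      exact ⟨e, Subtype.ext he⟩
    refine Submodule.span_le.2 ?_ ht
    rintro _ ⟨⟨z, g⟩, e, hy, rfl⟩
    refine ⟨nAct E g hy e, ?_⟩
    rw [ten_act]
    exact ten_congr (Category.id_comp _) e

theorem continuous_secA (t : SecSrc E) :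
    Continuous fun x => (⟨x, secA E x t⟩ : (indObj E).Tot) :=
  ⟨fun V hV => by
    have := (isOpen_secTop_iff (F := TStalk E) (secA E) (secA_surjective E)
      (secA_near E)).1 hV t
    exact this⟩

/-- The section `x ↦ s(x) ⊗ x` is one of those that define the topology of `E ⊗_{G_ε} G`: it is
the one named by `s ⊗ 1_U`, if `U` contains the support of `s`. -/
theorem continuous_toInd_section (s : sections E) :
    Continuous fun x : X => (⟨x, ten (⟨x, 𝟙 x⟩ : Quiver.Star x) (ev x s)⟩ : (indObj E).Tot) := by
  obtain ⟨U, hc, ho, hU⟩ := exists_compactOpen_superset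
    (show IsCompact {x : X | ev x s ≠ 0} from s.2.2)
  convert continuous_secA E (s ⊗ₜ oneU R hc ho) using 2 with x
  refine congrArg (Sigma.mk x) ?_
  by_cases hx : x ∈ U
  · exact (secJ_one_of_mem s _ (oneU_mem hx)).symm
  · refine Eq.trans ?_ (secJ_one_of_notMem s _ (oneU_notMem hx)).symm
    have h0 : ev x s = 0 := by_contra fun h => hx (hU h)
    rw [h0, map_zero]

/-- The isomorphism `E → (E ⊗_{G_ε} G)_ε`, `e ↦ e ⊗ p(e)`. -/
def neutralInd : E ⟶ (sheafJ κ R ⋙ sheafI κ R).obj E where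
  app := toInd E
  continuous := GSheaf.continuous_of_sections E fun s hs =>
    (continuous_induced_rng (f := inclTot (indObj E))).2 (continuous_toInd_section E ⟨s, hs⟩)
  map_act {x y} g e := Subtype.ext (by
    refine (ten_act (E := E) (⟨x, 𝟙 (show X from x)⟩ : @Quiver.Star X _ x) g.1 g.2 e).trans ?_
    refine Eq.trans ?_ (tAct_ten (E := E) (X := X) g.1 ⟨y, 𝟙 (show X from y)⟩ e).symm
    exact ten_congr ((Category.id_comp g.1).trans (Category.comp_id g.1).symm) e)

variable (κ R) in
/-- For every grading, induction of sheaves followed by restriction is isomorphic to the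
identity. -/
theorem sheafJ_sheafI : Nonempty (𝟭 (GSheaf R (Neutral κ)) ≅ sheafJ κ R ⋙ sheafI κ R) := by
  refine ⟨NatIso.ofComponents (fun E => @asIso _ _ _ _ (neutralInd E)
    (GSheaf.isIso_of_bijective _ (toInd_bijective E))) fun {E F} φ => ?_⟩
  refine GSheaf.Hom.ext (funext fun x => LinearMap.ext fun e => Subtype.ext ?_)
  exact (tMap_ten φ (⟨x, 𝟙 (show X from x)⟩ : @Quiver.Star X _ x) e).symm

end InducedNeutral

end

end SG

theorem corollary3p13 {Γ : Type v} [Group Γ] {X : Type u} [CategoryTheory.Groupoid.{u} X]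
    [TopologicalSpace X] [TopologicalSpace (SG.Arr X)] [SG.IsAmpleGroupoid X]
    (κ : SG.GroupoidGrading X Γ) (R : Type u) [CommRing R] [Nontrivial R] :
    List.TFAE [
      κ.IsStrong,
      (SG.steinbergGrading κ R).IsStrong,
      (SG.sheafI κ R).IsEquivalence ∧ (SG.sheafJ κ R).IsEquivalence ∧
        (SG.modI (SG.steinbergGrading κ R)).IsEquivalence ∧
        (SG.modJ (SG.steinbergGrading κ R)).IsEquivalence ∧
        (SG.grGammaC κ R).IsEquivalence ∧ (SG.grSh κ R).IsEquivalence ∧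
        (SG.neutralGammaC κ R).IsEquivalence ∧ (SG.neutralSh κ R).IsEquivalence] := by
  tfae_have 1 → 2 := SG.steinberg_isStrong
  tfae_have 2 → 1 := SG.isStrong_of_steinberg
  tfae_have 3 → 2 := fun ⟨_, _, h, _⟩ => SG.isStrong_of_faithful h.faithful
  tfae_have 2 → 3 := by
    intro h
    obtain ⟨hI, hJ⟩ := SG.modI_modJ_isEquivalence h
    obtain ⟨hΓ, hSh⟩ := SG.grGammaC_grSh_isEquivalence κ R
    obtain ⟨hΓ', hSh'⟩ := SG.neutralGammaC_neutralSh_isEquivalence κ R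
    have hI' : (SG.sheafI κ R).IsEquivalence := by
      obtain ⟨η⟩ := SG.sheafI_neutralGammaC κ R
      have : (SG.sheafI κ R ⋙ SG.neutralGammaC κ R).IsEquivalence :=
        Functor.isEquivalence_of_iso η
      exact Functor.isEquivalence_of_comp_right _ (SG.neutralGammaC κ R)
    have hJ' : (SG.sheafJ κ R).IsEquivalence := by
      obtain ⟨η⟩ := SG.sheafJ_sheafI κ R
      have : (SG.sheafJ κ R ⋙ SG.sheafI κ R).IsEquivalence := Functor.isEquivalence_of_iso η
      exact Functor.isEquivalence_of_comp_right _ (SG.sheafI κ R)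
    exact ⟨hI', hJ', hI, hJ, hΓ, hSh, hΓ', hSh'⟩
  tfae_finish
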